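/- All trees are finite ordered rooted trees; $|T|$ is the number of nodes of $T$. A subtree of $T$ is a non-empty connected set of nodes of $T$, a root subtree is a subtree that contains the root, and $S(T)$, $R(T)$ are the numbers of subtrees and of root subtrees of $T$. Let $(w_i)_{i\ge0}$ be a sequence of real numbers, let $\Phi(z)=\sum_{i\ge0}w_iz^i$, and let $r\in[0,\infty]$ be its radius of convergence. Put $w(T)=\prod_{v\in T}w_{d(v)}$, where $d(v)$ is the number of children of $v$. For every $n$ with $\sum_{|T|=n}w(T)\ne0$ let $\mathcal T_n$ be the random tree with $\mathbb P(\mathcal T_n=T)=w(T)/\sum_{|T'|=n}w(T')$ for $|T|=n$. Assume one of the following. (i) (Simply generated trees.) $w_i\ge 0$ for all $i$, $w_0>0$, $r>0$, $\lim_{z\uparrow r}z\Phi'(z)/\Phi(z)>1$ (the limit may be $+\infty$), and $\lim_{z\uparrow r}\Phi'(z)=\infty$. (ii) (Conditioned Galton–Watson trees.) $w_i=\mathbb P(\xi=i)$ for a random variable $\xi$ with values in $\{0,1,2,\dots\}$ such that $\mathbb E\xi=1$, $0<\operatorname{Var}\xi<\infty$, $\mathbb Ee^{t\xi}<\infty$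 for some $t>0$, and $\lim_{z\uparrow r}\Phi'(z)=\infty$. For $m\ge0$ let $F_m(z)=\sum_Tw(T)R(T)^mz^{|T|}$, let $\rho_m$ be the radius of convergence of $F_m$, and let $\widehat F_m(z)=\sum_{k=0}^m\binom mkF_k(z)$. Then $\infty>\rho_0>\rho_1>\rho_2>\dots>0$, and for all $m\ge1$ and $\ell\ge0$ we have $\widehat F_\ell(\rho_{m+\ell})<r$ and $\rho_{m+\ell}\Phi'(\widehat F_\ell(\rho_{m+\ell}))<1$. Hence numbers $\alpha_{m,\ell}$ are well defined by $\alpha_{0,\ell}=1$ and, for $m\ge1$, $$\alpha_{m,\ell}=\frac{1+\rho_{m+\ell}\sum_{k=1}^{m-1}\binom mk\alpha_{k,m+\ell-k}\,\Phi'\bigl(\widehat F_{m+\ell-k}(\rho_{m+\ell})\bigr)}{1-\rho_{m+\ell}\,\Phi'\bigl(\widehat F_\ell(\rho_{m+\ell})\bigr)}.$$ Moreover, with $\tau_m=\rho_0/\rho_m$, so that $1=\tau_0<\tau_1<\tau_2<\dots$, there are numbers $\gamma_m>0$ $(m\ge0)$ and $\gamma'_{\ell,m}>0$ $(\ell,m\ge0)$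 with $\gamma'_{\ell,m}=\alpha_{m,\ell}\,\gamma_{\ell+m}$ such that, as $n\to\infty$ through the values for which $\mathcal T_n$ exists, for each fixed $m\ge0$, $$\mathbb E\,R(\mathcal T_n)^m=(1+O(n^{-1}))\,\gamma_m\,\tau_m^n ;$$ for each fixed $m\ge1$, with $\gamma'_m=\gamma'_{0,m}$, $$\mathbb E\,S(\mathcal T_n)^m=(1+O(n^{-1}))\,\gamma'_m\,\tau_m^n ;$$ and, more generally, for all fixed $\ell,m\ge0$, $$\mathbb E\bigl[R(\mathcal T_n)^\ell S(\mathcal T_n)^m\bigr]=(1+O(n^{-1}))\,\gamma'_{\ell,m}\,\tau_{\ell+m}^n .$$ The implied constants may depend on the sequence $(w_i)$ and on $\ell,m$, but not on $n$. -/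

import Mathlib

open Filter Topology MeasureTheory ProbabilityTheory

/-- A finite ordered (plane) rooted tree, in Ulam--Harris--Neveu coding: a node is the finite list
of child indices that leads to it from the root `[]`, so that the children of a node `u` are
`u ++ [0], u ++ [1], …, u ++ [d - 1]`. -/
@[ext]
structure OrderedTree where
  nodes : Finset (List ℕ)
  root_mem : [] ∈ nodes
  parent_mem : ∀ (u : List ℕ) (i : ℕ), u ++ [i] ∈ nodes → u ∈ nodes
  sibling_mem : ∀ (u : List ℕ) (i j : ℕ), j ≤ i → u ++ [i] ∈ nodes → u ++ [j] ∈ nodes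

/-- The parent--child graph on all possible nodes. -/
def nodeGraph : SimpleGraph (List ℕ) :=
  SimpleGraph.fromRel (fun u v => ∃ i : ℕ, v = u ++ [i])

namespace OrderedTree

/-- The number of nodes. -/
def size (T : OrderedTree) : ℕ := T.nodes.card

open Classical in
/-- The number of children of the node `u`. -/
noncomputable def outdegree (T : OrderedTree) (u : List ℕ) : ℕ :=
  (T.nodes.filter (fun v => ∃ i : ℕ, v = u ++ [i])).card

open Classical in
/-- The general (non-fringe) subtrees: the non-empty connected sets of nodes. -/
noncomputable def subtrees (T : OrderedTree) : Finset (Finset (List ℕ)) :=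
  T.nodes.powerset.filter (fun V => (nodeGraph.induce (V : Set (List ℕ))).Connected)

/-- The root subtrees: the subtrees that contain the root. -/
noncomputable def rootSubtrees (T : OrderedTree) : Finset (Finset (List ℕ)) :=
  T.subtrees.filter (fun V => [] ∈ V)

/-- The number `S(T)` of general subtrees. -/
noncomputable def numSubtrees (T : OrderedTree) : ℕ := T.subtrees.card

/-- The number `R(T)` of root subtrees. -/
noncomputable def numRootSubtrees (T : OrderedTree) : ℕ := T.rootSubtrees.card

/-- The weight `∏_v w_{d(v)}`. -/
noncomputable def weight (w : ℕ → ℝ) (T : OrderedTree) : ℝ :=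
  ∏ v ∈ T.nodes, w (T.outdegree v)

theorem prefix_mem (T : OrderedTree) (a b : List ℕ) (h : a ++ b ∈ T.nodes) : a ∈ T.nodes := by
  induction b using List.reverseRecOn with
  | nil => simpa using h
  | append_singleton b i ih =>
    exact ih (T.parent_mem (a ++ b) i (by simpa [List.append_assoc] using h))

theorem length_lt_size (T : OrderedTree) (u : List ℕ) (h : u ∈ T.nodes) :
    u.length < T.size := by
  have hinj : Set.InjOn (fun k => u.take k) (Finset.range (u.length + 1) : Set ℕ) := by
    intro k hk l hl hkl
    have h1 := congrArg List.length hkl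
    simp only [Finset.coe_range, Set.mem_Iio, List.length_take] at hk hl h1
    omega
  have := Finset.card_le_card_of_injOn (s := Finset.range (u.length + 1)) (t := T.nodes)
    (fun k => u.take k)
    (fun k _ => T.prefix_mem (u.take k) (u.drop k) (by simpa using h)) hinj
  simpa [size, Nat.succ_le_iff] using this

theorem entry_lt_size (T : OrderedTree) (u : List ℕ) (h : u ∈ T.nodes) (i : ℕ) (hi : i ∈ u) :
    i < T.size := by
  obtain ⟨a, b, rfl⟩ := List.append_of_mem hi
  have h1 : a ++ [i] ∈ T.nodes := T.prefix_mem (a ++ [i]) b (by simpa using h)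
  have := Finset.card_le_card_of_injOn (s := Finset.range (i + 1)) (t := T.nodes)
    (fun k => a ++ [k])
    (fun k hk => T.sibling_mem a i k (by simp at hk; omega) h1)
    (fun k _ l _ hkl => by simpa using hkl)
  simpa [size, Nat.succ_le_iff] using this

theorem finite_size_eq (n : ℕ) : {T : OrderedTree | T.size = n}.Finite := by
  have hL : {u : List ℕ | u.length ≤ n ∧ ∀ i ∈ u, i < n}.Finite := by
    refine ((List.finite_length_le (Fin n) n).image (List.map Fin.val)).subset ?_
    rintro u ⟨hu, hi⟩
    refine ⟨u.pmap (fun i h => ⟨i, h⟩) hi, by simpa using hu, ?_⟩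
    simp [List.map_pmap]
  have hP : {s : Finset (List ℕ) | s ⊆ hL.toFinset}.Finite := by
    refine (hL.toFinset.powerset).finite_toSet.subset fun s hs => ?_
    exact Finset.mem_coe.mpr (Finset.mem_powerset.mpr hs)
  refine Set.Finite.of_finite_image (f := OrderedTree.nodes) (hP.subset ?_) ?_
  · rintro _ ⟨T, hT, rfl⟩ u hu
    have hT' : T.size = n := hT
    refine (Set.Finite.mem_toFinset hL).mpr ?_
    exact ⟨hT' ▸ (T.length_lt_size u hu).le, fun i hi => hT' ▸ T.entry_lt_size u hu i hi⟩
  · intro T _ T' _ h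
    exact OrderedTree.ext h

/-- The finite set of all ordered trees with `n` nodes. -/
noncomputable def ofSize (n : ℕ) : Finset OrderedTree := (finite_size_eq n).toFinset

end OrderedTree

/-- The total weight of all ordered trees with `n` nodes. -/
noncomputable def totalWeight (w : ℕ → ℝ) (n : ℕ) : ℝ :=
  ∑ T ∈ OrderedTree.ofSize n, T.weight w

/-- The probability that the simply generated random tree of size `n` with weight sequence `w`
equals `T`, for a tree `T` with `n` nodes. If `w i` are the probabilities of an offspring
distribution, this is the law of the conditioned Galton--Watson tree of size `n`. The random tree
exists only if `totalWeight w n` is nonzero. -/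
noncomputable def treeProb (w : ℕ → ℝ) (n : ℕ) (T : OrderedTree) : ℝ :=
  T.weight w / totalWeight w n

/-- The expectation of `f` of the simply generated random tree of size `n`. -/
noncomputable def treeExp (w : ℕ → ℝ) (n : ℕ) (f : OrderedTree → ℝ) : ℝ :=
  ∑ T ∈ OrderedTree.ofSize n, treeProb w n T * f T

/-- `E f(T_n) = (1 + O(1/n)) c t ^ n`, where `n ≥ 1` ranges over the sizes for which the random
tree exists. -/
def HasExpAsymptotics (w : ℕ → ℝ) (f : OrderedTree → ℝ) (c t : ℝ) : Prop :=
  ∃ C : ℝ, ∀ n : ℕ, 1 ≤ n → totalWeight w n ≠ 0 →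
    |treeExp w n f / (c * t ^ n) - 1| ≤ C / n

/-- The sum of the power series with coefficients `a`. -/
noncomputable def seriesSum (a : ℕ → ℝ) (x : ℝ) : ℝ := ∑' i : ℕ, a i * x ^ i

/-- The radius of convergence of the power series with coefficients `a`. -/
noncomputable def seriesRadius (a : ℕ → ℝ) : ENNReal :=
  (FormalMultilinearSeries.ofScalars ℝ a).radius

/-- The filter of real numbers that tend to the extended number `r > 0` from below. -/
def leftOf (r : ENNReal) : Filter ℝ := comap ENNReal.ofReal (𝓝[<] r)

/-- `lim_{z ↑ R} Φ'(z) = ∞`, where `R` is the radius of convergence of the generator `Φ` of `w`. -/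
def DerivTendsToInfinity (w : ℕ → ℝ) : Prop :=
  Tendsto (deriv (seriesSum w)) (leftOf (seriesRadius w)) atTop

/-- Assumptions on the weight sequence of a simply generated tree, with generator
`Φ(z) = ∑ w_i z^i` of radius of convergence `R`: `w_i ≥ 0`, `w_0 > 0`, `R > 0`,
`lim_{z ↑ R} z Φ'(z) / Φ(z) > 1` (the limit may be infinite), and `lim_{z ↑ R} Φ'(z) = ∞`. -/
structure SimplyGeneratedAssumptions (w : ℕ → ℝ) : Prop where
  nonneg : ∀ i, 0 ≤ w i
  zero_pos : 0 < w 0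
  radius_pos : 0 < seriesRadius w
  ratio_limit : ∃ ν : EReal, 1 < ν ∧
    Tendsto (fun z : ℝ => ((z * deriv (seriesSum w) z / seriesSum w z : ℝ) : EReal))
      (leftOf (seriesRadius w)) (𝓝 ν)
  deriv_limit : DerivTendsToInfinity w

/-- Assumptions on the offspring distribution `ξ` of a Galton--Watson tree: `E ξ = 1`,
`0 < Var ξ < ∞`, `E exp(t ξ) < ∞` for some `t > 0`, and `lim_{z ↑ R} Φ'(z) = ∞` for the probability
generating function `Φ` with radius of convergence `R`. -/
structure GaltonWatsonAssumptions (p : PMF ℕ) : Prop where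
  mean_one : ∫ i : ℕ, (i : ℝ) ∂p.toMeasure = 1
  variance_finite : MemLp (fun i : ℕ => (i : ℝ)) 2 p.toMeasure
  variance_pos : 0 < variance (fun i : ℕ => (i : ℝ)) p.toMeasure
  exp_moment : ∃ t : ℝ, 0 < t ∧ Integrable (fun i : ℕ => Real.exp (t * i)) p.toMeasure
  deriv_limit : DerivTendsToInfinity (fun i => (p i).toReal)

/-- The coefficient of `z ^ n` in `F_m(z) = ∑_T w(T) R(T)^m z^|T|`. -/
noncomputable def rootCoeff (w : ℕ → ℝ) (m n : ℕ) : ℝ :=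
  ∑ T ∈ OrderedTree.ofSize n, T.weight w * (T.numRootSubtrees : ℝ) ^ m

/-- The radius of convergence `ρ_m` of `F_m`, as an extended number. -/
noncomputable def rootRadius (w : ℕ → ℝ) (m : ℕ) : ENNReal := seriesRadius (rootCoeff w m)

/-- The radius of convergence `ρ_m` of `F_m`, as a real number. -/
noncomputable def rho (w : ℕ → ℝ) (m : ℕ) : ℝ := (rootRadius w m).toReal

/-- `\widehat F_m(z) = ∑_{k=0}^m (m choose k) F_k(z)`. -/
noncomputable def hatF (w : ℕ → ℝ) (m : ℕ) (z : ℝ) : ℝ :=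
  ∑ k ∈ Finset.range (m + 1), (m.choose k : ℝ) * seriesSum (rootCoeff w k) z

/-- The constants `α_{m,ℓ}`: `α_{0,ℓ} = 1` and, for `m ≥ 1`, with `N = m + ℓ`,
`α_{m,ℓ} = (1 + ρ_N ∑_{k=1}^{m-1} (m choose k) α_{k,N-k} Φ'(\widehat F_{N-k}(ρ_N)))
  / (1 - ρ_N Φ'(\widehat F_ℓ(ρ_N)))`. -/
noncomputable def alpha (w : ℕ → ℝ) (m l : ℕ) : ℝ :=
  if m = 0 then 1 else
    (1 + rho w (m + l) * ∑ k ∈ (Finset.Ico 1 m).attach,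
        (m.choose k.1 : ℝ) * alpha w k.1 (m + l - k.1) *
          deriv (seriesSum w) (hatF w (m + l - k.1) (rho w (m + l)))) /
      (1 - rho w (m + l) * deriv (seriesSum w) (hatF w l (rho w (m + l))))
termination_by m
decreasing_by exact (Finset.mem_Ico.mp k.2).2

/-! Cutting a tree at its root into branches T_i gives R(T) = ∏ (1 + R(T_i)) and S(T) = R(T) + ∑
S(T_i) (`numRootSubtrees_graft`, `numSubtrees_graft`). The first identity yields F_m = z Φ(F̂_m), so
H = F̂_m solves H = G + z Φ(H), where G = ∑_{k<m} C(m,k) F_k involves lower moments only.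

Radii. Sums are first taken in [0, ∞], where F̂_m(x) lies below every s with G(x) + x Φ(s) ≤ s
(`hatGF_le_of_fixedPoint`). A tangent inequality gives x Φ'(F̂_m(x)) < 1 for x < ρ_m. By
semicontinuity the value at ρ_m is at most 1, and since Φ' = ∞ from r on, F̂_m(ρ_m) < r. If that
value were below 1 while G converges beyond ρ_m, the inequality would stay solvable slightly beyond
ρ_m. Hence ρ_m Φ'(F̂_m(ρ_m)) = 1 (`mul_ePhiDeriv_eq_one`), by induction: equality for m forces
ρ_{m+1} < ρ_m because F̂_{m+1} > F̂_m, and then the next G converges beyond ρ_{m+1}.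

Singularities. The characteristic equation makes H = G + z Φ(H) degenerate to exactly second order
at ρ_m. So F_m is there an analytic function of (ρ_m - z)^{1/2} with linear coefficient c_m < 0
(`TreeEquation.sqrtSing`). With d the gcd of the outdegrees of positive weight, F_m continues
analytically past every other point ζ of the circle with ζ^d ≠ ρ_m^d.

Coefficients. After rescaling, explicit odd powers of (1 - z)^{1/2} and their rotations by d-th
roots of unity are subtracted. The rest has bounded third derivative in the open disc, so Cauchy's
estimate makes its coefficients O(n^{-3}), which is a relative error O(1/n)
(`SqrtSing.unit_coeff_asymptotics`).

Mixed moments. Expanding S = R + ∑ S(T_i) shows that, with N = ℓ + m, the generating function of R^ℓ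
S^m satisfies a linear equation with factor 1 - z Φ'(F̂_ℓ), whose right side contains F_N, the
functions of R^{N-j} S^j with 0 < j < m, and a function regular at ρ_N (`exists_moment_eq`).
Comparing linear coefficients at ρ_N gives α_{m,ℓ} c_N, with exactly the recursion defining α
(`sqrtSing_momentFun`). Dividing by the coefficients of F_0 gives the moments. -/

open scoped ENNReal

/-! ### Decomposition of a tree at its root -/

namespace OrderedTree

theorem mem_of_prefix_mem (T : OrderedTree) {a b : List ℕ} (hab : a <+: b) (h : b ∈ T.nodes) :
    a ∈ T.nodes := by
  obtain ⟨c, rfl⟩ := hab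
  exact T.prefix_mem a c h

/-- The tree whose root has the `n` branches `c 0, …, c (n - 1)`. -/
def graft (n : ℕ) (c : Fin n → OrderedTree) : OrderedTree where
  nodes := insert [] (Finset.univ.biUnion fun i : Fin n => (c i).nodes.image (i.val :: ·))
  root_mem := Finset.mem_insert_self _ _
  parent_mem := by
    intro u i h
    rcases u with _ | ⟨k, u⟩
    · simp
    · simp only [Finset.mem_insert, Finset.mem_biUnion, Finset.mem_image, List.cons_append] at h ⊢
      rcases h with h | ⟨j, -, v, hv, hv'⟩
      · simp at h
      · simp only [List.cons.injEq] at hv'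
        obtain ⟨rfl, rfl⟩ := hv'
        exact Or.inr ⟨j, Finset.mem_univ _, u, (c j).parent_mem u i hv, rfl⟩
  sibling_mem := by
    intro u i j hij h
    rcases u with _ | ⟨k, u⟩
    · simp only [Finset.mem_insert, Finset.mem_biUnion, Finset.mem_image, List.nil_append] at h ⊢
      rcases h with h | ⟨a, -, v, hv, hv'⟩
      · simp at h
      · simp only [List.cons.injEq] at hv'
        exact Or.inr ⟨⟨j, by omega⟩, Finset.mem_univ _, [], (c _).root_mem, rfl⟩
    · simp only [Finset.mem_insert, Finset.mem_biUnion, Finset.mem_image, List.cons_append] at h ⊢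
      rcases h with h | ⟨a, -, v, hv, hv'⟩
      · simp at h
      · simp only [List.cons.injEq] at hv'
        obtain ⟨rfl, rfl⟩ := hv'
        exact Or.inr ⟨a, Finset.mem_univ _, u ++ [j], (c a).sibling_mem u i j hij hv, rfl⟩

variable {n : ℕ} (c : Fin n → OrderedTree)

theorem cons_mem_graft {k : ℕ} {u : List ℕ} :
    k :: u ∈ (graft n c).nodes ↔ ∃ h : k < n, u ∈ (c ⟨k, h⟩).nodes := by
  simp only [graft, Finset.mem_insert, Finset.mem_biUnion, Finset.mem_image, Finset.mem_univ,
    true_and, reduceCtorEq, false_or, List.cons.injEq]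
  constructor
  · rintro ⟨i, v, hv, rfl, rfl⟩
    exact ⟨i.2, hv⟩
  · rintro ⟨h, hu⟩
    exact ⟨⟨k, h⟩, u, hu, rfl, rfl⟩

theorem fin_cons_mem_graft {i : Fin n} {u : List ℕ} :
    i.val :: u ∈ (graft n c).nodes ↔ u ∈ (c i).nodes := by
  simp [cons_mem_graft]

theorem cons_injective (k : ℕ) : Function.Injective (fun u : List ℕ => k :: u) :=
  fun _ _ h => (List.cons.inj h).2

theorem pairwiseDisjoint_branches (V : Fin n → Finset (List ℕ)) :
    ((Finset.univ : Finset (Fin n)) : Set (Fin n)).PairwiseDisjoint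
      (fun i => (V i).image (i.val :: ·)) := by
  intro i _ j _ hij
  rw [Function.onFun, Finset.disjoint_left]
  intro u hu hu'
  simp only [Finset.mem_image] at hu hu'
  obtain ⟨a, -, rfl⟩ := hu
  obtain ⟨b, -, hb⟩ := hu'
  simp only [List.cons.injEq] at hb
  exact hij (Fin.ext hb.1.symm)

theorem prod_graft {M : Type*} [CommMonoid M] (f : List ℕ → M) :
    ∏ u ∈ (graft n c).nodes, f u = f [] * ∏ i, ∏ u ∈ (c i).nodes, f (i.val :: u) := by
  rw [graft, Finset.prod_insert (by simp), Finset.prod_biUnion (pairwiseDisjoint_branches _)]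
  congr 1
  refine Finset.prod_congr rfl fun i _ => ?_
  rw [Finset.prod_image (fun _ _ _ _ h => cons_injective _ h)]

theorem size_graft : (graft n c).size = 1 + ∑ i, (c i).size := by
  have h : (graft n c).nodes.card = 1 + ∑ i, (c i).nodes.card := by
    rw [graft, Finset.card_insert_of_notMem (by simp),
      Finset.card_biUnion (pairwiseDisjoint_branches _), add_comm]
    congr 1
    exact Finset.sum_congr rfl fun i _ => Finset.card_image_of_injective _ (cons_injective _)
  exact h

theorem outdegree_graft_nil : (graft n c).outdegree [] = n := by
  classical
  have : (graft n c).nodes.filter (fun v => ∃ i : ℕ, v = [] ++ [i]) =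
      Finset.univ.image (fun i : Fin n => [i.val]) := by
    ext v
    simp only [Finset.mem_filter, List.nil_append, Finset.mem_image, Finset.mem_univ, true_and]
    constructor
    · rintro ⟨hv, i, rfl⟩
      obtain ⟨h, -⟩ := (cons_mem_graft c).1 hv
      exact ⟨⟨i, h⟩, rfl⟩
    · rintro ⟨i, rfl⟩
      exact ⟨(cons_mem_graft c).2 ⟨i.2, (c i).root_mem⟩, i, rfl⟩
  rw [outdegree]
  convert congrArg Finset.card this using 1
  rw [Finset.card_image_of_injective _ (fun i j h => by simpa [Fin.ext_iff] using h)]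
  simp

theorem outdegree_graft_cons (i : Fin n) (u : List ℕ) :
    (graft n c).outdegree (i.val :: u) = (c i).outdegree u := by
  classical
  have : (graft n c).nodes.filter (fun v => ∃ j : ℕ, v = (i.val :: u) ++ [j]) =
      ((c i).nodes.filter (fun v => ∃ j : ℕ, v = u ++ [j])).image (i.val :: ·) := by
    ext v
    simp only [Finset.mem_filter, List.cons_append, Finset.mem_image]
    constructor
    · rintro ⟨hv, j, rfl⟩
      exact ⟨u ++ [j], ⟨(fin_cons_mem_graft c).1 hv, j, rfl⟩, rfl⟩
    · rintro ⟨_, ⟨hv, j, rfl⟩, rfl⟩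
      exact ⟨(fin_cons_mem_graft c).2 hv, j, rfl⟩
  rw [outdegree, outdegree]
  convert congrArg Finset.card this using 1
  rw [Finset.card_image_of_injective _ (cons_injective _)]

theorem weight_graft (w : ℕ → ℝ) :
    (graft n c).weight w = w n * ∏ i, (c i).weight w := by
  rw [weight, prod_graft, outdegree_graft_nil]
  simp only [outdegree_graft_cons, weight]

/-- The descendants of the node `r` in `V`, relative to `r`. -/
noncomputable def below (V : Finset (List ℕ)) (r : List ℕ) : Finset (List ℕ) :=
  V.preimage (r ++ ·) (List.append_right_injective r).injOn

theorem mem_below {V : Finset (List ℕ)} {r u : List ℕ} : u ∈ below V r ↔ r ++ u ∈ V := by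
  rw [below, Finset.mem_preimage]

/-- Restriction of a set of nodes to the `k`-th branch. -/
noncomputable def restrict (V : Finset (List ℕ)) (k : ℕ) : Finset (List ℕ) := below V [k]

theorem mem_restrict {V : Finset (List ℕ)} {k : ℕ} {u : List ℕ} :
    u ∈ restrict V k ↔ k :: u ∈ V := by
  rw [restrict, mem_below, List.singleton_append]

/-- The branch of `T` at the child `i` of the root. -/
noncomputable def branch (T : OrderedTree) (i : ℕ) (hi : [i] ∈ T.nodes) : OrderedTree where
  nodes := restrict T.nodes i
  root_mem := mem_restrict.2 hi
  parent_mem := by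
    intro u j h
    rw [mem_restrict] at h ⊢
    exact T.parent_mem (i :: u) j h
  sibling_mem := by
    intro u a b hab h
    rw [mem_restrict] at h ⊢
    exact T.sibling_mem (i :: u) a b hab h

theorem exists_root_degree (T : OrderedTree) : ∃ n, ∀ i, [i] ∈ T.nodes ↔ i < n := by
  classical
  have hex : ∃ n, [n] ∉ T.nodes := by
    refine ⟨T.size, fun h => ?_⟩
    exact lt_irrefl _ (T.entry_lt_size _ h T.size (by simp))
  refine ⟨Nat.find hex, fun i => ⟨fun h => ?_, fun h => ?_⟩⟩
  · by_contra hlt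
    exact Nat.find_spec hex (T.sibling_mem [] i _ (not_lt.1 hlt) h)
  · by_contra hn
    exact Nat.find_min hex h hn

/-- The outdegree of the root recovers `n`, and stripping the first letter of the nodes recovers the
branches. Sums over trees thereby become sums over tuples of trees. -/
theorem graft_bijective :
    Function.Bijective (fun p : Σ n, (Fin n → OrderedTree) => graft p.1 p.2) := by
  constructor
  · rintro ⟨n, c⟩ ⟨n', c'⟩ h
    simp only at h
    obtain rfl : n = n' := by rw [← outdegree_graft_nil c, h, outdegree_graft_nil]
    congr 1
    funext i
    ext u
    rw [← fin_cons_mem_graft c, h, fin_cons_mem_graft]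
  · intro T
    obtain ⟨n, hn⟩ := T.exists_root_degree
    refine ⟨⟨n, fun i => T.branch i ((hn i).2 i.2)⟩, ?_⟩
    ext u
    rcases u with _ | ⟨k, u⟩
    · simp [root_mem]
    · rw [cons_mem_graft]
      constructor
      · rintro ⟨h, hu⟩
        simpa [branch, mem_restrict] using hu
      · intro h
        exact ⟨(hn k).1 (T.mem_of_prefix_mem (by simp) h), by simpa [branch, mem_restrict] using h⟩

/-- The decomposition of a tree into the branches at its root. -/
noncomputable def graftEquiv : (Σ n, (Fin n → OrderedTree)) ≃ OrderedTree :=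
  Equiv.ofBijective _ graft_bijective

theorem graftEquiv_apply (p : Σ n, (Fin n → OrderedTree)) : graftEquiv p = graft p.1 p.2 := rfl

theorem size_pos (T : OrderedTree) : 0 < T.size := Finset.card_pos.2 ⟨[], T.root_mem⟩

/-- Structural induction on ordered trees. -/
theorem graft_induction {P : OrderedTree → Prop}
    (h : ∀ n (c : Fin n → OrderedTree), (∀ i, P (c i)) → P (graft n c)) (T : OrderedTree) :
    P T := by
  induction hs : T.size using Nat.strong_induction_on generalizing T with
  | _ s ih =>
    obtain ⟨⟨n, c⟩, rfl⟩ := graft_bijective.2 T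
    refine h n c fun i => ih _ ?_ _ rfl
    rw [← hs, size_graft]
    have := Finset.single_le_sum (f := fun i => (c i).size) (fun _ _ => Nat.zero_le _)
      (Finset.mem_univ i)
    simp only at *
    omega

/-! ### Subtrees -/

/-- A finite set of nodes that is a root subtree of some tree: it contains the root and the parents
of its elements. -/
def IsRootClosed (V : Finset (List ℕ)) : Prop :=
  [] ∈ V ∧ ∀ (u : List ℕ) (i : ℕ), u ++ [i] ∈ V → u ∈ V

theorem nodeGraph_adj_iff {u v : List ℕ} :
    nodeGraph.Adj u v ↔ (∃ i, v = u ++ [i]) ∨ ∃ i, u = v ++ [i] := by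
  rw [nodeGraph, SimpleGraph.fromRel_adj]
  constructor
  · rintro ⟨-, h⟩
    exact h
  · intro h
    refine ⟨?_, h⟩
    rintro rfl
    rcases h with ⟨i, hi⟩ | ⟨i, hi⟩ <;> simpa using congrArg List.length hi

/-- Removing last letters leads from any node to the root without leaving the set. -/
theorem IsRootClosed.connected_image {V : Finset (List ℕ)} (hV : IsRootClosed V) (r : List ℕ) :
    (nodeGraph.induce ((V.image (r ++ ·) : Finset (List ℕ)) : Set (List ℕ))).Connected := by
  have hmem : ∀ {u}, u ∈ V → r ++ u ∈ ((V.image (r ++ ·) : Finset (List ℕ)) : Set (List ℕ)) :=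
    fun hu => by simpa using hu
  have key : ∀ u (hu : u ∈ V),
      (nodeGraph.induce ((V.image (r ++ ·) : Finset (List ℕ)) : Set (List ℕ))).Reachable
        ⟨r ++ [], hmem hV.1⟩ ⟨r ++ u, hmem hu⟩ := by
    intro u
    induction u using List.reverseRecOn with
    | nil => intro _; exact SimpleGraph.Reachable.rfl
    | append_singleton u i ih =>
      intro hu
      refine (ih (hV.2 u i hu)).trans (SimpleGraph.Adj.reachable ?_)
      rw [SimpleGraph.induce_adj, nodeGraph_adj_iff]
      exact Or.inl ⟨i, by simp⟩
  rw [SimpleGraph.connected_iff_exists_forall_reachable]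
  refine ⟨⟨r ++ [], hmem hV.1⟩, ?_⟩
  rintro ⟨x, hx⟩
  obtain ⟨u, hu, rfl⟩ := Finset.mem_image.1 (Finset.mem_coe.1 hx)
  exact key u hu

/-- The root is a node `r` of minimal length. Along a walk ending in `r`, read backwards, every node
extends `r` and has all intermediate prefixes in `V`; the only step that could break this goes to
the parent of `r`, which is shorter than `r`. -/
theorem exists_root_of_connected {V : Finset (List ℕ)}
    (hV : (nodeGraph.induce (V : Set (List ℕ))).Connected) :
    ∃ r U, IsRootClosed U ∧ V = U.image (r ++ ·) := by
  obtain ⟨⟨x, hx⟩⟩ := hV.nonempty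
  obtain ⟨r, hr, hmin⟩ := Finset.exists_min_image V List.length ⟨x, hx⟩
  have key : ∀ v (hv : v ∈ V), ∃ u, v = r ++ u ∧ ∀ a, a <+: u → r ++ a ∈ V := by
    intro v hv
    have hreach := hV.preconnected ⟨r, hr⟩ ⟨v, hv⟩
    obtain ⟨p⟩ := hreach.symm
    suffices h : ∀ (y z : (V : Set (List ℕ))) (q : (nodeGraph.induce (V : Set (List ℕ))).Walk y z),
        z.1 = r → ∃ u, y.1 = r ++ u ∧ ∀ a, a <+: u → r ++ a ∈ V from h _ _ p rfl
    intro y z q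
    induction q with
    | nil =>
      rintro hz
      refine ⟨[], by simpa using hz, fun a ha => ?_⟩
      simp only [List.prefix_nil] at ha
      simpa [ha] using hr
    | @cons a b z hab q ih =>
      intro hz
      obtain ⟨u, hu, hpre⟩ := ih hz
      rw [SimpleGraph.induce_adj, nodeGraph_adj_iff] at hab
      rcases hab with ⟨i, hi⟩ | ⟨i, hi⟩
      · rcases List.eq_nil_or_concat u with rfl | ⟨u', j, rfl⟩
        · have h1 := hmin _ a.2
          have h2 : r.length = a.1.length + 1 := by
            have := congrArg List.length (hu.symm.trans hi)
            simpa using this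
          omega
        · have h1 : a.1 ++ [i] = (r ++ u') ++ [j] := by rw [← hi, hu]; simp
          refine ⟨u', (List.append_inj' h1 rfl).1, fun s hs => hpre s (hs.trans ?_)⟩
          simp
      · refine ⟨u ++ [i], by rw [hi, hu, List.append_assoc], fun s hs => ?_⟩
        rcases List.prefix_concat_iff.1 (by simpa using hs) with h | h
        · rw [h, ← List.append_assoc, ← hu, ← hi]
          exact a.2
        · exact hpre s h
  classical
  refine ⟨r, below V r, ⟨?_, ?_⟩, ?_⟩
  · simpa [mem_below] using hr
  · intro u i hu
    rw [mem_below] at hu ⊢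
    obtain ⟨u', hu', hpre⟩ := key _ hu
    exact hpre u (by rw [← List.append_cancel_left hu']; simp)
  · ext v
    simp only [Finset.mem_image, mem_below]
    constructor
    · intro hv
      obtain ⟨u, rfl, -⟩ := key v hv
      exact ⟨u, hv, rfl⟩
    · rintro ⟨u, hu, rfl⟩
      exact hu

theorem mem_subtrees {T : OrderedTree} {V : Finset (List ℕ)} :
    V ∈ T.subtrees ↔ V ⊆ T.nodes ∧ ∃ r U, IsRootClosed U ∧ V = U.image (r ++ ·) := by
  classical
  rw [subtrees, Finset.mem_filter, Finset.mem_powerset]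
  refine and_congr_right fun _ => ⟨exists_root_of_connected, ?_⟩
  rintro ⟨r, U, hU, rfl⟩
  exact hU.connected_image r

theorem mem_rootSubtrees {T : OrderedTree} {V : Finset (List ℕ)} :
    V ∈ T.rootSubtrees ↔ V ⊆ T.nodes ∧ IsRootClosed V := by
  classical
  rw [rootSubtrees, Finset.mem_filter, mem_subtrees]
  constructor
  · rintro ⟨⟨h, r, U, hU, rfl⟩, hn⟩
    obtain ⟨u, -, hu⟩ := Finset.mem_image.1 hn
    obtain ⟨rfl, rfl⟩ := List.append_eq_nil_iff.1 hu
    exact ⟨h, by simpa using hU⟩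
  · rintro ⟨h, hV⟩
    exact ⟨⟨h, [], V, hV, by simp⟩, hV.1⟩

theorem IsRootClosed.nil_mem_restrict {V : Finset (List ℕ)} (hV : IsRootClosed V) {k : ℕ}
    {u : List ℕ} (h : u ∈ restrict V k) : [] ∈ restrict V k := by
  induction u using List.reverseRecOn with
  | nil => exact h
  | append_singleton u i ih =>
    refine ih ?_
    rw [mem_restrict] at h ⊢
    exact hV.2 (k :: u) i h

/-- A root subtree consists of the root and an independent choice in each branch: nothing, or a root
subtree of the branch. -/
theorem numRootSubtrees_graft :
    (graft n c).numRootSubtrees = ∏ i, (1 + (c i).numRootSubtrees) := by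
  classical
  have hempty : ∀ i, ∅ ∉ (c i).rootSubtrees := by
    intro i h
    simpa using (mem_rootSubtrees.1 h).2.1
  have hcard : ∀ i, (insert ∅ (c i).rootSubtrees).card = 1 + (c i).numRootSubtrees := by
    intro i
    rw [Finset.card_insert_of_notMem (hempty i), numRootSubtrees, add_comm]
  simp_rw [← hcard]
  rw [← Fintype.card_piFinset, numRootSubtrees]
  have hmem : ∀ {i : Fin n} {W : Finset (List ℕ)}, W ∈ insert ∅ (c i).rootSubtrees →
      W ⊆ (c i).nodes ∧ ∀ u j, u ++ [j] ∈ W → u ∈ W := by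
    intro i W hW
    rcases Finset.mem_insert.1 hW with rfl | hW
    · simp
    · exact ⟨(mem_rootSubtrees.1 hW).1, (mem_rootSubtrees.1 hW).2.2⟩
  refine Finset.card_bij' (fun V _ => fun i : Fin n => restrict V i.val)
    (fun W _ => insert [] (Finset.univ.biUnion fun i : Fin n =>
        (W i).image (i.val :: ·))) ?_ ?_ ?_ ?_
  · intro V hV
    obtain ⟨hsub, hcl⟩ := mem_rootSubtrees.1 hV
    rw [Fintype.mem_piFinset]
    intro i
    rw [Finset.mem_insert]
    rcases Finset.eq_empty_or_nonempty (restrict V i.val) with h | ⟨u, hu⟩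
    · exact Or.inl h
    · refine Or.inr (mem_rootSubtrees.2 ⟨fun v hv => ?_, hcl.nil_mem_restrict hu, ?_⟩)
      · exact (fin_cons_mem_graft c).1 (hsub (mem_restrict.1 hv))
      · intro v j hv
        rw [mem_restrict] at hv ⊢
        exact hcl.2 (i.val :: v) j hv
  · intro W hW
    rw [Fintype.mem_piFinset] at hW
    refine mem_rootSubtrees.2 ⟨?_, by simp, ?_⟩
    · intro v hv
      simp only [Finset.mem_insert, Finset.mem_biUnion, Finset.mem_image, Finset.mem_univ,
        true_and] at hv
      rcases hv with rfl | ⟨i, u, hu, rfl⟩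
      · exact root_mem _
      · exact (fin_cons_mem_graft c).2 ((hmem (hW i)).1 hu)
    · intro u j hu
      rcases u with _ | ⟨k, u⟩
      · simp
      · simp only [Finset.mem_insert, Finset.mem_biUnion, Finset.mem_image, Finset.mem_univ,
          true_and, List.cons_append, reduceCtorEq, false_or, List.cons.injEq] at hu ⊢
        obtain ⟨i, v, hv, rfl, rfl⟩ := hu
        exact ⟨i, u, (hmem (hW i)).2 u j hv, rfl, rfl⟩
  · intro V hV
    obtain ⟨hsub, hcl⟩ := mem_rootSubtrees.1 hV
    ext u
    rcases u with _ | ⟨k, u⟩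
    · simp [hcl.1]
    · simp only [Finset.mem_insert, Finset.mem_biUnion, Finset.mem_image, Finset.mem_univ,
          true_and, reduceCtorEq, false_or, List.cons.injEq, mem_restrict]
      constructor
      · rintro ⟨i, v, hv, rfl, rfl⟩
        exact hv
      · intro h
        obtain ⟨hk, -⟩ := (cons_mem_graft c).1 (hsub h)
        exact ⟨⟨k, hk⟩, u, h, rfl, rfl⟩
  · intro W hW
    funext i
    ext u
    simp only [mem_restrict, Finset.mem_insert, Finset.mem_biUnion, Finset.mem_image,
      Finset.mem_univ, true_and, reduceCtorEq, false_or, List.cons.injEq]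
    constructor
    · rintro ⟨j, v, hv, hj, rfl⟩
      rwa [← Fin.ext hj]
    · intro h
      exact ⟨i, u, h, rfl, rfl⟩

/-- A subtree that avoids the root is connected, hence lies inside a single branch. -/
theorem numSubtrees_graft :
    (graft n c).numSubtrees = (graft n c).numRootSubtrees + ∑ i, (c i).numSubtrees := by
  classical
  have hinj : ∀ k : ℕ, Function.Injective (fun V : Finset (List ℕ) => V.image (k :: ·)) :=
    fun k => Finset.image_injective (cons_injective k)
  have hne : ∀ {T : OrderedTree} {V}, V ∈ T.subtrees → V.Nonempty := by
    intro T V hV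
    obtain ⟨-, r, U, hU, rfl⟩ := mem_subtrees.1 hV
    exact ⟨r ++ [], Finset.mem_image_of_mem _ hU.1⟩
  have heq : (graft n c).subtrees = (graft n c).rootSubtrees ∪
      Finset.univ.biUnion (fun i : Fin n => (c i).subtrees.image (fun V =>
          V.image (i.val :: ·))) := by
    ext V
    simp only [Finset.mem_union, Finset.mem_biUnion, Finset.mem_image, Finset.mem_univ, true_and]
    constructor
    · intro hV
      obtain ⟨hsub, r, U, hU, rfl⟩ := mem_subtrees.1 hV
      rcases r with _ | ⟨k, r⟩
      · exact Or.inl (mem_rootSubtrees.2 ⟨hsub, by simpa using hU⟩)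
      · obtain ⟨hk, -⟩ := (cons_mem_graft c).1 (hsub (Finset.mem_image_of_mem _ hU.1))
        refine Or.inr ⟨⟨k, hk⟩, U.image (r ++ ·), mem_subtrees.2 ⟨?_, r, U, hU, rfl⟩, ?_⟩
        · intro v hv
          obtain ⟨u, hu, rfl⟩ := Finset.mem_image.1 hv
          exact (fin_cons_mem_graft c (i := ⟨k, hk⟩)).1 (hsub (Finset.mem_image_of_mem _ hu))
        · simp [Finset.image_image, Function.comp_def]
    · rintro (hV | ⟨i, V, hV, rfl⟩)
      · exact (Finset.mem_filter.1 hV).1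
      · obtain ⟨hsub, r, U, hU, rfl⟩ := mem_subtrees.1 hV
        refine mem_subtrees.2 ⟨?_, i.val :: r, U, hU, by
          simp [Finset.image_image, Function.comp_def]⟩
        intro v hv
        obtain ⟨u, hu, rfl⟩ := Finset.mem_image.1 hv
        exact (fin_cons_mem_graft c).2 (hsub hu)
  rw [numSubtrees, heq, Finset.card_union_of_disjoint, Finset.card_biUnion, numRootSubtrees]
  · congr 1
    exact Finset.sum_congr rfl fun i _ => Finset.card_image_of_injective _ (hinj _)
  · intro i _ j _ hij
    rw [Function.onFun, Finset.disjoint_left]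
    intro V hV hV'
    obtain ⟨A, hA, rfl⟩ := Finset.mem_image.1 hV
    obtain ⟨B, -, hB⟩ := Finset.mem_image.1 hV'
    obtain ⟨a, ha⟩ := hne hA
    have : i.val :: a ∈ B.image (j.val :: ·) := hB ▸ Finset.mem_image_of_mem _ ha
    obtain ⟨b, -, hb⟩ := Finset.mem_image.1 this
    simp only [List.cons.injEq] at hb
    exact hij (Fin.ext hb.1.symm)
  · rw [Finset.disjoint_left]
    intro V hV hV'
    simp only [Finset.mem_biUnion, Finset.mem_image, Finset.mem_univ, true_and] at hV'
    obtain ⟨i, A, -, rfl⟩ := hV'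
    simpa using (mem_rootSubtrees.1 hV).2.1

theorem numRootSubtrees_pos (T : OrderedTree) : 0 < T.numRootSubtrees := by
  induction T using graft_induction with
  | h n c _ =>
    rw [numRootSubtrees_graft]
    exact Finset.prod_pos fun i _ => by omega

theorem numRootSubtrees_le_two_pow_size (T : OrderedTree) : T.numRootSubtrees ≤ 2 ^ T.size := by
  rw [size, ← Finset.card_powerset]
  exact Finset.card_le_card fun V hV => Finset.mem_powerset.2 (mem_rootSubtrees.1 hV).1

/-- It allows S to be traded for R at the price of a factor `n`, which does not affect radii of
convergence. -/
theorem numSubtrees_le_size_mul (T : OrderedTree) :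
    T.numSubtrees ≤ T.size * T.numRootSubtrees := by
  induction T using graft_induction with
  | h n c ih =>
    have hle : ∀ i, (c i).numRootSubtrees ≤ (graft n c).numRootSubtrees := by
      intro i
      rw [numRootSubtrees_graft]
      exact (Nat.le_add_left _ 1).trans (Finset.single_le_prod' (f := fun i =>
        1 + (c i).numRootSubtrees) (fun j _ => by omega) (Finset.mem_univ i))
    rw [numSubtrees_graft, size_graft, add_mul, one_mul, Finset.sum_mul]
    gcongr with i
    exact (ih i).trans (Nat.mul_le_mul_left _ (hle i))

theorem weight_nonneg {w : ℕ → ℝ} (hw : ∀ i, 0 ≤ w i) (T : OrderedTree) : 0 ≤ T.weight w :=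
  Finset.prod_nonneg fun _ _ => hw _

/-- If all outdegrees of positive weight are multiples of `d`, then so is the number of edges of a
tree of positive weight. -/
theorem size_modEq_one {w : ℕ → ℝ} {d : ℕ} (hd : ∀ k, w k ≠ 0 → d ∣ k) (T : OrderedTree)
    (hT : T.weight w ≠ 0) : T.size ≡ 1 [MOD d] := by
  induction T using graft_induction with
  | h n c ih =>
    rw [weight_graft] at hT
    have h1 : ∀ i, (c i).size ≡ 1 [MOD d] := fun i =>
      ih i (Finset.prod_ne_zero_iff.1 (right_ne_zero_of_mul hT) i (Finset.mem_univ i))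
    rw [size_graft]
    have h2 : ∑ i, (c i).size ≡ n [MOD d] := by
      have : ∀ s : Finset (Fin n), ∑ i ∈ s, (c i).size ≡ s.card [MOD d] := by
        intro s
        induction s using Finset.induction_on with
        | empty => rfl
        | insert a s ha ih =>
          rw [Finset.sum_insert ha, Finset.card_insert_of_notMem ha, add_comm]
          exact ih.add (h1 a)
      simpa using this Finset.univ
    have h3 : n ≡ 0 [MOD d] := (Nat.modEq_zero_iff_dvd).2 (hd n (left_ne_zero_of_mul hT))
    exact (Nat.ModEq.refl 1).add (h2.trans h3)

end OrderedTree

/-! ### Power series and sums over tuples with values in `[0, ∞]` -/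

/-- The sum of the power series with coefficients `a` in `[0, ∞]`. -/
noncomputable def eSeries (a : ℕ → ℝ≥0∞) (s : ℝ≥0∞) : ℝ≥0∞ := ∑' n, a n * s ^ n

/-- The coefficients of the derivative of a power series. -/
def derivCoeff {R : Type*} [Semiring R] (a : ℕ → R) (n : ℕ) : R := (n + 1) * a (n + 1)

/-- The sum of `a n * ∏ g (c i) * (∑ S (c i)) ^ j` over all `n` and all `n`-tuples `c`. -/
noncomputable def tupleSum {τ : Type*} (a : ℕ → ℝ≥0∞) (g S : τ → ℝ≥0∞) (j : ℕ) : ℝ≥0∞ :=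
  ∑' n, a n * ∑' c : Fin n → τ, (∏ i, g (c i)) * (∑ i, S (c i)) ^ j

theorem tsum_tuple_succ {τ : Type*} {n : ℕ} (i : Fin (n + 1)) (f : (Fin (n + 1) → τ) → ℝ≥0∞) :
    ∑' c, f c = ∑' t, ∑' c : Fin n → τ, f (i.insertNth t c) := by
  rw [← (Fin.insertNthEquiv (fun _ => τ) i).tsum_eq f, ENNReal.tsum_prod']
  rfl

theorem tsum_tuple_prod {τ : Type*} (g : τ → ℝ≥0∞) (n : ℕ) :
    ∑' c : Fin n → τ, ∏ i, g (c i) = (∑' t, g t) ^ n := by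
  induction n with
  | zero => simp
  | succ n ih =>
    rw [tsum_tuple_succ 0]
    simp only [Fin.prod_univ_succAbove _ 0, Fin.insertNth_apply_same, Fin.insertNth_apply_succAbove,
      ENNReal.tsum_mul_left, ih, ENNReal.tsum_mul_right]
    rw [pow_succ']

theorem tupleSum_zero {τ : Type*} (a : ℕ → ℝ≥0∞) (g S : τ → ℝ≥0∞) :
    tupleSum a g S 0 = eSeries a (∑' t, g t) := by
  simp [tupleSum, eSeries, tsum_tuple_prod]

/-- One factor of the power picks out a component. By symmetry each component contributes the same,
whence `n + 1`; the remaining power is expanded binomially into that component and the others. -/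
theorem tsum_tuple_pow_succ {τ : Type*} (g S : τ → ℝ≥0∞) (n j : ℕ) :
    ∑' c : Fin (n + 1) → τ, (∏ i, g (c i)) * (∑ i, S (c i)) ^ (j + 1) =
      (n + 1) * ∑ q ∈ Finset.range (j + 1), (j.choose q : ℝ≥0∞) * (∑' t, g t * S t ^ (q + 1)) *
        ∑' c : Fin n → τ, (∏ i, g (c i)) * (∑ i, S (c i)) ^ (j - q) := by
  have h1 : ∀ c : Fin (n + 1) → τ, (∏ i, g (c i)) * (∑ i, S (c i)) ^ (j + 1) =
      ∑ k, S (c k) * ((∏ i, g (c i)) * (∑ i, S (c i)) ^ j) := by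
    intro c
    rw [← Finset.sum_mul, pow_succ]
    ring
  simp_rw [h1]
  rw [Summable.tsum_finsetSum (fun _ _ => ENNReal.summable)]
  have h2 : ∀ k : Fin (n + 1),
      ∑' c : Fin (n + 1) → τ, S (c k) * ((∏ i, g (c i)) * (∑ i, S (c i)) ^ j) =
      ∑ q ∈ Finset.range (j + 1), (j.choose q : ℝ≥0∞) * (∑' t, g t * S t ^ (q + 1)) *
        ∑' c : Fin n → τ, (∏ i, g (c i)) * (∑ i, S (c i)) ^ (j - q) := by
    intro k
    rw [tsum_tuple_succ k]
    simp only [Fin.prod_univ_succAbove _ k, Fin.sum_univ_succAbove _ k, Fin.insertNth_apply_same,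
      Fin.insertNth_apply_succAbove]
    have h3 : ∀ (t : τ) (c : Fin n → τ),
        S t * ((g t * ∏ i, g (c i)) * (S t + ∑ i, S (c i)) ^ j) =
        ∑ q ∈ Finset.range (j + 1), (j.choose q : ℝ≥0∞) * (g t * S t ^ (q + 1)) *
          ((∏ i, g (c i)) * (∑ i, S (c i)) ^ (j - q)) := by
      intro t c
      rw [add_pow, Finset.mul_sum, Finset.mul_sum]
      refine Finset.sum_congr rfl fun q _ => ?_
      ring
    simp_rw [h3]
    simp_rw [Summable.tsum_finsetSum (fun _ _ => ENNReal.summable), ENNReal.tsum_mul_left,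
      ENNReal.tsum_mul_right, ENNReal.tsum_mul_left]
  rw [Finset.sum_congr rfl fun k _ => h2 k, Finset.sum_const, Finset.card_univ, Fintype.card_fin,
    nsmul_eq_mul]
  push_cast
  rfl

/-- The term `n = 0` vanishes because the exponent is positive, and the factor `n + 1` turns `a`
into its derivative. Iterating this replaces an explicit formula for higher derivatives of a
composition. -/
theorem tupleSum_succ {τ : Type*} (a : ℕ → ℝ≥0∞) (g S : τ → ℝ≥0∞) (j : ℕ) :
    tupleSum a g S (j + 1) = ∑ q ∈ Finset.range (j + 1), (j.choose q : ℝ≥0∞) *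
      (∑' t, g t * S t ^ (q + 1)) * tupleSum (derivCoeff a) g S (j - q) := by
  rw [tupleSum, tsum_eq_zero_add' ENNReal.summable]
  simp only [Finset.univ_eq_empty, Finset.sum_empty, ne_eq, Nat.add_eq_zero_iff, one_ne_zero,
    and_false, not_false_eq_true, zero_pow, mul_zero, tsum_zero, zero_add]
  have h : ∀ q, (j.choose q : ℝ≥0∞) * (∑' t, g t * S t ^ (q + 1)) *
      tupleSum (derivCoeff a) g S (j - q) =
      ∑' n, (j.choose q : ℝ≥0∞) * (∑' t, g t * S t ^ (q + 1)) * (derivCoeff a n *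
        ∑' c : Fin n → τ, (∏ i, g (c i)) * (∑ i, S (c i)) ^ (j - q)) :=
    fun q => ENNReal.tsum_mul_left.symm
  simp_rw [tsum_tuple_pow_succ, h]
  rw [← Summable.tsum_finsetSum (fun _ _ => ENNReal.summable)]
  congr 1
  funext n
  rw [Finset.mul_sum, Finset.mul_sum]
  refine Finset.sum_congr rfl fun q _ => ?_
  rw [derivCoeff]
  ring

theorem eSeries_mono (a : ℕ → ℝ≥0∞) : Monotone (eSeries a) :=
  fun _ _ h => ENNReal.tsum_le_tsum fun n => mul_le_mul_right (pow_le_pow_left' h n) _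

/-- This and the next lemma are the lower and upper mean value bounds for a monomial, written
without subtraction so that they make sense in [0, ∞]. -/
theorem pow_add_mul_le (x d : ℝ≥0∞) (n : ℕ) :
    x ^ (n + 1) + (n + 1) * x ^ n * d ≤ (x + d) ^ (n + 1) := by
  induction n with
  | zero => simp
  | succ n ih =>
    calc x ^ (n + 1 + 1) + ((n + 1 : ℕ) + 1) * x ^ (n + 1) * d
        = (x ^ (n + 1) + (n + 1) * x ^ n * d) * x + x ^ (n + 1) * d := by push_cast; ring
      _ ≤ (x + d) ^ (n + 1) * x + (x + d) ^ (n + 1) * d := by gcongr; exact le_self_add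
      _ = _ := by ring

theorem add_pow_le_pow_add (x d : ℝ≥0∞) (n : ℕ) :
    (x + d) ^ (n + 1) ≤ x ^ (n + 1) + (n + 1) * (x + d) ^ n * d := by
  induction n with
  | zero => simp
  | succ n ih =>
    calc (x + d) ^ (n + 1 + 1) = (x + d) ^ (n + 1) * x + (x + d) ^ (n + 1) * d := by ring
      _ ≤ (x ^ (n + 1) + (n + 1) * (x + d) ^ n * d) * x + (x + d) ^ (n + 1) * d := by gcongr
      _ ≤ x ^ (n + 1 + 1) + ((n + 1) * (x + d) ^ n * d) * (x + d) + (x + d) ^ (n + 1) * d := by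
        rw [add_mul, ← pow_succ]
        gcongr
        exact le_self_add
      _ = _ := by push_cast; ring

theorem eSeries_eq_zero_add (a : ℕ → ℝ≥0∞) (s : ℝ≥0∞) :
    eSeries a s = a 0 + ∑' n, a (n + 1) * s ^ (n + 1) := by
  rw [eSeries, tsum_eq_zero_add' ENNReal.summable]
  simp

/-- Convexity of a series with nonnegative coefficients, in the form of its tangent at `x`, summed
from the monomials. -/
theorem eSeries_add_deriv_mul_le (a : ℕ → ℝ≥0∞) (x d : ℝ≥0∞) :
    eSeries a x + eSeries (derivCoeff a) x * d ≤ eSeries a (x + d) := by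
  rw [eSeries_eq_zero_add a x, eSeries_eq_zero_add a (x + d), add_assoc, eSeries,
      ← ENNReal.tsum_mul_right,
    ← ENNReal.tsum_add]
  gcongr with n
  calc a (n + 1) * x ^ (n + 1) + derivCoeff a n * x ^ n * d
      = a (n + 1) * (x ^ (n + 1) + (n + 1) * x ^ n * d) := by rw [derivCoeff]; ring
    _ ≤ _ := by gcongr; exact pow_add_mul_le x d n

theorem eSeries_add_le (a : ℕ → ℝ≥0∞) (x d : ℝ≥0∞) :
    eSeries a (x + d) ≤ eSeries a x + eSeries (derivCoeff a) (x + d) * d := by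
  rw [eSeries_eq_zero_add a x, eSeries_eq_zero_add a (x + d), add_assoc, eSeries,
      ← ENNReal.tsum_mul_right,
    ← ENNReal.tsum_add]
  gcongr with n
  calc a (n + 1) * (x + d) ^ (n + 1) ≤ a (n + 1) * (x ^ (n + 1) + (n + 1) * (x + d) ^ n * d) := by
        gcongr; exact add_pow_le_pow_add x d n
    _ = _ := by rw [derivCoeff]; ring

theorem lowerSemicontinuous_eSeries {a : ℕ → ℝ≥0∞} (ha : ∀ n, a n ≠ ∞) :
    LowerSemicontinuous (eSeries a) :=
  lowerSemicontinuous_tsum fun n =>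
    ((ENNReal.continuous_const_mul (ha n)).comp (ENNReal.continuous_pow n)).lowerSemicontinuous

/-! ### Generating functions of trees -/

namespace OrderedTree

/-- The generating function `∑_T w(T) R(T)^l S(T)^m x^|T|`. -/
noncomputable def momentGF (w : ℕ → ℝ) (l m : ℕ) (x : ℝ≥0∞) : ℝ≥0∞ :=
  ∑' T : OrderedTree, ENNReal.ofReal (T.weight w) * (T.numRootSubtrees : ℝ≥0∞) ^ l *
    (T.numSubtrees : ℝ≥0∞) ^ m * x ^ T.size

/-- The summand `w(T) (1 + R(T))^p x^|T|`. -/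
noncomputable def hatTerm (w : ℕ → ℝ) (p : ℕ) (x : ℝ≥0∞) (T : OrderedTree) : ℝ≥0∞ :=
  ENNReal.ofReal (T.weight w) * (1 + (T.numRootSubtrees : ℝ≥0∞)) ^ p * x ^ T.size

/-- The generating function `∑_T w(T) (1 + R(T))^p S(T)^q x^|T|`. -/
noncomputable def hatGF (w : ℕ → ℝ) (p q : ℕ) (x : ℝ≥0∞) : ℝ≥0∞ :=
  ∑' T : OrderedTree, hatTerm w p x T * (T.numSubtrees : ℝ≥0∞) ^ q

/-- The weights as extended nonnegative numbers. -/
noncomputable def eWeight (w : ℕ → ℝ) (i : ℕ) : ℝ≥0∞ := ENNReal.ofReal (w i)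

theorem hatTerm_eq_sum (w : ℕ → ℝ) (p : ℕ) (x : ℝ≥0∞) (T : OrderedTree) :
    hatTerm w p x T = ∑ k ∈ Finset.range (p + 1), (p.choose k : ℝ≥0∞) *
      (ENNReal.ofReal (T.weight w) * (T.numRootSubtrees : ℝ≥0∞) ^ k * x ^ T.size) := by
  rw [hatTerm, add_comm, add_pow, Finset.mul_sum, Finset.sum_mul]
  exact Finset.sum_congr rfl fun k _ => by rw [one_pow]; ring

theorem hatGF_eq_sum (w : ℕ → ℝ) (p q : ℕ) (x : ℝ≥0∞) :
    hatGF w p q x = ∑ k ∈ Finset.range (p + 1), (p.choose k : ℝ≥0∞) * momentGF w k q x := by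
  simp_rw [hatGF, hatTerm_eq_sum, momentGF, ← ENNReal.tsum_mul_left]
  rw [← Summable.tsum_finsetSum (fun _ _ => ENNReal.summable)]
  congr 1
  funext T
  rw [Finset.sum_mul]
  exact Finset.sum_congr rfl fun k _ => by ring

theorem hatGF_zero (w : ℕ → ℝ) (p : ℕ) (x : ℝ≥0∞) : hatGF w p 0 x = ∑' T, hatTerm w p x T := by
  simp [hatGF]

theorem tsum_graft (f : OrderedTree → ℝ≥0∞) :
    ∑' T, f T = ∑' n, ∑' c : Fin n → OrderedTree, f (graft n c) := by
  rw [← graftEquiv.tsum_eq f, ENNReal.tsum_sigma']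
  rfl

theorem ofReal_weight_graft {w : ℕ → ℝ} (hw : ∀ i, 0 ≤ w i) {n : ℕ} (c : Fin n → OrderedTree) :
    ENNReal.ofReal ((graft n c).weight w) =
      eWeight w n * ∏ i, ENNReal.ofReal ((c i).weight w) := by
  rw [weight_graft, ENNReal.ofReal_mul (hw n),
    ENNReal.ofReal_prod_of_nonneg fun i _ => weight_nonneg hw _]
  rfl

/-- Everything is multiplicative over branches; a power of R at the root becomes the same power of 1
+ R on each branch, which is why F̂ appears in the functional equation. -/
theorem weight_mul_pow_graft {w : ℕ → ℝ} (hw : ∀ i, 0 ≤ w i) {n : ℕ} (c : Fin n → OrderedTree)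
    (p : ℕ) (x : ℝ≥0∞) :
    ENNReal.ofReal ((graft n c).weight w) * ((graft n c).numRootSubtrees : ℝ≥0∞) ^ p *
      x ^ (graft n c).size = x * (eWeight w n * ∏ i, hatTerm w p x (c i)) := by
  rw [ofReal_weight_graft hw, numRootSubtrees_graft, size_graft]
  simp only [hatTerm, Finset.prod_mul_distrib, Finset.prod_pow, Finset.prod_pow_eq_pow_sum,
    pow_add, pow_one]
  push_cast
  ring

/-- The power of S = ∑ S(T_i) + R is expanded binomially: `j` factors go to the branches, and the
other `m - j` join the power of R. -/
theorem momentGF_eq_sum {w : ℕ → ℝ} (hw : ∀ i, 0 ≤ w i) (l m : ℕ) (x : ℝ≥0∞) :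
    momentGF w l m x = ∑ j ∈ Finset.range (m + 1), (m.choose j : ℝ≥0∞) *
      (x * tupleSum (eWeight w) (hatTerm w (l + m - j) x) (fun T => (T.numSubtrees : ℝ≥0∞)) j) := by
  rw [momentGF, tsum_graft]
  simp_rw [tupleSum, ← ENNReal.tsum_mul_left]
  rw [← Summable.tsum_finsetSum (fun _ _ => ENNReal.summable)]
  congr 1
  funext n
  rw [← Summable.tsum_finsetSum (fun _ _ => ENNReal.summable)]
  congr 1
  funext c
  have h1 : ((graft n c).numSubtrees : ℝ≥0∞) =
      ∑ i, ((c i).numSubtrees : ℝ≥0∞) + (graft n c).numRootSubtrees := by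
    rw [numSubtrees_graft]
    push_cast
    ring
  rw [h1, add_pow, Finset.mul_sum, Finset.sum_mul]
  refine Finset.sum_congr rfl fun j hj => ?_
  have hj' : l + m - j = l + (m - j) := by
    have := Finset.mem_range.1 hj
    omega
  have h2 := weight_mul_pow_graft hw c (l + m - j) x
  calc _ = (m.choose j : ℝ≥0∞) * (ENNReal.ofReal ((graft n c).weight w) *
        ((graft n c).numRootSubtrees : ℝ≥0∞) ^ (l + m - j) * x ^ (graft n c).size) *
        (∑ i, ((c i).numSubtrees : ℝ≥0∞)) ^ j := by rw [hj', pow_add]; ring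
    _ = _ := by rw [h2]; ring

theorem momentGF_zero_right {w : ℕ → ℝ} (hw : ∀ i, 0 ≤ w i) (l : ℕ) (x : ℝ≥0∞) :
    momentGF w l 0 x = x * eSeries (eWeight w) (hatGF w l 0 x) := by
  rw [momentGF_eq_sum hw]
  simp [tupleSum_zero, hatGF_zero]

/-- The part `∑_{k<m} (m choose k) F_k` of `hatGF`. -/
noncomputable def lowerGF (w : ℕ → ℝ) (m : ℕ) (x : ℝ≥0∞) : ℝ≥0∞ :=
  ∑ k ∈ Finset.range m, (m.choose k : ℝ≥0∞) * momentGF w k 0 x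

theorem hatGF_eq_lower_add (w : ℕ → ℝ) (m : ℕ) (x : ℝ≥0∞) :
    hatGF w m 0 x = lowerGF w m x + momentGF w m 0 x := by
  rw [hatGF_eq_sum, Finset.sum_range_succ, lowerGF]
  simp

theorem hatGF_eq_lower_add_mul {w : ℕ → ℝ} (hw : ∀ i, 0 ≤ w i) (m : ℕ) (x : ℝ≥0∞) :
    hatGF w m 0 x = lowerGF w m x + x * eSeries (eWeight w) (hatGF w m 0 x) := by
  rw [← momentGF_zero_right hw, ← hatGF_eq_lower_add]

/-- Every solution of the fixed point inequality bounds the generating function. -/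
theorem hatGF_le_of_fixedPoint {w : ℕ → ℝ} (hw : ∀ i, 0 ≤ w i) (m : ℕ) {x s : ℝ≥0∞}
    (h : lowerGF w m x + x * eSeries (eWeight w) s ≤ s) : hatGF w m 0 x ≤ s := by
  classical
  -- The sum is truncated to trees of size at most `n`. Branches of a tree of size at most `n + 1`
  -- have size at most `n`, so induction on `n` iterates the fixed point map from 0 and never
  -- exceeds `s`.
  set trunc : ℕ → (OrderedTree → ℝ≥0∞) → OrderedTree → ℝ≥0∞ :=
    fun n f T => if T.size ≤ n then f T else 0 with htrunc
  have hle : ∀ n f T, trunc n f T ≤ f T := by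
    intro n f T
    simp only [htrunc]
    split_ifs <;> simp
  have hb : ∀ n, ∑' T, trunc n (hatTerm w m x) T ≤ s := by
    intro n
    induction n with
    | zero =>
      have : ∀ T, trunc 0 (hatTerm w m x) T = 0 := fun T => if_neg (by have := T.size_pos; omega)
      simp [this]
    | succ n ih =>
      refine le_trans ?_ h
      have h1 : ∀ T, trunc (n + 1) (hatTerm w m x) T ≤
          (∑ k ∈ Finset.range m, (m.choose k : ℝ≥0∞) * (ENNReal.ofReal (T.weight w) *
            (T.numRootSubtrees : ℝ≥0∞) ^ k * (T.numSubtrees : ℝ≥0∞) ^ 0 * x ^ T.size)) +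
          trunc (n + 1) (fun T => ENNReal.ofReal (T.weight w) *
            (T.numRootSubtrees : ℝ≥0∞) ^ m * x ^ T.size) T := by
        intro T
        simp only [htrunc]
        split_ifs
        · rw [hatTerm_eq_sum, Finset.sum_range_succ]
          simp
        · simp
      refine (ENNReal.tsum_le_tsum h1).trans ?_
      rw [ENNReal.tsum_add, Summable.tsum_finsetSum (fun _ _ => ENNReal.summable)]
      simp_rw [ENNReal.tsum_mul_left]
      rw [lowerGF]
      refine add_le_add le_rfl ?_
      calc _ ≤ x * eSeries (eWeight w) (∑' T, trunc n (hatTerm w m x) T) := ?_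
        _ ≤ _ := by gcongr; exact eSeries_mono _ ih
      rw [tsum_graft, eSeries]
      simp_rw [← tsum_tuple_prod, ← ENNReal.tsum_mul_left]
      refine ENNReal.tsum_le_tsum fun k => ENNReal.tsum_le_tsum fun c => ?_
      simp only [htrunc]
      split_ifs with hs
      · rw [weight_mul_pow_graft hw]
        gcongr with i
        rw [if_pos]
        rw [size_graft] at hs
        have := Finset.single_le_sum (f := fun i => (c i).size) (fun _ _ => Nat.zero_le _)
          (Finset.mem_univ i)

        omega
      · exact zero_le
  rw [hatGF_zero]
  refine ENNReal.summable.tsum_le_of_sum_le fun F => ?_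
  refine le_trans ?_ (hb (F.sup size))
  refine le_trans (Finset.sum_le_sum fun T hT => ?_) (ENNReal.sum_le_tsum F)
  simp only [htrunc]
  rw [if_pos (Finset.le_sup (f := size) hT)]

theorem momentGF_mono (w : ℕ → ℝ) (l m : ℕ) : Monotone (momentGF w l m) :=
  fun _ _ h => ENNReal.tsum_le_tsum fun _ => mul_le_mul_right (pow_le_pow_left' h _) _

theorem hatGF_mono (w : ℕ → ℝ) (p q : ℕ) : Monotone (hatGF w p q) := by
  intro x y h
  simp_rw [hatGF_eq_sum]
  gcongr
  exact momentGF_mono _ _ _ h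

theorem lowerGF_mono (w : ℕ → ℝ) (m : ℕ) : Monotone (lowerGF w m) := by
  intro x y h
  simp_rw [lowerGF]
  gcongr
  exact momentGF_mono _ _ _ h

theorem momentGF_mono_left (w : ℕ → ℝ) (m : ℕ) (x : ℝ≥0∞) {k l : ℕ} (h : k ≤ l) :
    momentGF w k m x ≤ momentGF w l m x := by
  refine ENNReal.tsum_le_tsum fun T => ?_
  gcongr
  exact_mod_cast T.numRootSubtrees_pos

/-- The crude bound R ≤ 2^|T| is enough to keep all radii positive. -/
theorem momentGF_le_zero_left (w : ℕ → ℝ) (l : ℕ) (x : ℝ≥0∞) :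
    momentGF w l 0 x ≤ momentGF w 0 0 (2 ^ l * x) := by
  refine ENNReal.tsum_le_tsum fun T => ?_
  have : (T.numRootSubtrees : ℝ≥0∞) ≤ 2 ^ T.size := by
    exact_mod_cast T.numRootSubtrees_le_two_pow_size
  calc _ ≤ ENNReal.ofReal (T.weight w) * (2 ^ T.size) ^ l * (T.numSubtrees : ℝ≥0∞) ^ 0 *
        x ^ T.size := by gcongr
    _ = _ := by rw [mul_pow, ← pow_mul, ← pow_mul, mul_comm T.size l]; ring

/-- The coefficient of `z ^ n` in `∑_T w(T) R(T)^l S(T)^m z^|T|`. -/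
noncomputable def momentCoeff (w : ℕ → ℝ) (l m n : ℕ) : ℝ :=
  ∑ T ∈ ofSize n, T.weight w * ((T.numRootSubtrees : ℝ) ^ l * (T.numSubtrees : ℝ) ^ m)

theorem mem_ofSize {n : ℕ} {T : OrderedTree} : T ∈ ofSize n ↔ T.size = n := by
  simp [ofSize]

theorem momentCoeff_nonneg {w : ℕ → ℝ} (hw : ∀ i, 0 ≤ w i) (l m n : ℕ) :
    0 ≤ momentCoeff w l m n :=
  Finset.sum_nonneg fun T _ => mul_nonneg (weight_nonneg hw T) (by positivity)

theorem momentGF_eq_eSeries {w : ℕ → ℝ} (hw : ∀ i, 0 ≤ w i) (l m : ℕ) (x : ℝ≥0∞) :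
    momentGF w l m x = eSeries (fun n => ENNReal.ofReal (momentCoeff w l m n)) x := by
  rw [momentGF, ← (Equiv.sigmaFiberEquiv size).tsum_eq, ENNReal.tsum_sigma', eSeries]
  congr 1
  funext n
  have : ∀ p : {T : OrderedTree // T.size = n}, (Equiv.sigmaFiberEquiv size) ⟨n, p⟩ = p.1 :=
    fun _ => rfl
  simp only [this]
  have h2 := Finset.tsum_subtype (ofSize n) (fun T : OrderedTree => ENNReal.ofReal (T.weight w) *
    (T.numRootSubtrees : ℝ≥0∞) ^ l * (T.numSubtrees : ℝ≥0∞) ^ m * x ^ T.size)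
  have h3 : ∑' p : {T : OrderedTree // T.size = n}, ENNReal.ofReal (p.1.weight w) *
      (p.1.numRootSubtrees : ℝ≥0∞) ^ l * (p.1.numSubtrees : ℝ≥0∞) ^ m * x ^ p.1.size =
      ∑' p : {T : OrderedTree // T ∈ ofSize n}, ENNReal.ofReal (p.1.weight w) *
      (p.1.numRootSubtrees : ℝ≥0∞) ^ l * (p.1.numSubtrees : ℝ≥0∞) ^ m * x ^ p.1.size :=
    ((Equiv.subtypeEquivRight fun T => (mem_ofSize (n := n) (T := T)).symm).tsum_eq
      (fun p : {T : OrderedTree // T ∈ ofSize n} => ENNReal.ofReal (p.1.weight w) *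
      (p.1.numRootSubtrees : ℝ≥0∞) ^ l * (p.1.numSubtrees : ℝ≥0∞) ^ m * x ^ p.1.size))
  rw [h3, h2, momentCoeff, ENNReal.ofReal_sum_of_nonneg, Finset.sum_mul]
  · refine Finset.sum_congr rfl fun T hT => ?_
    rw [mem_ofSize.1 hT, ENNReal.ofReal_mul (weight_nonneg hw T),
      ENNReal.ofReal_mul (by positivity), ENNReal.ofReal_pow (by positivity),
      ENNReal.ofReal_pow (by positivity), ENNReal.ofReal_natCast, ENNReal.ofReal_natCast]
    ring
  · exact fun T _ => mul_nonneg (weight_nonneg hw T) (by positivity)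

end OrderedTree

/-! ### Power series in one variable -/

/-- The tangent at `x`, evaluated at `y`, bounds the derivative by the value at `y`. -/
theorem eSeries_derivCoeff_ne_top {a : ℕ → ℝ≥0∞} {x y : ℝ≥0∞} (hxy : x < y)
    (h : eSeries a y ≠ ∞) : eSeries (derivCoeff a) x ≠ ∞ := by
  intro htop
  have h1 := eSeries_add_deriv_mul_le a x (y - x)
  rw [htop, add_tsub_cancel_of_le hxy.le, ENNReal.top_mul (tsub_pos_of_lt hxy).ne', add_top] at h1
  exact h (top_le_iff.1 h1)

/-- Right continuity of power series inside the region of convergence. -/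
theorem exists_eSeries_add_lt {a : ℕ → ℝ≥0∞} {x y c : ℝ≥0∞} (hxy : x < y)
    (hy : eSeries a y ≠ ∞) (hc : eSeries a x < c) :
    ∃ δ₀ > 0, ∀ δ ≤ δ₀, eSeries a (x + δ) < c := by
  obtain ⟨z, hxz, hzy⟩ := exists_between hxy
  have hD := eSeries_derivCoeff_ne_top hzy hy
  have hlt : Tendsto (fun δ : ℝ≥0∞ => eSeries a x + eSeries (derivCoeff a) z * δ) (𝓝 0)
      (𝓝 (eSeries a x + eSeries (derivCoeff a) z * 0)) :=
    ((ENNReal.continuous_const_mul hD).const_add _).tendsto 0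
  rw [mul_zero, add_zero] at hlt
  have h1 := (hlt.eventually (gt_mem_nhds hc)).and (gt_mem_nhds (tsub_pos_of_lt hxz))
  obtain ⟨δ₀, hδ₀, h2⟩ := ENNReal.nhds_zero_basis_Iic.eventually_iff.1 h1
  refine ⟨δ₀, hδ₀, fun δ hδ => ?_⟩
  obtain ⟨h3, h4⟩ := h2 hδ
  refine lt_of_le_of_lt ((eSeries_add_le a x δ).trans ?_) h3
  gcongr
  refine eSeries_mono _ ?_
  calc x + δ ≤ x + (z - x) := by gcongr
    _ = z := add_tsub_cancel_of_le hxz.le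

theorem enorm_eq_ofReal_of_nonneg {a : ℕ → ℝ} (ha : ∀ n, 0 ≤ a n) (n : ℕ) :
    ‖a n‖ₑ = ENNReal.ofReal (a n) := Real.enorm_of_nonneg (ha n)

theorem summable_of_eSeries_ne_top {𝕜 : Type*} [RCLike 𝕜] {a : ℕ → 𝕜} {z : 𝕜} {y : ℝ≥0∞}
    (hz : ‖z‖ₑ ≤ y) (h : eSeries (fun n => ‖a n‖ₑ) y ≠ ∞) : Summable fun n => ‖a n * z ^ n‖ := by
  have h1 : ∑' n, ‖a n * z ^ n‖ₑ ≠ ∞ := by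
    refine ne_top_of_le_ne_top h ?_
    simp_rw [enorm_mul, enorm_pow]
    exact eSeries_mono _ hz
  have h2 := ENNReal.summable_toReal h1
  simpa only [toReal_enorm] using h2

theorem enorm_natCast_add_one {𝕜 : Type*} [RCLike 𝕜] (n : ℕ) : ‖(n + 1 : 𝕜)‖ₑ = (n + 1 : ℝ≥0∞) := by
  have h1 : (n + 1 : 𝕜) = ((n + 1 : ℕ) : 𝕜) := by push_cast; rfl
  rw [h1, ← ofReal_norm, RCLike.norm_natCast, ENNReal.ofReal_natCast]
  push_cast
  rfl

theorem enorm_derivCoeff {𝕜 : Type*} [RCLike 𝕜] (a : ℕ → 𝕜) :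
    (fun n => ‖derivCoeff a n‖ₑ) = derivCoeff fun n => ‖a n‖ₑ := by
  funext n
  rw [derivCoeff, derivCoeff, enorm_mul, enorm_natCast_add_one]

theorem hasDerivAt_powerSeries {𝕜 : Type*} [RCLike 𝕜] {a : ℕ → 𝕜} {z : 𝕜} {y : ℝ≥0∞}
    (hz : ‖z‖ₑ < y) (h : eSeries (fun n => ‖a n‖ₑ) y ≠ ∞) :
    HasDerivAt (fun z : 𝕜 => ∑' n, a n * z ^ n) (∑' n, derivCoeff a n * z ^ n) z := by
  obtain ⟨x, hzx, hxy⟩ := exists_between hz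
  have hx : x ≠ ∞ := hxy.ne_top
  have hD := eSeries_derivCoeff_ne_top hxy h
  rw [← enorm_derivCoeff] at hD
  have hball : ∀ v ∈ Metric.ball (0 : 𝕜) x.toReal, ‖v‖ₑ ≤ x := by
    intro v hv
    rw [mem_ball_zero_iff] at hv
    rw [← ofReal_norm]
    exact ENNReal.ofReal_le_of_le_toReal hv.le
  have hsum : Summable fun n => (ENNReal.toReal (‖derivCoeff a n‖ₑ * x ^ n)) :=
    ENNReal.summable_toReal hD
  have hzball : z ∈ Metric.ball (0 : 𝕜) x.toReal := by
    rw [mem_ball_zero_iff, ← toReal_enorm]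
    exact (ENNReal.toReal_lt_toReal (enorm_ne_top) hx).2 hzx
  have hpos : 0 < x.toReal := ENNReal.toReal_pos (bot_lt_of_lt hzx).ne' hx
  -- The constant term is split off so that differentiating the shifted series termwise gives
  -- exactly the indexing of `derivCoeff`.
  have hsplit : ∀ v : 𝕜, ‖v‖ₑ ≤ x → ∑' n, a n * v ^ n = a 0 + ∑' n, a (n + 1) * v ^ (n + 1) := by
    intro v hv
    have := (summable_of_eSeries_ne_top (hv.trans hxy.le) h).of_norm
    rw [this.tsum_eq_zero_add]
    simp
  have key : HasDerivAt (fun v : 𝕜 => ∑' n, a (n + 1) * v ^ (n + 1))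
      (∑' n, derivCoeff a n * z ^ n) z := by
    refine hasDerivAt_tsum_of_isPreconnected (t := Metric.ball (0 : 𝕜) x.toReal) (y₀ := 0)
      (g := fun n v => a (n + 1) * v ^ (n + 1)) (g' := fun n v => derivCoeff a n * v ^ n)
      hsum Metric.isOpen_ball (convex_ball (0 : 𝕜) x.toReal).isPreconnected ?_ ?_
          (by simpa using hpos)
      ?_ hzball
    · intro n v _
      have := (hasDerivAt_pow (n + 1) v).const_mul (a (n + 1))
      refine this.congr_deriv ?_
      rw [derivCoeff, Nat.add_sub_cancel]
      push_cast
      ring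
    · intro n v hv
      rw [← toReal_enorm]
      refine ENNReal.toReal_mono ?_ ?_
      · exact ENNReal.mul_ne_top enorm_ne_top (ENNReal.pow_ne_top hx)
      · rw [enorm_mul, enorm_pow]
        gcongr
        exact hball v hv
    · simp [summable_zero]
  have := key.const_add (a 0)
  refine this.congr_of_eventuallyEq ?_
  filter_upwards [Metric.isOpen_ball.mem_nhds hzball] with v hv
  exact hsplit v (hball v hv)

theorem eSeries_ne_top_of_lt_seriesRadius {a : ℕ → ℝ} {x : ℝ≥0∞} (hx : x < seriesRadius a) :
    eSeries (fun n => ‖a n‖ₑ) x ≠ ∞ := by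
  lift x to NNReal using hx.ne_top
  have h := FormalMultilinearSeries.summable_norm_mul_pow _ hx
  simp_rw [FormalMultilinearSeries.ofScalars_norm] at h
  have h2 := h.tsum_ofReal_ne_top
  rw [eSeries]
  convert h2 using 3 with n
  rw [ENNReal.ofReal_mul (norm_nonneg _), ofReal_norm, ENNReal.ofReal_pow (by positivity)]
  simp

theorem le_seriesRadius_of_eSeries_ne_top {a : ℕ → ℝ} {x : ℝ≥0∞} (hx : x ≠ ∞)
    (h : eSeries (fun n => ‖a n‖ₑ) x ≠ ∞) : x ≤ seriesRadius a := by
  lift x to NNReal using hx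
  refine FormalMultilinearSeries.le_radius_of_summable _ ?_
  simp_rw [FormalMultilinearSeries.ofScalars_norm]
  have h2 := ENNReal.summable_toReal h
  convert h2 using 2
  rw [ENNReal.toReal_mul]
  simp

/-- No convergence is assumed: a divergent real series and the real value of ∞ both default to 0. -/
theorem seriesSum_eq_toReal {a : ℕ → ℝ} (ha : ∀ n, 0 ≤ a n) {x : ℝ} (hx : 0 ≤ x) :
    seriesSum a x = (eSeries (fun n => ENNReal.ofReal (a n)) (ENNReal.ofReal x)).toReal := by
  rw [seriesSum, eSeries, ENNReal.tsum_toReal_eq]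
  · congr 1
    funext n
    rw [ENNReal.toReal_mul, ENNReal.toReal_ofReal (ha n), ENNReal.toReal_pow,
      ENNReal.toReal_ofReal hx]
  · exact fun n => ENNReal.mul_ne_top ENNReal.ofReal_ne_top
      (ENNReal.pow_ne_top ENNReal.ofReal_ne_top)

theorem derivCoeff_nonneg {a : ℕ → ℝ} (ha : ∀ n, 0 ≤ a n) (n : ℕ) : 0 ≤ derivCoeff a n :=
  mul_nonneg (by positivity) (ha _)

theorem ofReal_derivCoeff {a : ℕ → ℝ} (ha : ∀ n, 0 ≤ a n) :
    (fun n => ENNReal.ofReal (derivCoeff a n)) = derivCoeff fun n => ENNReal.ofReal (a n) := by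
  have := enorm_derivCoeff a
  rw [show (fun n => ‖a n‖ₑ) = fun n => ENNReal.ofReal (a n) from
    funext (enorm_eq_ofReal_of_nonneg ha)] at this
  rw [← this]
  funext n
  rw [enorm_eq_ofReal_of_nonneg (derivCoeff_nonneg ha)]

theorem deriv_seriesSum {a : ℕ → ℝ} (ha : ∀ n, 0 ≤ a n) {x : ℝ} (hx : 0 ≤ x)
    (hr : ENNReal.ofReal x < seriesRadius a) :
    deriv (seriesSum a) x =
      (eSeries (derivCoeff fun n => ENNReal.ofReal (a n)) (ENNReal.ofReal x)).toReal := by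
  obtain ⟨y, hxy, hy⟩ := exists_between hr
  have h := hasDerivAt_powerSeries (a := a) (z := x) (y := y)
    (by rwa [Real.enorm_of_nonneg hx]) (eSeries_ne_top_of_lt_seriesRadius hy)
  have h2 : deriv (seriesSum a) x = seriesSum (derivCoeff a) x := h.deriv
  rw [h2, seriesSum_eq_toReal (derivCoeff_nonneg ha) hx, ofReal_derivCoeff ha]

/-! ### Weight sequences -/

namespace OrderedTree

/-- The properties of the weight sequence used below. -/
structure Admissible (w : ℕ → ℝ) : Prop where
  nonneg : ∀ i, 0 ≤ w i
  zero_pos : 0 < w 0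
  radius_pos : 0 < seriesRadius w
  deriv_limit : DerivTendsToInfinity w

/-- The derivative `Φ'` on `[0, ∞]`. -/
noncomputable abbrev ePhiDeriv (w : ℕ → ℝ) : ℝ≥0∞ → ℝ≥0∞ := eSeries (derivCoeff (eWeight w))

theorem eWeight_ne_top (w : ℕ → ℝ) (n : ℕ) : eWeight w n ≠ ∞ := ENNReal.ofReal_ne_top

theorem eWeight_zero_le_eSeries (w : ℕ → ℝ) (s : ℝ≥0∞) : eWeight w 0 ≤ eSeries (eWeight w) s := by
  rw [eSeries_eq_zero_add]
  exact le_self_add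

theorem lowerGF_ne_top_of {w : ℕ → ℝ} {m : ℕ} {x : ℝ≥0∞} (h : momentGF w m 0 x ≠ ∞) :
    lowerGF w m x ≠ ∞ := by
  rw [lowerGF]
  refine ENNReal.sum_ne_top.2 fun k hk => ENNReal.mul_ne_top (by finiteness) ?_
  exact ne_top_of_le_ne_top h (momentGF_mono_left w 0 x (Finset.mem_range.1 hk).le)

theorem lowerGF_succ_ne_top {w : ℕ → ℝ} {m : ℕ} {x : ℝ≥0∞} (h : momentGF w m 0 x ≠ ∞) :
    lowerGF w (m + 1) x ≠ ∞ := by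
  rw [lowerGF]
  refine ENNReal.sum_ne_top.2 fun k hk => ENNReal.mul_ne_top (by finiteness) ?_
  exact ne_top_of_le_ne_top h (momentGF_mono_left w 0 x (by have := Finset.mem_range.1 hk; omega))

theorem lowerSemicontinuous_hatGF (w : ℕ → ℝ) (m : ℕ) : LowerSemicontinuous (hatGF w m 0) := by
  have h : hatGF w m 0 = fun x => ∑' T, hatTerm w m x T := funext fun x => hatGF_zero w m x
  rw [h]
  refine lowerSemicontinuous_tsum fun T => Continuous.lowerSemicontinuous ?_
  exact (ENNReal.continuous_const_mul (by finiteness)).comp (ENNReal.continuous_pow _)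

theorem derivCoeff_eWeight_ne_top (w : ℕ → ℝ) (n : ℕ) : derivCoeff (eWeight w) n ≠ ∞ := by
  rw [derivCoeff]
  exact ENNReal.mul_ne_top (by finiteness) (eWeight_ne_top w _)

theorem hatGF_ne_top_of {w : ℕ → ℝ} {m : ℕ} {x : ℝ≥0∞} (h : momentGF w m 0 x ≠ ∞) :
    hatGF w m 0 x ≠ ∞ := by
  rw [hatGF_eq_lower_add]
  exact ENNReal.add_ne_top.2 ⟨lowerGF_ne_top_of h, h⟩

/-- Lower semicontinuity and monotonicity give left continuity, also at the radius of convergence.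
-/
theorem tendsto_hatGF_left (w : ℕ → ℝ) (m : ℕ) (x : ℝ≥0∞) :
    Tendsto (hatGF w m 0) (𝓝[<] x) (𝓝 (hatGF w m 0 x)) := by
  rw [tendsto_order]
  constructor
  · intro a ha
    exact (lowerSemicontinuous_hatGF w m x a ha).filter_mono nhdsWithin_le_nhds
  · intro a ha
    filter_upwards [self_mem_nhdsWithin] with y hy
    exact (hatGF_mono w m 0 (le_of_lt hy)).trans_lt ha

namespace Admissible

variable {w : ℕ → ℝ} (hw : Admissible w)

include hw

theorem enorm_eq : (fun n => ‖w n‖ₑ) = eWeight w := funext (enorm_eq_ofReal_of_nonneg hw.nonneg)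

theorem eSeries_ne_top {s : ℝ≥0∞} (hs : s < seriesRadius w) : eSeries (eWeight w) s ≠ ∞ := by
  rw [← hw.enorm_eq]
  exact eSeries_ne_top_of_lt_seriesRadius hs

theorem ePhiDeriv_ne_top {s : ℝ≥0∞} (hs : s < seriesRadius w) : ePhiDeriv w s ≠ ∞ := by
  obtain ⟨y, hxy, hy⟩ := exists_between hs
  exact eSeries_derivCoeff_ne_top hxy (hw.eSeries_ne_top hy)

theorem exists_deriv_gt (M : ℝ) :
    ∃ x : ℝ, 0 ≤ x ∧ ENNReal.ofReal x < seriesRadius w ∧ M < deriv (seriesSum w) x := by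
  have h := hw.deriv_limit.eventually (eventually_gt_atTop M)
  rw [leftOf, eventually_comap] at h
  have h2 := (h.and (self_mem_nhdsWithin)).and
    (mem_nhdsWithin_of_mem_nhds (lt_mem_nhds hw.radius_pos))
  have : (𝓝[<] (seriesRadius w)).NeBot := nhdsLT_neBot_of_exists_lt ⟨0, hw.radius_pos⟩
  obtain ⟨y, ⟨hy, hyr⟩, -⟩ := h2.exists
  have hyr' : y < seriesRadius w := hyr
  refine ⟨y.toReal, ENNReal.toReal_nonneg, ?_, ?_⟩
  · rwa [ENNReal.ofReal_toReal hyr'.ne_top]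
  · exact hy _ (ENNReal.ofReal_toReal hyr'.ne_top)

theorem deriv_eq {x : ℝ} (hx : 0 ≤ x) (hr : ENNReal.ofReal x < seriesRadius w) :
    deriv (seriesSum w) x = (ePhiDeriv w (ENNReal.ofReal x)).toReal :=
  deriv_seriesSum hw.nonneg hx hr

/-- Φ' is monotone and unbounded below the radius. -/
theorem ePhiDeriv_eq_top {s : ℝ≥0∞} (hs : seriesRadius w ≤ s) : ePhiDeriv w s = ∞ := by
  by_contra hne
  obtain ⟨x, hx, hxr, hM⟩ := hw.exists_deriv_gt (ePhiDeriv w s).toReal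
  rw [hw.deriv_eq hx hxr] at hM
  exact hM.not_ge (ENNReal.toReal_mono hne (eSeries_mono _ (hxr.le.trans hs)))

/-- Otherwise Φ' would be constant and could not tend to infinity. -/
theorem exists_two_le : ∃ k, 2 ≤ k ∧ 0 < w k := by
  by_contra! h
  have h0 : ∀ n, derivCoeff (eWeight w) (n + 1) = 0 := by
    intro n
    rw [derivCoeff, eWeight, ENNReal.ofReal_eq_zero.2 (h (n + 1 + 1) (by omega)), mul_zero]
  have h1 : ∀ s, ePhiDeriv w s = eWeight w 1 := by
    intro s
    rw [ePhiDeriv, eSeries_eq_zero_add]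
    simp only [h0, zero_mul, tsum_zero, add_zero]
    simp [derivCoeff]
  obtain ⟨x, hx, hxr, hM⟩ := hw.exists_deriv_gt (eWeight w 1).toReal
  rw [hw.deriv_eq hx hxr, h1] at hM
  exact lt_irrefl _ hM

theorem eWeight_zero_pos : 0 < eWeight w 0 := ENNReal.ofReal_pos.2 hw.zero_pos

/-- `Φ'` grows at least like a monomial of positive degree. -/
theorem exists_monomial_le :
    ∃ (k : ℕ) (b : ℝ≥0∞), b ≠ 0 ∧ ∀ s, b * s ^ (k + 1) ≤ ePhiDeriv w s := by
  obtain ⟨k, hk, hpos⟩ := hw.exists_two_le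
  obtain ⟨k, rfl⟩ := Nat.exists_eq_add_of_le' hk
  refine ⟨k, derivCoeff (eWeight w) (k + 1), ?_, fun s => ENNReal.le_tsum (k + 1)⟩
  rw [derivCoeff]
  have : eWeight w (k + 2) ≠ 0 := (ENNReal.ofReal_pos.2 hpos).ne'
  exact mul_ne_zero (by positivity) this

theorem ePhiDeriv_strict {s t : ℝ≥0∞} (hst : s < t) (ht : ePhiDeriv w t ≠ ∞) :
    ePhiDeriv w s < ePhiDeriv w t := by
  obtain ⟨k, hk, hpos⟩ := hw.exists_two_le
  obtain ⟨k, rfl⟩ := Nat.exists_eq_add_of_le' hk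
  refine ENNReal.tsum_lt_tsum (i := k + 1) (ne_top_of_le_ne_top ht (eSeries_mono _ hst.le))
    (fun n => ?_) ?_
  · gcongr
  · have h1 : derivCoeff (eWeight w) (k + 1) ≠ 0 := by
      rw [derivCoeff]
      have : eWeight w (k + 2) ≠ 0 := (ENNReal.ofReal_pos.2 hpos).ne'
      exact mul_ne_zero (by positivity) this
    have h2 : derivCoeff (eWeight w) (k + 1) ≠ ∞ := by
      rw [derivCoeff]
      exact ENNReal.mul_ne_top (by finiteness) (eWeight_ne_top w _)
    exact (ENNReal.mul_lt_mul_iff_right h1 h2).2 (ENNReal.pow_right_strictMono (by omega) hst)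

/-! ### The radii of convergence of the generating functions -/

theorem enorm_rootCoeff (m : ℕ) :
    (fun n => ‖rootCoeff w m n‖ₑ) = fun n => ENNReal.ofReal (momentCoeff w m 0 n) := by
  have : rootCoeff w m = momentCoeff w m 0 := by
    funext n
    simp [rootCoeff, momentCoeff]
  rw [this]
  exact funext (enorm_eq_ofReal_of_nonneg (momentCoeff_nonneg hw.nonneg m 0))

theorem momentGF_ne_top {m : ℕ} {x : ℝ≥0∞} (hx : x < rootRadius w m) : momentGF w m 0 x ≠ ∞ := by
  rw [momentGF_eq_eSeries hw.nonneg, ← hw.enorm_rootCoeff]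
  exact eSeries_ne_top_of_lt_seriesRadius hx

theorem le_rootRadius {m : ℕ} {x : ℝ≥0∞} (hx : x ≠ ∞) (h : momentGF w m 0 x ≠ ∞) :
    x ≤ rootRadius w m := by
  refine le_seriesRadius_of_eSeries_ne_top hx ?_
  rwa [hw.enorm_rootCoeff, ← momentGF_eq_eSeries hw.nonneg]

theorem mul_zero_le_hatGF (m : ℕ) (x : ℝ≥0∞) : x * eWeight w 0 ≤ hatGF w m 0 x := by
  rw [hatGF_eq_lower_add_mul hw.nonneg]
  refine le_add_left ?_
  gcongr
  exact eWeight_zero_le_eSeries w _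

/-- Let δ be the increment of F̂_m from `x` to `y`. The functional equation and the tangent
inequality give δ ≥ x Φ'(F̂_m(x)) δ + (y - x) w_0; as the last term is positive and δ is finite, the
factor of δ is below 1. -/
theorem mul_ePhiDeriv_lt_one {m : ℕ} {x y : ℝ≥0∞} (hxy : x < y) (h : momentGF w m 0 y ≠ ∞) :
    x * ePhiDeriv w (hatGF w m 0 x) < 1 := by
  have hmono := hatGF_mono w m 0 hxy.le
  have hHy := hatGF_ne_top_of h
  have hHx := ne_top_of_le_ne_top hHy hmono
  set δ := hatGF w m 0 y - hatGF w m 0 x with hδ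
  have hadd : hatGF w m 0 x + δ = hatGF w m 0 y := add_tsub_cancel_of_le hmono
  have hδtop : δ ≠ ∞ := ne_top_of_le_ne_top hHy tsub_le_self
  have h1 : hatGF w m 0 x + (x * ePhiDeriv w (hatGF w m 0 x) * δ + (y - x) * eWeight w 0) ≤
      hatGF w m 0 x + δ := by
    calc _ = lowerGF w m x + x * (eSeries (eWeight w) (hatGF w m 0 x) +
          ePhiDeriv w (hatGF w m 0 x) * δ) + (y - x) * eWeight w 0 := by
          nth_rw 1 [hatGF_eq_lower_add_mul hw.nonneg m x]
          ring
      _ ≤ lowerGF w m y + x * eSeries (eWeight w) (hatGF w m 0 y) +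
          (y - x) * eSeries (eWeight w) (hatGF w m 0 y) := by
        gcongr
        · exact lowerGF_mono w m hxy.le
        · rw [← hadd]
          exact eSeries_add_deriv_mul_le _ _ _
        · exact eWeight_zero_le_eSeries w _
      _ = lowerGF w m y + (x + (y - x)) * eSeries (eWeight w) (hatGF w m 0 y) := by ring
      _ = hatGF w m 0 x + δ := by
        rw [add_tsub_cancel_of_le hxy.le, ← hatGF_eq_lower_add_mul hw.nonneg, hadd]
  rw [ENNReal.add_le_add_iff_left hHx] at h1
  by_contra! hge
  have h2 : δ + (y - x) * eWeight w 0 ≤ δ + 0 := by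
    rw [add_zero]
    refine le_trans ?_ h1
    gcongr
    exact le_mul_of_one_le_left (zero_le) hge
  rw [ENNReal.add_le_add_iff_left hδtop, nonpos_iff_eq_zero, mul_eq_zero] at h2
  rcases h2 with h2 | h2
  · exact (tsub_pos_of_lt hxy).ne' h2
  · exact hw.eWeight_zero_pos.ne' h2

theorem mul_ePhiDeriv_lt_one_of_lt {m : ℕ} {x : ℝ≥0∞} (hx : x < rootRadius w m) :
    x * ePhiDeriv w (hatGF w m 0 x) < 1 := by
  obtain ⟨y, hxy, hy⟩ := exists_between hx
  exact hw.mul_ePhiDeriv_lt_one hxy (hw.momentGF_ne_top hy)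

/-- With an infinite radius, x Φ'(F̂_m(x)) < 1 would hold for all finite `x`. But F̂_m(x) ≥ x w_0
and Φ' dominates a monomial of positive degree, so the left side is unbounded. -/
theorem rootRadius_lt_top (m : ℕ) : rootRadius w m < ∞ := by
  rw [lt_top_iff_ne_top]
  intro htop
  obtain ⟨k, b, hb, hle⟩ := hw.exists_monomial_le
  have h : ∀ x : NNReal, (x : ℝ≥0∞) * (b * (x * eWeight w 0) ^ (k + 1)) ≤ 1 := by
    intro x
    refine le_trans ?_ (hw.mul_ePhiDeriv_lt_one_of_lt (m := m) (x := x) (by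
      rw [htop]; exact ENNReal.coe_lt_top)).le
    gcongr
    exact (hle _).trans (eSeries_mono _ (hw.mul_zero_le_hatGF m x))
  have hc : b * eWeight w 0 ^ (k + 1) ≠ 0 := mul_ne_zero hb (pow_ne_zero _ hw.eWeight_zero_pos.ne')
  have h2 : ∀ x : NNReal, 1 ≤ x → (x : ℝ≥0∞) * (b * eWeight w 0 ^ (k + 1)) ≤ 1 := by
    intro x hx
    refine le_trans ?_ (h x)
    rw [mul_pow]
    gcongr
    refine le_mul_of_one_le_left zero_le (one_le_pow₀ (by exact_mod_cast hx))
  have h3 : (∞ : ℝ≥0∞) * (b * eWeight w 0 ^ (k + 1)) ≤ 1 := by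
    have ht : Tendsto (fun x : NNReal => (x : ℝ≥0∞) * (b * eWeight w 0 ^ (k + 1))) atTop
        (𝓝 (∞ * (b * eWeight w 0 ^ (k + 1)))) :=
      ENNReal.Tendsto.mul_const (ENNReal.tendsto_coe_nhds_top.2 tendsto_id)
          (Or.inl ENNReal.top_ne_zero)
    exact le_of_tendsto ht ((eventually_ge_atTop 1).mono h2)
  rw [ENNReal.top_mul hc] at h3
  simp at h3

theorem rootRadius_pos (m : ℕ) : 0 < rootRadius w m := by
  obtain ⟨s, hs0, hs⟩ := exists_between hw.radius_pos
  have hs_fin := hs.ne_top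
  have hΦ := hw.eSeries_ne_top hs
  -- With this `x` the number `s` satisfies x Φ(s) ≤ s, the fixed point inequality for m = 0. The `+
  -- 1` makes the denominator plainly nonzero.
  set x := s / (eSeries (eWeight w) s + 1) with hx
  have hx0 : 0 < x := ENNReal.div_pos hs0.ne' (by finiteness)
  have hle : x * eSeries (eWeight w) s ≤ s := by
    calc _ ≤ x * (eSeries (eWeight w) s + 1) := by gcongr; exact le_self_add
      _ = s := ENNReal.div_mul_cancel (by positivity) (by finiteness)
  have h1 : hatGF w 0 0 x ≤ s := hatGF_le_of_fixedPoint hw.nonneg 0 (by simpa [lowerGF] using hle)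
  have h2 : momentGF w 0 0 x ≠ ∞ := by
    refine ne_top_of_le_ne_top hs_fin (le_trans ?_ h1)
    rw [hatGF_eq_lower_add]
    exact le_add_self
  have hx_fin : x ≠ ∞ := ENNReal.div_ne_top hs_fin (by positivity)
  have h3 : momentGF w m 0 (x / 2 ^ m) ≠ ∞ := by
    refine ne_top_of_le_ne_top h2 ((momentGF_le_zero_left w m _).trans_eq ?_)
    rw [ENNReal.mul_div_cancel (by positivity) (by finiteness)]
  refine lt_of_lt_of_le ?_ (hw.le_rootRadius ?_ h3)
  · exact ENNReal.div_pos hx0.ne' (by finiteness)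
  · exact ENNReal.div_ne_top hx_fin (by positivity)

theorem mul_ePhiDeriv_le_one (m : ℕ) :
    rootRadius w m * ePhiDeriv w (hatGF w m 0 (rootRadius w m)) ≤ 1 := by
  set ρ := rootRadius w m with hρ
  have : (𝓝[<] ρ).NeBot := nhdsLT_neBot_of_exists_lt ⟨0, hw.rootRadius_pos m⟩
  -- Fixing the outer factor `y` leaves a lower semicontinuous function of F̂_m alone. The limit y →
  -- ρ is taken only after Φ' has been shown to be finite there.
  have key : ∀ y < ρ, y * ePhiDeriv w (hatGF w m 0 ρ) ≤ 1 := by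
    intro y hy
    have hy' : y ≠ ∞ := hy.ne_top
    have hlsc : LowerSemicontinuous fun s => y * ePhiDeriv w s := by
      have : (fun s => y * ePhiDeriv w s) =
          eSeries (fun n => y * derivCoeff (eWeight w) n) := by
        funext s
        rw [ePhiDeriv, eSeries, eSeries, ← ENNReal.tsum_mul_left]
        simp_rw [mul_assoc]
      rw [this]
      exact lowerSemicontinuous_eSeries fun n => ENNReal.mul_ne_top hy'
          (derivCoeff_eWeight_ne_top w n)
    by_contra! hgt
    have h1 := (tendsto_hatGF_left w m ρ).eventually (hlsc _ _ hgt)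
    have h2 : ∀ᶠ x in 𝓝[<] ρ, y < x := mem_nhdsWithin_of_mem_nhds (lt_mem_nhds hy)
    obtain ⟨x, ⟨hx1, hx2⟩, hx3⟩ := ((h1.and h2).and self_mem_nhdsWithin).exists
    have h3 := hw.mul_ePhiDeriv_lt_one_of_lt (m := m) (x := x) hx3
    have h4 : y * ePhiDeriv w (hatGF w m 0 x) ≤ x * ePhiDeriv w (hatGF w m 0 x) := by gcongr
    exact lt_irrefl _ (hx1.trans_le (h4.trans h3.le))
  have hfin : ePhiDeriv w (hatGF w m 0 ρ) ≠ ∞ := by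
    intro htop
    obtain ⟨y, hy0, hy⟩ := exists_between (hw.rootRadius_pos m)
    have := key y hy
    rw [htop, ENNReal.mul_top hy0.ne'] at this
    simp at this
  have ht : Tendsto (fun y => y * ePhiDeriv w (hatGF w m 0 ρ)) (𝓝[<] ρ)
      (𝓝 (ρ * ePhiDeriv w (hatGF w m 0 ρ))) :=
    ((ENNReal.continuous_mul_const hfin).tendsto ρ).mono_left nhdsWithin_le_nhds
  refine le_of_tendsto ht ?_
  filter_upwards [self_mem_nhdsWithin] with y hy using key y hy

theorem ePhiDeriv_ne_top_at (m : ℕ) : ePhiDeriv w (hatGF w m 0 (rootRadius w m)) ≠ ∞ := by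
  intro htop
  have := hw.mul_ePhiDeriv_le_one m
  rw [htop, ENNReal.mul_top (hw.rootRadius_pos m).ne'] at this
  simp at this

theorem hatGF_lt_radius (m : ℕ) : hatGF w m 0 (rootRadius w m) < seriesRadius w := by
  by_contra! h
  exact hw.ePhiDeriv_ne_top_at m (hw.ePhiDeriv_eq_top h)

theorem hatGF_ne_top (m : ℕ) : hatGF w m 0 (rootRadius w m) ≠ ∞ := (hw.hatGF_lt_radius m).ne_top

/-- If the value were below 1, moving from s = F̂_m(ρ) to s + δ would make the fixed point
inequality strict. By right continuity it would persist at some ρ + ε, and F̂_m would be finite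
beyond its radius. -/
theorem one_le_mul_ePhiDeriv {m : ℕ} {y : ℝ≥0∞} (hy : rootRadius w m < y)
    (hG : lowerGF w m y ≠ ∞) :
    1 ≤ rootRadius w m * ePhiDeriv w (hatGF w m 0 (rootRadius w m)) := by
  set ρ := rootRadius w m with hρ
  set s := hatGF w m 0 ρ with hs
  by_contra! hlt
  have hs_fin : s ≠ ∞ := hw.hatGF_ne_top m
  have hρtop : ρ ≠ ∞ := (hw.rootRadius_lt_top m).ne
  have hρ0 : ρ ≠ 0 := (hw.rootRadius_pos m).ne'
  obtain ⟨t, hst, htr⟩ := exists_between (hw.hatGF_lt_radius m)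
  obtain ⟨δ₀, hδ₀, hδ⟩ := exists_eSeries_add_lt hst (hw.ePhiDeriv_ne_top htr)
    (c := 1 / ρ) (by rwa [ENNReal.lt_div_iff_mul_lt (Or.inl hρ0) (Or.inl hρtop), mul_comm])
  -- The three bounds keep the slope at `s + δ` below 1, keep δ finite, and keep `s + δ` inside the
  -- disc of convergence of Φ.
  set δ := min δ₀ (min 1 (t - s)) with hδdef
  have hδ0 : 0 < δ := lt_min hδ₀ (lt_min one_pos (tsub_pos_of_lt hst))
  have hδtop : δ ≠ ∞ := ne_top_of_le_ne_top ENNReal.one_ne_top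
    ((min_le_right _ _).trans (min_le_left _ _))
  have hsδt : s + δ ≤ t := by
    calc s + δ ≤ s + (t - s) := by
          gcongr
          exact (min_le_right _ _).trans (min_le_right _ _)
      _ = t := add_tsub_cancel_of_le hst.le
  have hΦfin : eSeries (eWeight w) (s + δ) ≠ ∞ := hw.eSeries_ne_top (hsδt.trans_lt htr)
  have h1 : ρ * ePhiDeriv w (s + δ) < 1 := by
    have := hδ δ (min_le_left _ _)
    rwa [ENNReal.lt_div_iff_mul_lt (Or.inl hρ0) (Or.inl hρtop), mul_comm] at this
  have hGρ : lowerGF w m ρ ≠ ∞ := ne_top_of_le_ne_top hG (lowerGF_mono w m hy.le)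
  have h2 : lowerGF w m ρ + ρ * eSeries (eWeight w) (s + δ) < s + δ := by
    calc _ ≤ lowerGF w m ρ + ρ * (eSeries (eWeight w) s + ePhiDeriv w (s + δ) * δ) := by
          gcongr
          exact eSeries_add_le _ _ _
      _ = s + ρ * ePhiDeriv w (s + δ) * δ := by
        have hsum : s = lowerGF w m ρ + ρ * eSeries (eWeight w) s :=
          hatGF_eq_lower_add_mul hw.nonneg m ρ
        nth_rw 3 [hsum]
        ring
      _ < s + 1 * δ := by
        refine ENNReal.add_lt_add_left hs_fin ?_
        exact (ENNReal.mul_lt_mul_iff_left hδ0.ne' hδtop).2 h1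
      _ = s + δ := by rw [one_mul]
  -- continuity of the left-hand side to the right of `ρ`
  set a : ℕ → ℝ≥0∞ := fun n => (∑ k ∈ Finset.range m, (m.choose k : ℝ≥0∞) *
    ENNReal.ofReal (momentCoeff w k 0 n)) + if n = 1 then eSeries (eWeight w) (s + δ) else 0 with ha
  have haS : ∀ x, eSeries a x = lowerGF w m x + x * eSeries (eWeight w) (s + δ) := by
    intro x
    rw [eSeries]
    simp only [ha, add_mul, ENNReal.tsum_add]
    congr 1
    · simp_rw [lowerGF, momentGF_eq_eSeries hw.nonneg, eSeries, ← ENNReal.tsum_mul_left]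
      rw [← Summable.tsum_finsetSum (fun _ _ => ENNReal.summable)]
      simp_rw [Finset.sum_mul, mul_assoc]
    · rw [tsum_eq_single 1 (by intro n hn; simp [hn])]
      simp [mul_comm]
  obtain ⟨y', hy1, hy2⟩ := exists_between hy
  have hy'top : y' ≠ ∞ := hy2.ne_top
  have hay : eSeries a y' ≠ ∞ := by
    rw [haS]
    exact ENNReal.add_ne_top.2 ⟨ne_top_of_le_ne_top hG (lowerGF_mono w m hy2.le),
      ENNReal.mul_ne_top hy'top hΦfin⟩
  obtain ⟨ε₀, hε₀, hε⟩ := exists_eSeries_add_lt hy1 hay (c := s + δ) (by rwa [haS])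
  set ε := min ε₀ 1 with hεdef
  have hε0 : ε ≠ 0 := (lt_min hε₀ one_pos).ne'
  have hεtop : ε ≠ ∞ := ne_top_of_le_ne_top ENNReal.one_ne_top (min_le_right _ _)
  have h3 := hε ε (min_le_left _ _)
  rw [haS] at h3
  have h4 : hatGF w m 0 (ρ + ε) ≠ ∞ :=
    ne_top_of_le_ne_top (ENNReal.add_ne_top.2 ⟨hs_fin, hδtop⟩)
      (hatGF_le_of_fixedPoint hw.nonneg m h3.le)
  have h5 : momentGF w m 0 (ρ + ε) ≠ ∞ := by
    refine ne_top_of_le_ne_top h4 ?_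
    rw [hatGF_eq_lower_add]
    exact le_add_self
  have h6 := hw.le_rootRadius (ENNReal.add_ne_top.2 ⟨hρtop, hεtop⟩) h5
  exact h6.not_gt (ENNReal.lt_add_right hρtop hε0)

/-- Since R ≥ 1, passing from the exponent `m` to `m + 1` adds at least 1 to the power of 1 + R,
hence at least F_0 > 0 to the sum. -/
theorem hatGF_lt_succ {m : ℕ} {x : ℝ≥0∞} (hx : x ≠ 0) (h : hatGF w m 0 x ≠ ∞) :
    hatGF w m 0 x < hatGF w (m + 1) 0 x := by
  have h1 : hatGF w m 0 x + momentGF w 0 0 x ≤ hatGF w (m + 1) 0 x := by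
    rw [hatGF_zero, hatGF_zero, momentGF, ← ENNReal.tsum_add]
    refine ENNReal.tsum_le_tsum fun T => ?_
    have hR : (1 : ℝ≥0∞) ≤ T.numRootSubtrees := by exact_mod_cast T.numRootSubtrees_pos
    have h2 : (1 + (T.numRootSubtrees : ℝ≥0∞)) ^ m + 1 ≤
        (1 + (T.numRootSubtrees : ℝ≥0∞)) ^ (m + 1) := by
      rw [pow_succ, mul_add, mul_one]
      gcongr
      calc (1 : ℝ≥0∞) = 1 ^ m * 1 := by simp
        _ ≤ _ := by gcongr; exact le_self_add
    simp only [hatTerm, pow_zero, mul_one]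
    calc _ = ENNReal.ofReal (T.weight w) * ((1 + (T.numRootSubtrees : ℝ≥0∞)) ^ m + 1) *
        x ^ T.size := by
          ring
      _ ≤ _ := by gcongr
  refine lt_of_lt_of_le (ENNReal.lt_add_right h ?_) h1
  rw [momentGF_zero_right hw.nonneg]
  exact mul_ne_zero hx (hw.eWeight_zero_pos.trans_le (eWeight_zero_le_eSeries w _)).ne'

theorem rootRadius_antitone : Antitone (rootRadius w) := by
  intro k l h
  refine le_of_forall_lt fun x hx => ?_
  obtain ⟨y, hxy, hy⟩ := exists_between hx
  refine lt_of_lt_of_le hxy (hw.le_rootRadius hy.ne_top ?_)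
  exact ne_top_of_le_ne_top (hw.momentGF_ne_top hy) (momentGF_mono_left w 0 y h)

/-- Were the two radii equal, the strictly larger F̂_{m+1} would push the characteristic value above
1. -/
theorem rootRadius_succ_lt_of {m : ℕ}
    (h : rootRadius w m * ePhiDeriv w (hatGF w m 0 (rootRadius w m)) = 1) :
    rootRadius w (m + 1) < rootRadius w m := by
  refine lt_of_le_of_ne (hw.rootRadius_antitone (Nat.le_succ m)) fun heq => ?_
  have h1 := hw.mul_ePhiDeriv_le_one (m + 1)
  have h2 := hw.ePhiDeriv_ne_top_at (m + 1)
  rw [heq] at h1 h2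
  have h3 := hw.ePhiDeriv_strict
    (hw.hatGF_lt_succ (hw.rootRadius_pos m).ne' (hw.hatGF_ne_top m)) h2
  have h4 := (ENNReal.mul_lt_mul_iff_right (hw.rootRadius_pos m).ne'
    (hw.rootRadius_lt_top m).ne).2 h3
  rw [h] at h4
  exact h4.not_ge h1

/-- The characteristic equation `ρ_m Φ'(\hat F_m(ρ_m)) = 1`. -/
theorem mul_ePhiDeriv_eq_one (m : ℕ) :
    rootRadius w m * ePhiDeriv w (hatGF w m 0 (rootRadius w m)) = 1 := by
  induction m with
  | zero =>
    refine le_antisymm (hw.mul_ePhiDeriv_le_one 0) ?_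
    exact hw.one_le_mul_ePhiDeriv (hw.rootRadius_lt_top 0) (by simp [lowerGF])
  | succ m ih =>
    refine le_antisymm (hw.mul_ePhiDeriv_le_one _) ?_
    -- The lower part for `m + 1` involves only F_0, …, F_m, all finite below ρ_m, which now exceeds
    -- ρ_{m+1}. For `m = 0` the lower part is an empty sum.
    obtain ⟨y, hy1, hy2⟩ := exists_between (hw.rootRadius_succ_lt_of ih)
    exact hw.one_le_mul_ePhiDeriv hy1 (lowerGF_succ_ne_top (hw.momentGF_ne_top hy2))

theorem rootRadius_strictAnti : StrictAnti (rootRadius w) :=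
  strictAnti_nat_of_succ_lt fun m => hw.rootRadius_succ_lt_of (hw.mul_ePhiDeriv_eq_one m)

end Admissible

end OrderedTree

/-! ### The principal square root -/

/-- The principal square root. -/
noncomputable def csqrt (z : ℂ) : ℂ := z ^ (1 / 2 : ℂ)

theorem csqrt_sq (z : ℂ) : csqrt z ^ 2 = z := by
  rw [csqrt, ← Complex.cpow_nat_mul]
  norm_num

theorem norm_csqrt (z : ℂ) : ‖csqrt z‖ ^ 2 = ‖z‖ := by
  rw [← norm_pow, csqrt_sq]

theorem tendsto_csqrt_zero : Tendsto csqrt (𝓝 0) (𝓝 0) := by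
  rw [tendsto_zero_iff_norm_tendsto_zero]
  have h : ∀ z, ‖csqrt z‖ = √‖z‖ := fun z => by
    rw [← norm_csqrt z, Real.sqrt_sq (norm_nonneg _)]
  simp_rw [h]
  have : Tendsto (fun z : ℂ => √‖z‖) (𝓝 0) (𝓝 (√‖(0 : ℂ)‖)) :=
    (Real.continuous_sqrt.comp continuous_norm).tendsto 0
  simpa using this

theorem analyticAt_csqrt {z : ℂ} (hz : z ∈ Complex.slitPlane) : AnalyticAt ℂ csqrt z :=
  analyticAt_id.cpow analyticAt_const hz

theorem csqrt_ne_zero {z : ℂ} (hz : z ≠ 0) : csqrt z ≠ 0 := by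
  intro h
  have := csqrt_sq z
  rw [h] at this
  exact hz (by rw [← this]; ring)

theorem hasDerivAt_csqrt {z : ℂ} (hz : z ∈ Complex.slitPlane) :
    HasDerivAt csqrt (1 / (2 * csqrt z)) z := by
  have h1 := (analyticAt_csqrt hz).differentiableAt.hasDerivAt
  have h2 : HasDerivAt (fun z => csqrt z ^ 2) (2 * csqrt z * deriv csqrt z) z := by
    simpa using h1.fun_pow 2
  have h3 : HasDerivAt (fun z => csqrt z ^ 2) 1 z := by
    simp_rw [csqrt_sq]
    exact hasDerivAt_id z
  have h4 := h2.unique h3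
  have h5 := csqrt_ne_zero (Complex.slitPlane_ne_zero hz)
  have h6 : deriv csqrt z = 1 / (2 * csqrt z) := by
    field_simp
    rw [← h4]
    ring
  rwa [h6] at h1

theorem re_csqrt_pos {z : ℂ} (hz : z ∈ Complex.slitPlane) : 0 < (csqrt z).re := by
  have hz0 := Complex.slitPlane_ne_zero hz
  have harg := Complex.mem_slitPlane_iff_arg.1 hz
  rw [csqrt, Complex.cpow_def_of_ne_zero hz0, Complex.exp_re]
  refine mul_pos (Real.exp_pos _) (Real.cos_pos_of_mem_Ioo ?_)
  have h : (Complex.log z * (1 / 2)).im = Complex.arg z / 2 := by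
    rw [show (1 / 2 : ℂ) = ((1 / 2 : ℝ) : ℂ) by norm_num, Complex.im_mul_ofReal, Complex.log_im]
    ring
  rw [h]
  have h1 := Complex.neg_pi_lt_arg z
  have h2 := lt_of_le_of_ne (Complex.arg_le_pi z) harg.1
  constructor <;> linarith

theorem eq_csqrt_of_sq_eq {z t : ℂ} (hz : z ∈ Complex.slitPlane) (ht : t ^ 2 = z)
    (hre : 0 ≤ t.re) : t = csqrt z := by
  have h : (t - csqrt z) * (t + csqrt z) = 0 := by
    have := csqrt_sq z
    linear_combination ht - this
  rcases mul_eq_zero.1 h with h | h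
  · exact sub_eq_zero.1 h
  · have h1 := congrArg Complex.re h
    have h2 := re_csqrt_pos hz
    simp only [Complex.add_re, Complex.zero_re] at h1
    linarith

theorem csqrt_ofReal_mul {r : ℝ} (hr : 0 < r) {z : ℂ} (hz : z ∈ Complex.slitPlane) :
    csqrt (r * z) = √r * csqrt z := by
  symm
  refine eq_csqrt_of_sq_eq ?_ ?_ ?_
  · rw [Complex.mem_slitPlane_iff] at hz ⊢
    simp only [Complex.re_ofReal_mul, Complex.im_ofReal_mul]
    rcases hz with h | h
    · exact Or.inl (mul_pos hr h)
    · exact Or.inr (mul_ne_zero hr.ne' h)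
  · rw [mul_pow, csqrt_sq, ← Complex.ofReal_pow, Real.sq_sqrt hr.le]
  · rw [Complex.re_ofReal_mul]
    exact mul_nonneg (Real.sqrt_nonneg _) (re_csqrt_pos hz).le

theorem sub_mem_slitPlane {ρ : ℝ} {z : ℂ} (h : ‖z‖ ≤ ρ) (hne : z ≠ ρ) :
    (ρ : ℂ) - z ∈ Complex.slitPlane := by
  rw [Complex.mem_slitPlane_iff]
  simp only [Complex.sub_re, Complex.ofReal_re, Complex.sub_im, Complex.ofReal_im]
  have h1 := Complex.re_le_norm z
  rcases (h1.trans h).lt_or_eq with h2 | h2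
  · exact Or.inl (by linarith)
  · right
    intro h3
    apply hne
    apply Complex.ext
    · simpa using h2
    · simp only [Complex.ofReal_im]
      linarith

theorem one_sub_mem_slitPlane {z : ℂ} (h : ‖z‖ ≤ 1) (hne : z ≠ 1) :
    1 - z ∈ Complex.slitPlane := by
  have := sub_mem_slitPlane (ρ := 1) h (by simpa using hne)
  simpa using this

/-! ### Power series on the unit disc -/

/-- `f` is the sum of the power series with coefficients `a` on the unit disc. -/
def HasUnitSeries (f : ℂ → ℂ) (a : ℕ → ℂ) : Prop :=
  ∀ z ∈ Metric.ball (0 : ℂ) 1, HasSum (fun n => a n * z ^ n) (f z)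

namespace HasUnitSeries

variable {f g : ℂ → ℂ} {a b : ℕ → ℂ}

theorem add (hf : HasUnitSeries f a) (hg : HasUnitSeries g b) :
    HasUnitSeries (fun z => f z + g z) (fun n => a n + b n) := by
  intro z hz
  simpa only [add_mul] using (hf z hz).add (hg z hz)

theorem sub (hf : HasUnitSeries f a) (hg : HasUnitSeries g b) :
    HasUnitSeries (fun z => f z - g z) (fun n => a n - b n) := by
  intro z hz
  simpa only [sub_mul] using (hf z hz).sub (hg z hz)

theorem const_mul (hf : HasUnitSeries f a) (c : ℂ) :
    HasUnitSeries (fun z => c * f z) (fun n => c * a n) := by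
  intro z hz
  simpa only [mul_assoc] using (hf z hz).mul_left c

theorem sum {ι : Type*} {s : Finset ι} {f : ι → ℂ → ℂ} {a : ι → ℕ → ℂ}
    (h : ∀ i ∈ s, HasUnitSeries (f i) (a i)) :
    HasUnitSeries (fun z => ∑ i ∈ s, f i z) (fun n => ∑ i ∈ s, a i n) := by
  intro z hz
  simp only [Finset.sum_mul]
  exact hasSum_sum fun i hi => h i hi z hz

theorem rotate (hf : HasUnitSeries f a) {u : ℂ} (hu : ‖u‖ = 1) :
    HasUnitSeries (fun z => f (u * z)) (fun n => u ^ n * a n) := by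
  intro z hz
  have := hf (u * z) (by simpa [hu] using hz)
  convert this using 2
  ring

theorem one_sub_mul (hf : HasUnitSeries f a) :
    HasUnitSeries (fun z => (1 - z) * f z) (fun n => a n - if n = 0 then 0 else a (n - 1)) := by
  intro z hz
  have h1 := hf z hz
  have h2 : HasSum (fun n => (if n = 0 then 0 else a (n - 1)) * z ^ n) (z * f z) := by
    rw [← hasSum_nat_add_iff' 1]
    have h3 := h1.mul_left z
    have h4 : (fun n => z * (a n * z ^ n)) =
        fun n => (if n + 1 = 0 then 0 else a (n + 1 - 1)) * z ^ (n + 1) := by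
      funext n
      rw [if_neg (Nat.succ_ne_zero n), Nat.add_sub_cancel]
      ring
    rw [h4] at h3
    simpa using h3
  have h5 := h1.sub h2
  have h6 : (fun n => a n * z ^ n - (if n = 0 then 0 else a (n - 1)) * z ^ n) =
      fun n => (a n - if n = 0 then 0 else a (n - 1)) * z ^ n := by
    funext n
    ring
  rw [h6] at h5
  have h7 : (1 - z) * f z = f z - z * f z := by ring
  simpa only [h7] using h5

theorem eSeries_ne_top (hf : HasUnitSeries f a) {y : ℝ≥0∞} (hy : y < 1) :
    eSeries (fun n => ‖a n‖ₑ) y ≠ ∞ := by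
  obtain ⟨x, hyx, hx⟩ := exists_between hy
  lift x to NNReal using hx.ne_top
  lift y to NNReal using hy.ne_top
  have hyx' : y < x := by exact_mod_cast hyx
  have hx0 : 0 < x := (zero_le).trans_lt hyx'
  have hsum := (hf (x : ℝ) (by simpa using hx)).summable
  obtain ⟨C, hC⟩ := (hsum.tendsto_atTop_zero.norm.bddAbove_range)
  have hb : ∀ n, ‖a n‖ * (x : ℝ) ^ n ≤ C := by
    intro n
    have := hC ⟨n, rfl⟩
    simpa using this
  have hgeo : Summable fun n => C * ((y : ℝ) / x) ^ n :=
    (summable_geometric_of_lt_one (by positivity)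
      ((div_lt_one (by exact_mod_cast hx0)).2 (by exact_mod_cast hyx'))).mul_left C
  have hs : Summable fun n => ‖a n‖ * (y : ℝ) ^ n := by
    refine Summable.of_nonneg_of_le (fun n => by positivity) (fun n => ?_) hgeo
    have hxpos : (0 : ℝ) < x := by exact_mod_cast hx0
    calc ‖a n‖ * (y : ℝ) ^ n = (‖a n‖ * (x : ℝ) ^ n) * ((y : ℝ) / x) ^ n := by
          rw [div_pow]
          field_simp
      _ ≤ _ := by gcongr; exact hb n
  have h2 := hs.tsum_ofReal_ne_top
  rw [eSeries]
  convert h2 using 3 with n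
  rw [ENNReal.ofReal_mul (norm_nonneg _), ofReal_norm, ENNReal.ofReal_pow (by positivity)]
  simp

theorem hasDerivAt (hf : HasUnitSeries f a) {z : ℂ} (hz : z ∈ Metric.ball (0 : ℂ) 1) :
    HasDerivAt f (∑' n, derivCoeff a n * z ^ n) z := by
  have hz' : ‖z‖ₑ < 1 := by
    rw [mem_ball_zero_iff] at hz
    rw [← ofReal_norm]
    exact ENNReal.ofReal_lt_one.2 hz
  obtain ⟨y, hzy, hy⟩ := exists_between hz'
  refine (hasDerivAt_powerSeries hzy (hf.eSeries_ne_top hy)).congr_of_eventuallyEq ?_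
  filter_upwards [Metric.isOpen_ball.mem_nhds hz] with v hv
  exact (hf v hv).tsum_eq.symm

theorem deriv (hf : HasUnitSeries f a) : HasUnitSeries (deriv f) (derivCoeff a) := by
  intro z hz
  have hz' : ‖z‖ₑ < 1 := by
    rw [mem_ball_zero_iff] at hz
    rw [← ofReal_norm]
    exact ENNReal.ofReal_lt_one.2 hz
  obtain ⟨y, hzy, hy⟩ := exists_between hz'
  obtain ⟨x, hyx, hx⟩ := exists_between hy
  have hD := eSeries_derivCoeff_ne_top hyx (hf.eSeries_ne_top hx)
  rw [← enorm_derivCoeff] at hD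
  have hs := (summable_of_eSeries_ne_top hzy.le hD).of_norm
  rw [(hf.hasDerivAt hz).deriv]
  exact hs.hasSum

theorem iteratedDeriv_zero (hf : HasUnitSeries f a) (n : ℕ) :
    iteratedDeriv n f 0 = n.factorial * a n := by
  induction n generalizing f a with
  | zero =>
    have h1 := (hf 0 (by simp)).unique (hasSum_single 0 (by intro n hn; simp [hn]))
    simp [h1]
  | succ n ih =>
    rw [iteratedDeriv_succ', ih hf.deriv, derivCoeff, Nat.factorial_succ]
    push_cast
    ring

theorem iteratedDeriv (hf : HasUnitSeries f a) (k : ℕ) :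
    HasUnitSeries (iteratedDeriv k f) (derivCoeff^[k] a) := by
  induction k generalizing f a with
  | zero => simpa using hf
  | succ k ih =>
    rw [iteratedDeriv_succ', Function.iterate_succ_apply]
    exact ih hf.deriv

theorem differentiableOn (hf : HasUnitSeries f a) : DifferentiableOn ℂ f (Metric.ball 0 1) :=
  fun _ hz => (hf.hasDerivAt hz).differentiableAt.differentiableWithinAt

/-- Cauchy's estimate for a bounded function on the unit disc. -/
theorem norm_coeff_le (hf : HasUnitSeries f a) {M : ℝ}
    (hM : ∀ z ∈ Metric.ball (0 : ℂ) 1, ‖f z‖ ≤ M) (n : ℕ) : ‖a n‖ ≤ M := by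
  -- The function need not extend to the unit circle, so Cauchy's estimate is used on smaller
  -- circles and r tends to 1 afterwards.
  have h : ∀ r ∈ Set.Ioo (0 : ℝ) 1, ‖a n‖ * r ^ n ≤ M := by
    intro r hr
    have hsub : Metric.closedBall (0 : ℂ) r ⊆ Metric.ball 0 1 :=
      Metric.closedBall_subset_ball hr.2
    have hd : DiffContOnCl ℂ f (Metric.ball 0 r) :=
      (hf.differentiableOn.mono (by
        rw [closure_ball _ hr.1.ne']; exact hsub)).diffContOnCl
    have := Complex.norm_iteratedDeriv_le_of_forall_mem_sphere_norm_le n hr.1 hd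
      (fun z hz => hM z (hsub (Metric.sphere_subset_closedBall hz)))
    rw [hf.iteratedDeriv_zero, norm_mul, Complex.norm_natCast,
      le_div_iff₀ (pow_pos hr.1 n), mul_assoc] at this
    exact le_of_mul_le_mul_left this (by positivity)
  have ht : Tendsto (fun r : ℝ => ‖a n‖ * r ^ n) (𝓝[<] 1) (𝓝 (‖a n‖ * 1 ^ n)) :=
    ((continuous_const.mul (continuous_pow n)).tendsto 1).mono_left nhdsWithin_le_nhds
  rw [one_pow, mul_one] at ht
  refine le_of_tendsto ht ?_
  filter_upwards [Ioo_mem_nhdsLT (zero_lt_one (α := ℝ))] with r hr using h r hr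

/-- Cauchy's estimate applied to the third derivative gains a factor of order n^{-3}. -/
theorem norm_coeff_mul_le (hf : HasUnitSeries f a) {M : ℝ}
    (hM : ∀ z ∈ Metric.ball (0 : ℂ) 1, ‖_root_.iteratedDeriv 3 f z‖ ≤ M) (n : ℕ) :
    ((n : ℝ) + 1) * (n + 2) * (n + 3) * ‖a (n + 3)‖ ≤ M := by
  have := (hf.iteratedDeriv 3).norm_coeff_le hM n
  simp only [Function.iterate_succ, Function.iterate_zero, Function.comp_apply, id, derivCoeff,
    norm_mul] at this
  have hn : ∀ k : ℕ, ‖((k : ℂ) + 1)‖ = k + 1 := by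
    intro k
    have : ((k : ℂ) + 1) = ((k + 1 : ℕ) : ℂ) := by push_cast; rfl
    rw [this, Complex.norm_natCast]
    push_cast
    rfl
  simp only [hn] at this
  push_cast at this
  refine le_trans (le_of_eq ?_) this
  ring

end HasUnitSeries

/-! ### The coefficients of `(1 - z) ^ (1 / 2)` -/

/-- The coefficients of the square root of `1 - z`. -/
noncomputable def sqrtCoeff : ℕ → ℝ
  | 0 => 1
  | n + 1 => sqrtCoeff n * ((n - 1 / 2) / (n + 1))

theorem sqrtCoeff_succ (n : ℕ) : sqrtCoeff (n + 1) = sqrtCoeff n * ((n - 1 / 2) / (n + 1)) := rfl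

theorem hasUnitSeries_csqrt : HasUnitSeries (fun z => csqrt (1 - z)) (fun n => sqrtCoeff n) := by
  have hc : ∀ n : ℕ, (-1) ^ n * Ring.choose (1 / 2 : ℂ) n = sqrtCoeff n := by
    intro n
    induction n with
    | zero => simp [sqrtCoeff]
    | succ n ih =>
      have h1 : Ring.choose (1 / 2 : ℂ) (n + 1) =
          Ring.choose (1 / 2 : ℂ) n * ((1 / 2 - n) / (n + 1)) := by
        rw [Ring.choose_eq_smul, Ring.choose_eq_smul, descPochhammer_succ_right,
          Polynomial.smeval_mul, Nat.factorial_succ]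
        simp only [smul_eq_mul, Polynomial.smeval_sub, Polynomial.smeval_X,
            Polynomial.smeval_natCast]
        have h2 : ((n : ℂ) + 1) ≠ 0 := by exact_mod_cast Nat.succ_ne_zero n
        have h3 : (n.factorial : ℂ) ≠ 0 := by exact_mod_cast n.factorial_ne_zero
        push_cast
        simp
        field_simp
      rw [h1, sqrtCoeff, pow_succ]
      push_cast
      rw [← ih]
      ring
  intro z hz
  have h := Complex.one_add_cpow_hasFPowerSeriesOnBall_zero (a := (1 / 2 : ℂ))
  have h2 := h.hasSum (y := -z) (by
    rw [Metric.mem_eball, edist_zero_right, enorm_neg, ← ofReal_norm]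
    rw [mem_ball_zero_iff] at hz
    exact ENNReal.ofReal_lt_one.2 hz)
  simp only [binomialSeries, FormalMultilinearSeries.ofScalars_apply_eq, zero_add,
      smul_eq_mul] at h2
  have h3 : (fun n => Ring.choose (1 / 2 : ℂ) n * (-z) ^ n) =
      fun n => (sqrtCoeff n : ℂ) * z ^ n := by
    funext n
    rw [← hc, neg_pow]
    ring
  rw [h3] at h2
  simpa only [csqrt, sub_eq_add_neg] using h2

theorem sqrtCoeff_succ_neg (n : ℕ) : sqrtCoeff (n + 1) < 0 := by
  induction n with
  | zero => norm_num [sqrtCoeff]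
  | succ n ih =>
    rw [sqrtCoeff]
    refine mul_neg_of_neg_of_pos ih (div_pos ?_ (by positivity))
    push_cast
    have : (0 : ℝ) ≤ n := n.cast_nonneg
    linarith

/-- The true order is n^{-3/2}. The weaker n^{-2} suffices because the remainder it is compared with
is O(n^{-3}) and only a relative error 1/n is wanted. -/
theorem sqrtCoeff_lower (n : ℕ) : 1 / 2 ≤ |sqrtCoeff (n + 1)| * ((n : ℝ) + 1) ^ 2 := by
  rw [abs_of_neg (sqrtCoeff_succ_neg n)]
  induction n with
  | zero => norm_num [sqrtCoeff]
  | succ n ih =>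
    refine ih.trans ?_
    rw [sqrtCoeff_succ (n + 1), ← neg_mul, mul_assoc]
    have h : 0 < -sqrtCoeff (n + 1) := neg_pos.2 (sqrtCoeff_succ_neg n)
    refine mul_le_mul_of_nonneg_left ?_ h.le
    have hn : (0 : ℝ) ≤ n := n.cast_nonneg
    push_cast
    rw [div_mul_eq_mul_div, le_div_iff₀ (by positivity)]
    nlinarith [mul_nonneg hn hn, mul_nonneg hn (mul_nonneg hn hn)]

/-- Multiplying a series by 1 - z differences its coefficients; for the square root this gains a
factor of order 1/n, which makes the higher odd powers negligible. -/
theorem sqrtCoeff_sub (n : ℕ) :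
    sqrtCoeff (n + 1) - sqrtCoeff n = sqrtCoeff (n + 1) * (-(3 / 2) / (n - 1 / 2)) := by
  have h1 : (n : ℝ) - 1 / 2 ≠ 0 := by
    intro h
    have : (2 * n : ℝ) = 1 := by linarith
    have h2 : 2 * n = 1 := by exact_mod_cast this
    omega
  have h2 : (n : ℝ) + 1 ≠ 0 := by positivity
  rw [sqrtCoeff]
  have h3 : (n : ℝ) * 2 - 1 ≠ 0 := by
    intro h
    exact h1 (by linarith)
  field_simp
  ring

theorem abs_sqrtCoeff_sub_le (n : ℕ) :
    |sqrtCoeff (n + 2) - sqrtCoeff (n + 1)| ≤ 6 * |sqrtCoeff (n + 2)| / (n + 2) := by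
  rw [sqrtCoeff_sub, abs_mul, mul_comm 6, mul_div_assoc]
  gcongr
  push_cast
  have hn : (0 : ℝ) ≤ n := n.cast_nonneg
  rw [abs_div, abs_neg, abs_of_pos (by norm_num : (0 : ℝ) < 3 / 2), abs_of_pos (by linarith),
    div_le_div_iff₀ (by linarith) (by positivity)]
  linarith

theorem abs_sqrtCoeff_le (n : ℕ) : |sqrtCoeff (n + 1)| ≤ 4 * |sqrtCoeff (n + 2)| := by
  rw [sqrtCoeff_succ (n + 1), abs_mul]
  have hn : (0 : ℝ) ≤ n := n.cast_nonneg
  push_cast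
  rw [abs_of_pos (a := ((n : ℝ) + 1 - 1 / 2) / (n + 1 + 1)) (div_pos (by linarith) (by positivity))]
  have : 1 / 4 ≤ ((n : ℝ) + 1 - 1 / 2) / (n + 1 + 1) := by
    rw [div_le_div_iff₀ (by norm_num) (by positivity)]
    linarith
  nlinarith [abs_nonneg (sqrtCoeff (n + 1))]

/-- The triangle inequality keeps just one factor 1/n, which is all that the relative error allows
for. -/
theorem abs_sqrtCoeff_second_diff_le (n : ℕ) :
    |(sqrtCoeff (n + 3) - sqrtCoeff (n + 2)) - (sqrtCoeff (n + 2) - sqrtCoeff (n + 1))| ≤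
      54 * |sqrtCoeff (n + 3)| / (n + 3) := by
  have h1 := abs_sqrtCoeff_sub_le (n + 1)
  have h2 := abs_sqrtCoeff_sub_le n
  have h3 := abs_sqrtCoeff_le (n + 1)
  have hn : (0 : ℝ) ≤ n := n.cast_nonneg
  have h4 : 6 * |sqrtCoeff (n + 2)| / ((n : ℝ) + 2) ≤ 48 * |sqrtCoeff (n + 3)| / (n + 3) := by
    rw [div_le_div_iff₀ (by positivity) (by positivity)]
    have h5 : |sqrtCoeff (n + 2)| * (n + 3) ≤ 4 * |sqrtCoeff (n + 3)| * (2 * (n + 2)) :=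
      mul_le_mul h3 (by linarith) (by positivity) (by positivity)
    linarith
  have h6 : 6 * |sqrtCoeff (n + 1 + 2)| / (((n + 1 : ℕ) : ℝ) + 2) =
      6 * |sqrtCoeff (n + 3)| / (n + 3) := by
    push_cast
    ring_nf
  rw [h6] at h1
  refine (abs_sub _ _).trans ?_
  calc _ ≤ 6 * |sqrtCoeff (n + 3)| / (n + 3) + 48 * |sqrtCoeff (n + 3)| / (n + 3) :=
        add_le_add h1 (h2.trans h4)
    _ = _ := by ring

/-! ### Functions on the unit disc with bounded third derivative -/

/-- The third derivative of `f` is bounded on the part of the unit disc that is close to `ζ`. -/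
def ThirdBddNear (f : ℂ → ℂ) (ζ : ℂ) : Prop :=
  ∃ C : ℝ, ∀ᶠ z in 𝓝[Metric.ball 0 1] ζ, ‖iteratedDeriv 3 f z‖ ≤ C

theorem eventuallyEq_iteratedDeriv_of_nhdsWithin {f g : ℂ → ℂ} {s : Set ℂ} (hs : IsOpen s) {ζ : ℂ}
    (h : f =ᶠ[𝓝[s] ζ] g) (n : ℕ) : iteratedDeriv n f =ᶠ[𝓝[s] ζ] iteratedDeriv n g := by
  filter_upwards [eventually_eventually_nhdsWithin.2 h, self_mem_nhdsWithin] with z hz hzs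
  rw [hs.nhdsWithin_eq hzs] at hz
  exact Filter.EventuallyEq.iteratedDeriv_eq n hz

theorem eventuallyEq_deriv_of_nhdsWithin {f g : ℂ → ℂ} {s : Set ℂ} (hs : IsOpen s) {ζ : ℂ}
    (h : f =ᶠ[𝓝[s] ζ] g) : deriv f =ᶠ[𝓝[s] ζ] deriv g := by
  simpa using eventuallyEq_iteratedDeriv_of_nhdsWithin hs h 1

namespace ThirdBddNear

variable {f g : ℂ → ℂ} {ζ : ℂ}

theorem congr (hf : ThirdBddNear f ζ) (h : g =ᶠ[𝓝[Metric.ball 0 1] ζ] f) : ThirdBddNear g ζ := by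
  obtain ⟨C, hC⟩ := hf
  refine ⟨C, ?_⟩
  filter_upwards [hC, eventuallyEq_iteratedDeriv_of_nhdsWithin Metric.isOpen_ball h 3] with z hz h'
  rwa [h']

theorem of_analyticAt (hf : AnalyticAt ℂ f ζ) : ThirdBddNear f ζ := by
  have h : ContinuousAt (iteratedDeriv 3 f) ζ := by
    rw [iteratedDeriv_eq_iterate]
    exact (hf.iterated_deriv 3).continuousAt
  refine ⟨‖iteratedDeriv 3 f ζ‖ + 1, ?_⟩
  filter_upwards [nhdsWithin_le_nhds (h.norm.eventually (gt_mem_nhds (lt_add_one _)))] with z hz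
  exact hz.le

theorem sub (hf : ThirdBddNear f ζ) (hg : ThirdBddNear g ζ)
    (hfd : DifferentiableOn ℂ f (Metric.ball 0 1)) (hgd : DifferentiableOn ℂ g (Metric.ball 0 1)) :
    ThirdBddNear (fun z => f z - g z) ζ := by
  obtain ⟨C, hC⟩ := hf
  obtain ⟨C', hC'⟩ := hg
  refine ⟨C + C', ?_⟩
  filter_upwards [hC, hC', self_mem_nhdsWithin] with z h1 h2 hz
  have hz' := Metric.isOpen_ball.mem_nhds hz
  rw [iteratedDeriv_fun_sub ((hfd.analyticAt hz').contDiffAt) ((hgd.analyticAt hz').contDiffAt)]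
  exact (norm_sub_le _ _).trans (add_le_add h1 h2)

theorem add (hf : ThirdBddNear f ζ) (hg : ThirdBddNear g ζ)
    (hfd : DifferentiableOn ℂ f (Metric.ball 0 1)) (hgd : DifferentiableOn ℂ g (Metric.ball 0 1)) :
    ThirdBddNear (fun z => f z + g z) ζ := by
  obtain ⟨C, hC⟩ := hf
  obtain ⟨C', hC'⟩ := hg
  refine ⟨C + C', ?_⟩
  filter_upwards [hC, hC', self_mem_nhdsWithin] with z h1 h2 hz
  have hz' := Metric.isOpen_ball.mem_nhds hz
  rw [iteratedDeriv_fun_add ((hfd.analyticAt hz').contDiffAt) ((hgd.analyticAt hz').contDiffAt)]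
  exact (norm_add_le _ _).trans (add_le_add h1 h2)

theorem sum {ι : Type*} {s : Finset ι} {f : ι → ℂ → ℂ} (h : ∀ i ∈ s, ThirdBddNear (f i) ζ)
    (hd : ∀ i ∈ s, DifferentiableOn ℂ (f i) (Metric.ball 0 1)) :
    ThirdBddNear (fun z => ∑ i ∈ s, f i z) ζ := by
  classical
  induction s using Finset.induction_on with
  | empty => simpa using of_analyticAt (f := fun _ => (0 : ℂ)) analyticAt_const
  | insert a s ha ih =>
    simp_rw [Finset.sum_insert ha]
    refine (h a (by simp)).add (ih (fun i hi => h i (by simp [hi]))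
      (fun i hi => hd i (by simp [hi]))) (hd a (by simp)) ?_
    exact DifferentiableOn.fun_sum fun i hi => hd i (by simp [hi])

/-- A local bound at all points of the closed disc gives a global bound. -/
theorem exists_bound (h : ∀ ζ ∈ Metric.closedBall (0 : ℂ) 1, ThirdBddNear f ζ) :
    ∃ M, ∀ z ∈ Metric.ball (0 : ℂ) 1, ‖iteratedDeriv 3 f z‖ ≤ M := by
  suffices H : ∃ M, ∀ z ∈ Metric.closedBall (0 : ℂ) 1, z ∈ Metric.ball (0 : ℂ) 1 →
      ‖iteratedDeriv 3 f z‖ ≤ M by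
    obtain ⟨M, hM⟩ := H
    exact ⟨M, fun z hz => hM z (Metric.ball_subset_closedBall hz) hz⟩
  refine (isCompact_closedBall (0 : ℂ) 1).induction_on
    (p := fun s => ∃ M, ∀ z ∈ s, z ∈ Metric.ball (0 : ℂ) 1 → ‖iteratedDeriv 3 f z‖ ≤ M)
    ⟨0, by simp⟩ ?_ ?_ ?_
  · rintro s t hst ⟨M, hM⟩
    exact ⟨M, fun z hz => hM z (hst hz)⟩
  · rintro s t ⟨M, hM⟩ ⟨M', hM'⟩
    refine ⟨max M M', fun z hz hzb => ?_⟩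
    rcases hz with hz | hz
    · exact (hM z hz hzb).trans (le_max_left _ _)
    · exact (hM' z hz hzb).trans (le_max_right _ _)
  · intro ζ hζ
    obtain ⟨C, hC⟩ := h ζ hζ
    rw [eventually_nhdsWithin_iff] at hC
    exact ⟨_, mem_nhdsWithin_of_mem_nhds hC, C, fun z hz => hz⟩

/-- With s = (1 - uz)^{1/2} one has ds/dz = -u/(2s), so a derivative in z lowers the power of `s` by
two and keeps the other factor analytic in `s`. -/
theorem deriv_sqrt_pow_mul {k : ℕ} {u : ℂ} {G : ℂ → ℂ} (hu : ‖u‖ = 1)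
    (huζ : u * ζ = 1) (hG : AnalyticAt ℂ G 0)
    (hf : f =ᶠ[𝓝[Metric.ball 0 1] ζ] fun z => csqrt (1 - u * z) ^ (k + 2) * G (csqrt (1 - u * z))) :
    ∃ G₁, AnalyticAt ℂ G₁ 0 ∧ deriv f =ᶠ[𝓝[Metric.ball 0 1] ζ]
      fun z => csqrt (1 - u * z) ^ k * G₁ (csqrt (1 - u * z)) := by
  refine ⟨fun s => -(u / 2) * ((k + 2) * G s + s * deriv G s), by fun_prop, ?_⟩
  refine (eventuallyEq_deriv_of_nhdsWithin Metric.isOpen_ball hf).trans ?_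
  have ht : Tendsto (fun z => csqrt (1 - u * z)) (𝓝 ζ) (𝓝 0) := by
    have h1 : Tendsto (fun z => 1 - u * z) (𝓝 ζ) (𝓝 (1 - u * ζ)) := by
      apply Continuous.tendsto
      fun_prop
    rw [huζ, sub_self] at h1
    exact tendsto_csqrt_zero.comp h1
  have hGd : ∀ᶠ z in 𝓝 ζ, DifferentiableAt ℂ G (csqrt (1 - u * z)) :=
    ht.eventually (hG.eventually_analyticAt.mono fun _ h => h.differentiableAt)
  filter_upwards [nhdsWithin_le_nhds hGd, self_mem_nhdsWithin] with z hz hzb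
  have hzb' : ‖u * z‖ < 1 := by simpa [hu] using hzb
  have hsp : 1 - u * z ∈ Complex.slitPlane :=
    one_sub_mem_slitPlane hzb'.le fun h => by simp [h] at hzb'
  have hne := csqrt_ne_zero (Complex.slitPlane_ne_zero hsp)
  have h1 : HasDerivAt (fun z => csqrt (1 - u * z)) (1 / (2 * csqrt (1 - u * z)) * (-u)) z := by
    have h0 : HasDerivAt (fun z => 1 - u * z) (-u) z := by
      simpa using ((hasDerivAt_id z).const_mul u).const_sub 1
    exact HasDerivAt.comp (h := fun z => 1 - u * z) z (hasDerivAt_csqrt hsp) h0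
  have h2 := (h1.fun_pow (k + 2)).mul (hz.hasDerivAt.comp z h1)
  refine h2.deriv.trans ?_
  simp only [Function.comp_apply]
  push_cast
  field_simp
  ring

/-- Three derivatives use up the six powers of `s` and leave an analytic function of `s`, which is
bounded near 0. This is why the Taylor expansion goes to order six. -/
theorem of_sqrt_pow_six {u : ℂ} {G : ℂ → ℂ} (hu : ‖u‖ = 1)
    (huζ : u * ζ = 1) (hG : AnalyticAt ℂ G 0)
    (hf : f =ᶠ[𝓝[Metric.ball 0 1] ζ] fun z => csqrt (1 - u * z) ^ 6 * G (csqrt (1 - u * z))) :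
    ThirdBddNear f ζ := by
  obtain ⟨G₁, hG₁, h1⟩ := deriv_sqrt_pow_mul (k := 4) hu huζ hG hf
  obtain ⟨G₂, hG₂, h2⟩ := deriv_sqrt_pow_mul (k := 2) hu huζ hG₁ h1
  obtain ⟨G₃, hG₃, h3⟩ := deriv_sqrt_pow_mul (k := 0) hu huζ hG₂ h2
  have ht : Tendsto (fun z => csqrt (1 - u * z)) (𝓝 ζ) (𝓝 0) := by
    have h1 : Tendsto (fun z => 1 - u * z) (𝓝 ζ) (𝓝 (1 - u * ζ)) := by
      apply Continuous.tendsto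
      fun_prop
    rw [huζ, sub_self] at h1
    exact tendsto_csqrt_zero.comp h1
  refine ⟨‖G₃ 0‖ + 1, ?_⟩
  have h4 := (hG₃.continuousAt.norm.tendsto.comp ht).eventually (gt_mem_nhds (lt_add_one _))
  filter_upwards [nhdsWithin_le_nhds h4, h3] with z hz hz3
  rw [iteratedDeriv_succ', iteratedDeriv_succ', iteratedDeriv_one, hz3]
  simpa using hz.le

end ThirdBddNear

/-! ### Square root singularities -/

/-- `f` is holomorphic on the disc of radius `ρ`; it extends analytically to the points `ζ` of the
boundary with `ζ ^ d ≠ ρ ^ d`, and at `ρ` it is an analytic function of `(ρ - z) ^ (1 / 2)`, with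
linear coefficient `c`. -/
structure SqrtSing (f : ℂ → ℂ) (ρ : ℝ) (d : ℕ) (c : ℂ) : Prop where
  differentiableOn : DifferentiableOn ℂ f (Metric.ball 0 ρ)
  regular : ∀ ζ : ℂ, ‖ζ‖ = ρ → ζ ^ d ≠ (ρ : ℂ) ^ d →
    ∃ g, AnalyticAt ℂ g ζ ∧ f =ᶠ[𝓝[Metric.ball 0 ρ] ζ] g
  singular : ∃ θ, AnalyticAt ℂ θ 0 ∧ deriv θ 0 = c ∧
    f =ᶠ[𝓝[Metric.ball 0 ρ] (ρ : ℂ)] fun z => θ (csqrt (ρ - z))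

theorem AnalyticAt.dslope_zero {f : ℂ → ℂ} (hf : AnalyticAt ℂ f 0) :
    AnalyticAt ℂ (dslope f 0) 0 := by
  obtain ⟨p, hp⟩ := hf
  exact ⟨_, hp.has_fpower_series_dslope_fslope⟩

theorem eq_add_mul_dslope (f : ℂ → ℂ) (s : ℂ) : f s = f 0 + s * dslope f 0 s := by
  have := sub_smul_dslope f 0 s
  simp only [sub_zero, smul_eq_mul] at this
  rw [this]
  ring

/-- Taylor expansion of order six. -/
theorem exists_taylor_six {θ : ℂ → ℂ} (hθ : AnalyticAt ℂ θ 0) :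
    ∃ (c₀ c₂ c₃ c₄ c₅ : ℂ) (G : ℂ → ℂ), AnalyticAt ℂ G 0 ∧ ∀ s, θ s =
      c₀ + deriv θ 0 * s + c₂ * s ^ 2 + c₃ * s ^ 3 + c₄ * s ^ 4 + c₅ * s ^ 5 + s ^ 6 * G s := by
  set D : (ℂ → ℂ) → ℂ → ℂ := fun f => dslope f 0 with hD
  refine ⟨θ 0, D (D θ) 0, D (D (D θ)) 0, D (D (D (D θ))) 0, D (D (D (D (D θ)))) 0,
    D (D (D (D (D (D θ))))),
    hθ.dslope_zero.dslope_zero.dslope_zero.dslope_zero.dslope_zero.dslope_zero, fun s => ?_⟩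
  have h : ∀ f, f s = f 0 + s * D f s := fun f => eq_add_mul_dslope f s
  have h1 : D θ 0 = deriv θ 0 := dslope_same _ _
  rw [h θ, h (D θ), h (D (D θ)), h (D (D (D θ))), h (D (D (D (D θ)))),
    h (D (D (D (D (D θ))))), h1]
  ring

/-- The odd part `(1 - z) ^ (1 / 2) * (c₁ + c₃ (1 - z) + c₅ (1 - z) ^ 2)`. -/
noncomputable def oddPart (c₁ c₃ c₅ z : ℂ) : ℂ :=
  csqrt (1 - z) * (c₁ + c₃ * (1 - z) + c₅ * (1 - z) ^ 2)

/-- The coefficients of `oddPart`. -/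
noncomputable def oddCoeff (c₁ c₃ c₅ : ℂ) (n : ℕ) : ℂ :=
  c₁ * sqrtCoeff n + c₃ * (sqrtCoeff n - if n = 0 then 0 else (sqrtCoeff (n - 1) : ℂ)) +
    c₅ * ((sqrtCoeff n - if n = 0 then 0 else (sqrtCoeff (n - 1) : ℂ)) -
      if n = 0 then 0 else (sqrtCoeff (n - 1) -
          if n - 1 = 0 then 0 else (sqrtCoeff (n - 1 - 1) : ℂ)))

theorem hasUnitSeries_oddPart (c₁ c₃ c₅ : ℂ) :
    HasUnitSeries (oddPart c₁ c₃ c₅) (oddCoeff c₁ c₃ c₅) := by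
  have h := ((hasUnitSeries_csqrt.const_mul c₁).add
      (hasUnitSeries_csqrt.one_sub_mul.const_mul c₃)).add
    (hasUnitSeries_csqrt.one_sub_mul.one_sub_mul.const_mul c₅)
  intro z hz
  have h1 := h z hz
  have h2 : oddPart c₁ c₃ c₅ z = c₁ * csqrt (1 - z) + c₃ * ((1 - z) * csqrt (1 - z)) +
      c₅ * ((1 - z) * ((1 - z) * csqrt (1 - z))) := by
    rw [oddPart]
    ring
  rw [h2]
  exact h1

theorem analyticAt_oddPart (c₁ c₃ c₅ : ℂ) {u ζ : ℂ} (h : ‖u * ζ‖ ≤ 1) (hne : u * ζ ≠ 1) :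
    AnalyticAt ℂ (fun z => oddPart c₁ c₃ c₅ (u * z)) ζ := by
  have h1 : AnalyticAt ℂ (fun z => csqrt (1 - u * z)) ζ :=
    (analyticAt_csqrt (one_sub_mem_slitPlane h hne)).comp_of_eq (by fun_prop) rfl
  unfold oddPart
  fun_prop

theorem norm_oddCoeff_sub_le (c₁ c₃ c₅ : ℂ) (n : ℕ) :
    ‖oddCoeff c₁ c₃ c₅ (n + 3) - c₁ * sqrtCoeff (n + 3)‖ ≤
      (6 * ‖c₃‖ + 54 * ‖c₅‖) * |sqrtCoeff (n + 3)| / (n + 3) := by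
  have h1 := abs_sqrtCoeff_sub_le (n + 1)
  have h2 := abs_sqrtCoeff_second_diff_le n
  have h3 : oddCoeff c₁ c₃ c₅ (n + 3) - c₁ * sqrtCoeff (n + 3) =
      c₃ * ((sqrtCoeff (n + 3) - sqrtCoeff (n + 2) : ℝ) : ℂ) +
      c₅ * (((sqrtCoeff (n + 3) - sqrtCoeff (n + 2)) -
          (sqrtCoeff (n + 2) - sqrtCoeff (n + 1)) : ℝ) : ℂ) := by
    simp only [oddCoeff, Nat.add_eq_zero_iff, OfNat.ofNat_ne_zero, and_false, if_false,
      Nat.add_one_sub_one]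
    push_cast
    ring
  rw [h3]
  refine (norm_add_le _ _).trans ?_
  rw [norm_mul, norm_mul, Complex.norm_real, Complex.norm_real, Real.norm_eq_abs, Real.norm_eq_abs]
  have h4 : 6 * |sqrtCoeff (n + 1 + 2)| / (((n + 1 : ℕ) : ℝ) + 2) =
      6 * |sqrtCoeff (n + 3)| / (n + 3) := by
    push_cast
    ring_nf
  rw [h4] at h1
  calc _ ≤ ‖c₃‖ * (6 * |sqrtCoeff (n + 3)| / (n + 3)) +
      ‖c₅‖ * (54 * |sqrtCoeff (n + 3)| / (n + 3)) := by
        gcongr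
    _ = _ := by ring

/-- Coefficient asymptotics for a square root singularity on the unit circle. -/
theorem SqrtSing.unit_coeff_asymptotics {f : ℂ → ℂ} {a : ℕ → ℂ} {d : ℕ} {c : ℂ} (hd : 0 < d)
    (h : SqrtSing f 1 d c) (ha : HasUnitSeries f a) (hper : ∀ n, a n ≠ 0 → n ≡ 1 [MOD d]) :
    ∃ C, ∀ n ≥ 3, n ≡ 1 [MOD d] → ‖a n - d * c * sqrtCoeff n‖ ≤ C * |sqrtCoeff n| / n := by
  obtain ⟨θ, hθ, hθc, hsing⟩ := h.singular
  obtain ⟨c₀, c₂, c₃, c₄, c₅, G, hG, htaylor⟩ := exists_taylor_six hθ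
  rw [hθc] at htaylor
  -- The possible singularities on the circle are the inverses of these roots of unity. As nonzero
  -- coefficients occur only for n ≡ 1 mod d, f(z) = u⁻¹ f(uz), so the singularity at u⁻¹ is a
  -- rotated copy of the one at 1.
  set W := Polynomial.nthRootsFinset d (1 : ℂ) with hW
  have hWmem : ∀ u, u ∈ W ↔ u ^ d = 1 := fun u => Polynomial.mem_nthRootsFinset hd _
  have hWcard : W.card = d := (Complex.isPrimitiveRoot_exp d hd.ne').card_nthRootsFinset
  have hWnorm : ∀ u ∈ W, ‖u‖ = 1 := fun u hu =>
    Complex.norm_eq_one_of_pow_eq_one ((hWmem u).1 hu) hd.ne'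
  have hWpow : ∀ u ∈ W, ∀ n, n ≡ 1 [MOD d] → u ^ n = u := by
    intro u hu n hn
    have h1 := (hWmem u).1 hu
    have h2 : u ^ n = u ^ 1 := by
      rw [pow_eq_pow_mod n h1, pow_eq_pow_mod 1 h1, hn]
    rwa [pow_one] at h2
  set T := oddPart c c₃ c₅ with hT
  have hTd : ∀ u : ℂ, ‖u‖ = 1 →
      DifferentiableOn ℂ (fun z => u⁻¹ * T (u * z)) (Metric.ball 0 1) := by
    intro u hu
    exact (((hasUnitSeries_oddPart c c₃ c₅).rotate hu).const_mul _).differentiableOn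
  -- Only odd powers of the square root need to be removed; the even ones are polynomials in z.
  set R : ℂ → ℂ := fun z => f z - ∑ u ∈ W, u⁻¹ * T (u * z) with hR
  have hRs : HasUnitSeries R (fun n => a n - ∑ u ∈ W, u⁻¹ * (u ^ n * oddCoeff c c₃ c₅ n)) :=
    ha.sub (HasUnitSeries.sum fun u hu =>
      ((hasUnitSeries_oddPart c c₃ c₅).rotate (hWnorm u hu)).const_mul u⁻¹)
  have hfd := ha.differentiableOn
  have hrot : ∀ u ∈ W, ∀ z ∈ Metric.ball (0 : ℂ) 1, f z = u⁻¹ * f (u * z) := by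
    intro u hu z hz
    have hu0 : u ≠ 0 := norm_ne_zero_iff.1 (by rw [hWnorm u hu]; norm_num)
    have h1 := ((ha.rotate (hWnorm u hu)).const_mul u⁻¹) z hz
    refine (ha z hz).unique ?_
    convert h1 using 2 with n
    by_cases hn : a n = 0
    · simp [hn]
    · simp only [hWpow u hu n (hper n hn)]
      field_simp
  have hTan : ∀ u ∈ W, ∀ ζ ∈ Metric.closedBall (0 : ℂ) 1, u * ζ ≠ 1 →
      ThirdBddNear (fun z => u⁻¹ * T (u * z)) ζ := by
    intro u hu ζ hζ hne
    refine ThirdBddNear.of_analyticAt (analyticAt_const.mul (analyticAt_oddPart _ _ _ ?_ hne))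
    rw [norm_mul, hWnorm u hu, one_mul]
    simpa using hζ
  have hbdd : ∀ ζ ∈ Metric.closedBall (0 : ℂ) 1, ThirdBddNear R ζ := by
    intro ζ hζ
    by_cases hint : ‖ζ‖ < 1
    · refine ThirdBddNear.of_analyticAt (hRs.differentiableOn.analyticAt ?_)
      exact Metric.isOpen_ball.mem_nhds (by simpa using hint)
    have hnorm : ‖ζ‖ = 1 := le_antisymm (by simpa using hζ) (not_lt.1 hint)
    have hζ0 : ζ ≠ 0 := norm_ne_zero_iff.1 (by rw [hnorm]; norm_num)
    by_cases hreg : ζ ^ d = 1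
    · have hζW : ζ⁻¹ ∈ W := (hWmem _).2 (by rw [inv_pow, hreg, inv_one])
      set v := ζ⁻¹ with hv
      have hvζ : v * ζ = 1 := inv_mul_cancel₀ hζ0
      have hvn := hWnorm v hζW
      have hv0 : v ≠ 0 := inv_ne_zero hζ0
      have hmain : ThirdBddNear (fun z => f z - v⁻¹ * T (v * z)) ζ := by
        have hE : AnalyticAt ℂ (fun z => v⁻¹ * (c₀ + c₂ * (1 - v * z) +
            c₄ * (1 - v * z) ^ 2)) ζ := by
          fun_prop
        -- Near ζ = v⁻¹, removing the odd terms and the even polynomial leaves exactly s^6 G(s),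
        -- with s = (1 - vz)^{1/2}.
        have hS : ThirdBddNear (fun z => (f z - v⁻¹ * T (v * z)) -
            v⁻¹ * (c₀ + c₂ * (1 - v * z) + c₄ * (1 - v * z) ^ 2)) ζ := by
          refine ThirdBddNear.of_sqrt_pow_six (G := fun s => v⁻¹ * G s) hvn hvζ (by fun_prop) ?_
          have ht : Tendsto (fun z => v * z) (𝓝[Metric.ball 0 1] ζ)
              (𝓝[Metric.ball 0 1] ((1 : ℝ) : ℂ)) := by
            refine tendsto_nhdsWithin_iff.2 ⟨?_, ?_⟩
            · have h1 : Tendsto (fun z => v * z) (𝓝 ζ) (𝓝 (v * ζ)) :=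
                (continuous_const_mul v).tendsto ζ
              rw [hvζ] at h1
              simpa using h1.mono_left nhdsWithin_le_nhds
            · filter_upwards [self_mem_nhdsWithin] with z hz
              simpa [hvn] using hz
          filter_upwards [ht.eventually hsing, self_mem_nhdsWithin] with z hz hzb
          rw [hrot v hζW z hzb, hz, htaylor, hT, oddPart]
          set s := csqrt (1 - v * z) with hs
          have hs2 : 1 - v * z = s ^ 2 := (csqrt_sq _).symm
          rw [Complex.ofReal_one, ← hs, hs2]
          ring
        have hEd : DifferentiableOn ℂ (fun z => v⁻¹ * (c₀ + c₂ * (1 - v * z) +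
            c₄ * (1 - v * z) ^ 2))
            (Metric.ball 0 1) := by fun_prop
        have := hS.add (ThirdBddNear.of_analyticAt hE) ((hfd.sub (hTd v hvn)).sub hEd) hEd
        simpa using this
      have hrest : ThirdBddNear (fun z => ∑ u ∈ W.erase v, u⁻¹ * T (u * z)) ζ := by
        refine ThirdBddNear.sum (fun u hu => ?_) (fun u hu =>
          hTd u (hWnorm u (Finset.mem_of_mem_erase hu)))
        refine hTan u (Finset.mem_of_mem_erase hu) ζ hζ fun h1 => ?_
        exact Finset.ne_of_mem_erase hu (mul_right_cancel₀ hζ0 (h1.trans hvζ.symm))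
      have := hmain.sub hrest (hfd.sub (hTd v hvn)) (DifferentiableOn.fun_sum fun u hu =>
          hTd u (hWnorm u (Finset.mem_of_mem_erase hu)))
      refine this.congr (Filter.Eventually.of_forall fun z => ?_)
      simp only [hR]
      rw [← Finset.add_sum_erase W _ hζW]
      ring
    · have hreg' : ζ ^ d ≠ ((1 : ℝ) : ℂ) ^ d := by simpa using hreg
      obtain ⟨g, hg, hfg⟩ := h.regular ζ hnorm hreg'
      refine ((ThirdBddNear.of_analyticAt hg).congr hfg).sub (ThirdBddNear.sum (fun u hu => ?_)
        (fun u hu => hTd u (hWnorm u hu))) hfd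
            (DifferentiableOn.fun_sum fun u hu => hTd u (hWnorm u hu))
      refine hTan u hu ζ hζ fun h1 => hreg ?_
      have h2 : u ^ d * ζ ^ d = 1 := by rw [← mul_pow, h1, one_pow]
      rwa [(hWmem u).1 hu, one_mul] at h2
  obtain ⟨M, hM⟩ := ThirdBddNear.exists_bound hbdd
  have hM0 : 0 ≤ M := (norm_nonneg _).trans (hM 0 (by simp))
  -- The 9 is 9/2, from (k+3)^3 ≤ (9/2)(k+1)(k+2)(k+3), times 2, from the lower bound 1/2 in
  -- `sqrtCoeff_lower`; the rest comes from the higher odd powers.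
  refine ⟨9 * M + d * (6 * ‖c₃‖ + 54 * ‖c₅‖), fun n hn hmod => ?_⟩
  obtain ⟨k, rfl⟩ := Nat.exists_eq_add_of_le' hn
  have h1 := hRs.norm_coeff_mul_le hM k
  -- For n ≡ 1 mod d one has u^n = u, so the d rotated singularities add up without cancellation.
  have h2 : ∑ u ∈ W, u⁻¹ * (u ^ (k + 3) * oddCoeff c c₃ c₅ (k + 3)) =
      d * oddCoeff c c₃ c₅ (k + 3) := by
    rw [Finset.sum_congr rfl (g := fun _ => oddCoeff c c₃ c₅ (k + 3)), Finset.sum_const, hWcard,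
      nsmul_eq_mul]
    intro u hu
    have hu0 : u ≠ 0 := norm_ne_zero_iff.1 (by rw [hWnorm u hu]; norm_num)
    rw [hWpow u hu _ hmod, inv_mul_cancel_left₀ hu0]
  simp only [h2] at h1
  have h3 := norm_oddCoeff_sub_le c c₃ c₅ k
  have h4 := sqrtCoeff_lower (k + 2)
  have hk : (0 : ℝ) ≤ k := k.cast_nonneg
  have h5 : ‖a (k + 3) - d * oddCoeff c c₃ c₅ (k + 3)‖ ≤ 9 * M * |sqrtCoeff (k + 3)| / (k + 3) := by
    set X := ‖a (k + 3) - d * oddCoeff c c₃ c₅ (k + 3)‖ with hX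
    have hX0 : 0 ≤ X := norm_nonneg _
    rw [le_div_iff₀ (by positivity)]
    push_cast at h4
    have h6 : 1 / 2 ≤ |sqrtCoeff (k + 3)| * ((k : ℝ) + 3) ^ 2 := by
      convert h4 using 3
      ring
    have h7 : ((k : ℝ) + 3) ^ 3 * X ≤ 9 / 2 * M := by
      have : ((k : ℝ) + 3) ^ 3 ≤ 9 / 2 * ((k + 1) * (k + 2) * (k + 3)) := by
        nlinarith [mul_nonneg hk hk, mul_nonneg hk (mul_nonneg hk hk)]
      nlinarith [mul_le_mul_of_nonneg_right this hX0]
    have h8 : 9 / 2 * M ≤ 9 * M * (|sqrtCoeff (k + 3)| * ((k : ℝ) + 3) ^ 2) := by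
      nlinarith [mul_le_mul_of_nonneg_left h6 hM0]
    have h9 : (X * (k + 3)) * ((k : ℝ) + 3) ^ 2 ≤
        9 * M * |sqrtCoeff (k + 3)| * ((k : ℝ) + 3) ^ 2 := by
      nlinarith
    exact le_of_mul_le_mul_right h9 (by positivity)
  have h10 : a (k + 3) - d * c * sqrtCoeff (k + 3) = (a (k + 3) - d * oddCoeff c c₃ c₅ (k + 3)) +
      d * (oddCoeff c c₃ c₅ (k + 3) - c * sqrtCoeff (k + 3)) := by ring
  rw [h10]
  refine (norm_add_le _ _).trans ?_
  rw [norm_mul, Complex.norm_natCast]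
  push_cast
  calc _ ≤ 9 * M * |sqrtCoeff (k + 3)| / (k + 3) +
        d * ((6 * ‖c₃‖ + 54 * ‖c₅‖) * |sqrtCoeff (k + 3)| / (k + 3)) := by gcongr
    _ = _ := by ring

/-! ### Operations on functions with a square root singularity -/

namespace SqrtSing

variable {f f' : ℂ → ℂ} {ρ : ℝ} {d : ℕ} {c c' : ℂ}

theorem tendsto_csqrt_sub (ρ : ℝ) :
    Tendsto (fun z => csqrt (ρ - z)) (𝓝 (ρ : ℂ)) (𝓝 0) := by
  have h1 : Tendsto (fun z : ℂ => (ρ : ℂ) - z) (𝓝 (ρ : ℂ)) (𝓝 ((ρ : ℂ) - ρ)) :=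
    (continuous_const.sub continuous_id).tendsto _
  rw [sub_self] at h1
  exact tendsto_csqrt_zero.comp h1

theorem congr (h : SqrtSing f ρ d c) (he : Set.EqOn f' f (Metric.ball 0 ρ)) :
    SqrtSing f' ρ d c := by
  have hev : ∀ ζ, f' =ᶠ[𝓝[Metric.ball 0 ρ] ζ] f := fun ζ => by
    filter_upwards [self_mem_nhdsWithin] with z hz using he hz
  refine ⟨h.differentiableOn.congr he, fun ζ h1 h2 => ?_, ?_⟩
  · obtain ⟨g, hg, hfg⟩ := h.regular ζ h1 h2
    exact ⟨g, hg, (hev ζ).trans hfg⟩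
  · obtain ⟨θ, hθ, hc, hfθ⟩ := h.singular
    exact ⟨θ, hθ, hc, (hev _).trans hfθ⟩

/-- With z = ρ - s², a function analytic at ρ is even in `s` and has no linear term. -/
theorem of_differentiableOn {u : ℂ → ℂ} {R : ℝ} (hρ : 0 < ρ) (hR : ρ < R)
    (hu : DifferentiableOn ℂ u (Metric.ball 0 R)) : SqrtSing u ρ d 0 := by
  have han : ∀ ζ : ℂ, ‖ζ‖ = ρ → AnalyticAt ℂ u ζ := fun ζ hζ =>
    hu.analyticAt (Metric.isOpen_ball.mem_nhds (by simpa [hζ] using hR))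
  refine ⟨hu.mono (Metric.ball_subset_ball hR.le), fun ζ h1 _ =>
    ⟨u, han ζ h1, Filter.EventuallyEq.rfl⟩, ⟨fun s => u (ρ - s ^ 2), ?_, ?_, ?_⟩⟩
  · refine (han ρ (by simp [abs_of_pos hρ])).comp_of_eq (by fun_prop) (by simp)
  · have h1 : HasDerivAt u (deriv u ρ) ((fun s : ℂ => (ρ : ℂ) - s ^ 2) 0) := by
      simpa using (han ρ (by simp [abs_of_pos hρ])).differentiableAt.hasDerivAt
    have h2 : HasDerivAt (fun s : ℂ => (ρ : ℂ) - s ^ 2) 0 0 := by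
      simpa using ((hasDerivAt_id (0 : ℂ)).fun_pow 2).const_sub (ρ : ℂ)
    exact (h1.comp 0 h2).deriv.trans (mul_zero _)
  · refine Filter.Eventually.of_forall fun z => ?_
    simp [csqrt_sq]

theorem add (h : SqrtSing f ρ d c) (h' : SqrtSing f' ρ d c') :
    SqrtSing (fun z => f z + f' z) ρ d (c + c') := by
  refine ⟨h.differentiableOn.add h'.differentiableOn, fun ζ h1 h2 => ?_, ?_⟩
  · obtain ⟨g, hg, hfg⟩ := h.regular ζ h1 h2
    obtain ⟨g', hg', hfg'⟩ := h'.regular ζ h1 h2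
    exact ⟨fun z => g z + g' z, hg.fun_add hg', hfg.add hfg'⟩
  · obtain ⟨θ, hθ, hc, hfθ⟩ := h.singular
    obtain ⟨θ', hθ', hc', hfθ'⟩ := h'.singular
    refine ⟨fun z => θ z + θ' z, hθ.fun_add hθ', ?_, hfθ.add hfθ'⟩
    rw [deriv_fun_add hθ.differentiableAt hθ'.differentiableAt, hc, hc']

/-- A regular factor is u(ρ - s²), even in `s`, so only its value at ρ affects the linear
coefficient. -/
theorem mul_left {u : ℂ → ℂ} {R : ℝ} (h : SqrtSing f ρ d c) (hρ : 0 < ρ) (hR : ρ < R)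
    (hu : DifferentiableOn ℂ u (Metric.ball 0 R)) :
    SqrtSing (fun z => u z * f z) ρ d (u ρ * c) := by
  have han : ∀ ζ : ℂ, ‖ζ‖ = ρ → AnalyticAt ℂ u ζ := fun ζ hζ =>
    hu.analyticAt (Metric.isOpen_ball.mem_nhds (by simpa [hζ] using hR))
  have hu' := of_differentiableOn (d := d) hρ hR hu
  refine ⟨(hu.mono (Metric.ball_subset_ball hR.le)).mul h.differentiableOn, fun ζ h1 h2 => ?_, ?_⟩
  · obtain ⟨g, hg, hfg⟩ := h.regular ζ h1 h2
    exact ⟨fun z => u z * g z, (han ζ h1).fun_mul hg, Filter.EventuallyEq.rfl.mul hfg⟩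
  · obtain ⟨θ, hθ, hc, hfθ⟩ := h.singular
    have h0 := han ρ (by simp [abs_of_pos hρ])
    have h1 : HasDerivAt u (deriv u ρ) ((fun s : ℂ => (ρ : ℂ) - s ^ 2) 0) := by
      simpa using h0.differentiableAt.hasDerivAt
    have h2 : HasDerivAt (fun s : ℂ => (ρ : ℂ) - s ^ 2) 0 0 := by
      simpa using ((hasDerivAt_id (0 : ℂ)).fun_pow 2).const_sub (ρ : ℂ)
    have h3 := (h1.comp 0 h2).mul hθ.differentiableAt.hasDerivAt
    refine ⟨fun s => u (ρ - s ^ 2) * θ s, ?_, ?_, ?_⟩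
    · have : AnalyticAt ℂ (fun s : ℂ => u (ρ - s ^ 2)) 0 :=
        h0.comp_of_eq (by fun_prop) (by simp)
      exact this.fun_mul hθ
    · refine h3.deriv.trans ?_
      simp [hc]
    · filter_upwards [hfθ] with z hz
      rw [hz, csqrt_sq]
      simp

theorem sum {ι : Type*} {s : Finset ι} {f : ι → ℂ → ℂ} {c : ι → ℂ} (hρ : 0 < ρ)
    (h : ∀ i ∈ s, SqrtSing (f i) ρ d (c i)) :
    SqrtSing (fun z => ∑ i ∈ s, f i z) ρ d (∑ i ∈ s, c i) := by
  classical
  induction s using Finset.induction_on with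
  | empty =>
    simp only [Finset.sum_empty]
    exact of_differentiableOn (R := ρ + 1) hρ (by linarith) (differentiableOn_const (0 : ℂ))
  | insert a s ha ih =>
    simp_rw [Finset.sum_insert ha]
    exact (h a (by simp)).add (ih fun i hi => h i (by simp [hi]))

/-- Rescaling to the unit disc. -/
theorem scale (h : SqrtSing f ρ d c) (hρ : 0 < ρ) :
    SqrtSing (fun z => f (ρ * z)) 1 d (√ρ * c) := by
  have hmaps : Set.MapsTo (fun z : ℂ => (ρ : ℂ) * z) (Metric.ball 0 1) (Metric.ball 0 ρ) := by
    intro z hz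
    simp only [mem_ball_zero_iff, norm_mul, Complex.norm_real, Real.norm_eq_abs, abs_of_pos hρ] at *
    nlinarith
  have ht : ∀ ζ : ℂ, Tendsto (fun z : ℂ => (ρ : ℂ) * z) (𝓝[Metric.ball 0 1] ζ)
      (𝓝[Metric.ball 0 ρ] (ρ * ζ)) := fun ζ =>
    (ContinuousWithinAt.tendsto_nhdsWithin (by fun_prop) hmaps)
  refine ⟨h.differentiableOn.comp (by fun_prop) hmaps, fun ζ h1 h2 => ?_, ?_⟩
  · obtain ⟨g, hg, hfg⟩ := h.regular (ρ * ζ) (by simp [h1, abs_of_pos hρ]) (by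
      rw [mul_pow]
      intro h3
      have hne : (ρ : ℂ) ^ d ≠ 0 := pow_ne_zero _ (by exact_mod_cast hρ.ne')
      apply h2
      rw [Complex.ofReal_one, one_pow]
      exact mul_left_cancel₀ hne (by rw [h3, mul_one]))
    exact ⟨fun z => g (ρ * z), hg.comp_of_eq (by fun_prop) rfl, (ht ζ).eventually hfg⟩
  · obtain ⟨θ, hθ, hc, hfθ⟩ := h.singular
    refine ⟨fun s => θ (√ρ * s), hθ.comp_of_eq (by fun_prop) (by simp), ?_, ?_⟩
    · have h1 : HasDerivAt θ c ((fun s : ℂ => (√ρ : ℂ) * s) 0) := by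
        simpa [hc] using hθ.differentiableAt.hasDerivAt
      have h2 : HasDerivAt (fun s : ℂ => (√ρ : ℂ) * s) (√ρ : ℂ) 0 := by
        simpa using (hasDerivAt_id (0 : ℂ)).const_mul (√ρ : ℂ)
      refine (h1.comp 0 h2).deriv.trans (mul_comm _ _)
    · have h3 := ht ((1 : ℝ) : ℂ)
      rw [Complex.ofReal_one, mul_one] at h3
      rw [Complex.ofReal_one]
      filter_upwards [h3.eventually hfθ, self_mem_nhdsWithin] with z hz hzb
      rw [hz]
      have h4 : ‖z‖ < 1 := by simpa using hzb
      rw [← csqrt_ofReal_mul hρ (one_sub_mem_slitPlane h4.le fun h => by simp [h] at h4)]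
      congr 2
      ring

/-- Coefficient asymptotics for a square root singularity. -/
theorem coeff_asymptotics {a : ℕ → ℂ} (hρ : 0 < ρ) (hd : 0 < d) (h : SqrtSing f ρ d c)
    (ha : ∀ z ∈ Metric.ball (0 : ℂ) ρ, HasSum (fun n => a n * z ^ n) (f z))
    (hper : ∀ n, a n ≠ 0 → n ≡ 1 [MOD d]) :
    ∃ C, ∀ n ≥ 3, n ≡ 1 [MOD d] →
      ‖a n * ρ ^ n - d * (√ρ * c) * sqrtCoeff n‖ ≤ C * |sqrtCoeff n| / n := by
  refine (h.scale hρ).unit_coeff_asymptotics (a := fun n => a n * ρ ^ n) hd ?_ ?_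
  · intro z hz
    have h1 : (ρ : ℂ) * z ∈ Metric.ball (0 : ℂ) ρ := by
      simp only [mem_ball_zero_iff, norm_mul, Complex.norm_real, Real.norm_eq_abs,
        abs_of_pos hρ] at *
      nlinarith
    have h2 := ha _ h1
    simpa only [mul_pow, mul_assoc] using h2
  · intro n hn
    exact hper n (left_ne_zero_of_mul hn)

end SqrtSing

/-! ### Implicit functions -/

/-- The analytic implicit function theorem for one equation in two complex variables. -/
theorem exists_analyticAt_implicit {P : ℂ × ℂ → ℂ} {a b p₂ : ℂ} (hP : AnalyticAt ℂ P (a, b))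
    (h0 : P (a, b) = 0) (h2 : HasDerivAt (fun h => P (a, h)) p₂ b) (hp₂ : p₂ ≠ 0) :
    ∃ θ : ℂ → ℂ, AnalyticAt ℂ θ a ∧ θ a = b ∧ (∀ᶠ v in 𝓝 (a, b), P v = 0 → v.2 = θ v.1) ∧
      ∀ p₁, HasDerivAt (fun z => P (z, b)) p₁ a → deriv θ a = -p₁ / p₂ := by
  have hc : ContDiffAt ℂ ⊤ P (a, b) := hP.contDiffAt
  have hF := hP.differentiableAt.hasFDerivAt
  set L := fderiv ℂ P (a, b) with hL
  have hL2 : L (0, 1) = p₂ := by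
    have h3 : HasDerivAt (fun h : ℂ => (a, h)) ((0 : ℂ), (1 : ℂ)) b :=
      (hasDerivAt_const b a).prodMk (hasDerivAt_id b)
    exact (hF.comp_hasDerivAt b h3).unique h2
  have hinv : (L ∘L ContinuousLinearMap.inr ℂ ℂ ℂ).IsInvertible := by
    refine ⟨ContinuousLinearEquiv.unitsEquivAut ℂ (Units.mk0 p₂ hp₂), ?_⟩
    ext
    simp [hL2]
  have hn : (⊤ : WithTop ℕ∞) ≠ 0 := by simp
  refine ⟨hc.implicitFunction hn hinv, ?_, ?_, ?_, ?_⟩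
  · exact (hc.contDiffAt_implicitFunction hn hinv).analyticAt
  · exact hc.implicitFunction_apply_self hn hinv
  · filter_upwards [hc.eventually_apply_eq_iff_implicitFunction hn hinv] with v hv hPv
    exact (hv.1 (by rw [hPv, h0])).symm
  · intro p₁ hp₁
    set θ := hc.implicitFunction hn hinv with hθ
    have hθa : θ a = b := hc.implicitFunction_apply_self hn hinv
    have hθd : HasDerivAt θ (deriv θ a) a :=
      (hc.contDiffAt_implicitFunction hn hinv).analyticAt.differentiableAt.hasDerivAt
    have hL1 : L (1, 0) = p₁ := by
      have h3 : HasDerivAt (fun z : ℂ => (z, b)) ((1 : ℂ), (0 : ℂ)) a :=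
        (hasDerivAt_id a).prodMk (hasDerivAt_const a b)
      exact (hF.comp_hasDerivAt a h3).unique hp₁
    have h4 : HasDerivAt (fun z => (z, θ z)) ((1 : ℂ), deriv θ a) a := (hasDerivAt_id a).prodMk hθd
    have hF' : HasFDerivAt P L (a, θ a) := by rwa [hθa]
    have h5 := hF'.comp_hasDerivAt a h4
    have h6 : (fun z => P (z, θ z)) =ᶠ[𝓝 a] fun _ => 0 := by
      filter_upwards [hc.eventually_apply_implicitFunction hn hinv] with z hz
      rw [hz, h0]
    have h7 := h5.unique ((hasDerivAt_const a (0 : ℂ)).congr_of_eventuallyEq h6)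
    have h8 : ((1 : ℂ), deriv θ a) = (1, 0) + deriv θ a • ((0 : ℂ), (1 : ℂ)) := by simp
    rw [h8, map_add, map_smul, hL1, hL2, smul_eq_mul] at h7
    field_simp
    linear_combination h7

/-- Equality in the triangle inequality for series. -/
theorem eq_of_hasSum_of_norm_le {a : ℕ → ℝ} {v : ℕ → ℂ} {A : ℝ} (hv : ∀ n, ‖v n‖ ≤ a n)
    (ha : HasSum a A) (hvs : HasSum v (A : ℂ)) (n : ℕ) : v n = a n := by
  have hre : HasSum (fun n => a n - (v n).re) 0 := by
    have := ha.sub (Complex.hasSum_re hvs)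
    simpa using this
  have hnn : ∀ n, 0 ≤ a n - (v n).re := fun n =>
    sub_nonneg.2 ((Complex.re_le_norm _).trans (hv n))
  have h1 : (v n).re = a n := by
    have := (hasSum_zero_iff_of_nonneg hnn).1 hre
    have := congrFun this n
    simp only [Pi.zero_apply] at this
    linarith
  have h2 := hv n
  have h3 : (v n).im = 0 := by
    have h4 := Complex.sq_norm (v n)
    rw [Complex.normSq_apply] at h4
    have h5 : 0 ≤ ‖v n‖ := norm_nonneg _
    have h6 : ‖v n‖ ^ 2 ≤ a n ^ 2 := by gcongr
    rw [← h1] at h6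
    nlinarith
  exact Complex.ext h1 (by simpa using h3)

/-! ### Power series with real coefficients in the complex domain -/

/-- The sum of a power series with real coefficients at a complex point. -/
noncomputable def cSeries (a : ℕ → ℝ) (z : ℂ) : ℂ := ∑' n, (a n : ℂ) * z ^ n

theorem enorm_ofReal_coeff (a : ℕ → ℝ) : (fun n => ‖(a n : ℂ)‖ₑ) = fun n => ‖a n‖ₑ := by
  funext n
  rw [← ofReal_norm, ← ofReal_norm, Complex.norm_real]

theorem hasDerivAt_cSeries {a : ℕ → ℝ} {z : ℂ} {y : ℝ≥0∞} (hz : ‖z‖ₑ < y)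
    (h : eSeries (fun n => ‖a n‖ₑ) y ≠ ∞) :
    HasDerivAt (cSeries a) (cSeries (derivCoeff a) z) z := by
  rw [← enorm_ofReal_coeff] at h
  have := hasDerivAt_powerSeries hz h
  refine this.congr_deriv ?_
  rw [cSeries]
  congr 1
  funext n
  simp [derivCoeff]

theorem summable_cSeries {a : ℕ → ℝ} {z : ℂ} {y : ℝ≥0∞} (hz : ‖z‖ₑ ≤ y)
    (h : eSeries (fun n => ‖a n‖ₑ) y ≠ ∞) : Summable fun n => (a n : ℂ) * z ^ n := by
  rw [← enorm_ofReal_coeff] at h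
  exact (summable_of_eSeries_ne_top hz h).of_norm

theorem eSeries_derivCoeff_enorm_ne_top {a : ℕ → ℝ} {x y : ℝ≥0∞} (hxy : x < y)
    (h : eSeries (fun n => ‖a n‖ₑ) y ≠ ∞) : eSeries (fun n => ‖derivCoeff a n‖ₑ) x ≠ ∞ := by
  rw [enorm_derivCoeff]
  exact eSeries_derivCoeff_ne_top hxy h

theorem enorm_lt_ofReal {z : ℂ} {r : ℝ} (h : ‖z‖ < r) : ‖z‖ₑ < ENNReal.ofReal r := by
  rw [← ofReal_norm]
  exact (ENNReal.ofReal_lt_ofReal_iff ((norm_nonneg _).trans_lt h)).2 h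

theorem differentiableOn_cSeries {a : ℕ → ℝ} {r : ℝ}
    (h : ∀ y < ENNReal.ofReal r, eSeries (fun n => ‖a n‖ₑ) y ≠ ∞) :
    DifferentiableOn ℂ (cSeries a) (Metric.ball 0 r) := by
  intro z hz
  obtain ⟨y, hzy, hy⟩ := exists_between (enorm_lt_ofReal (mem_ball_zero_iff.1 hz))
  exact (hasDerivAt_cSeries hzy (h y hy)).differentiableAt.differentiableWithinAt

/-- The sign of the square root is determined by the position of its argument. -/
theorem eq_csqrt_of_re_nonneg {y x q : ℂ} (hy : 0 < y.re) (hx : 0 ≤ x.re)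
    (hq : |q.im| < q.re) (h : (x * q) ^ 2 = y) : x * q = csqrt y := by
  have hsp : y ∈ Complex.slitPlane := Or.inl hy
  set s := csqrt y with hs
  have hs2 : s ^ 2 = y := csqrt_sq y
  have hsre : 0 < s.re := re_csqrt_pos hsp
  have h0 : (x * q - s) * (x * q + s) = 0 := by linear_combination h - hs2
  rcases mul_eq_zero.1 h0 with h1 | h1
  · exact sub_eq_zero.1 h1
  exfalso
  have hre : (s ^ 2).re = s.re ^ 2 - s.im ^ 2 := by
    rw [pow_two, Complex.mul_re]
    ring
  rw [hs2] at hre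
  have him : |s.im| < s.re := by
    refine abs_lt_of_sq_lt_sq ?_ hsre.le
    linarith
  have e1 := congrArg Complex.re h1
  have e2 := congrArg Complex.im h1
  simp only [Complex.add_re, Complex.mul_re, Complex.zero_re, Complex.add_im, Complex.mul_im,
    Complex.zero_im] at e1 e2
  -- If x q = -s, multiplying by the conjugate of q and taking real parts equates a nonnegative
  -- number with a negative one: both q and s lie in the open sector of half-angle π/4.
  have e3 : x.re * (q.re ^ 2 + q.im ^ 2) = -(s.re * q.re + s.im * q.im) := by
    linear_combination q.re * e1 + q.im * e2
  have e4 : 0 < s.re * q.re + s.im * q.im := by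
    have h5 : |s.im * q.im| < s.re * q.re := by
      rw [abs_mul]
      exact mul_lt_mul'' him hq (abs_nonneg _) (abs_nonneg _)
    have := neg_abs_le (s.im * q.im)
    linarith
  have e5 : 0 ≤ x.re * (q.re ^ 2 + q.im ^ 2) := by positivity
  linarith

/-! ### Singularities of solutions of `H = g + z Φ(H)` -/

/-- The data of a functional equation `H(z) = g(z) + z Φ(H(z))` where `Φ` and `H` are the sums of
power series with nonnegative coefficients `w` and `h`, and `ρ Φ'(H(ρ)) = 1`. -/
structure TreeEquation (w h : ℕ → ℝ) (g : ℂ → ℂ) (ρ s₀ r R : ℝ) (d : ℕ) : Prop where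
  w_nonneg : ∀ n, 0 ≤ w n
  h_nonneg : ∀ n, 0 ≤ h n
  rho_pos : 0 < ρ
  s_pos : 0 < s₀
  s_lt : s₀ < r
  conv : eSeries (fun n => ‖w n‖ₑ) (ENNReal.ofReal r) ≠ ∞
  hasSum_h : HasSum (fun n => h n * ρ ^ n) s₀
  h_one_pos : 0 < h 1
  rho_lt : ρ < R
  g_diff : DifferentiableOn ℂ g (Metric.ball 0 R)
  g_deriv : ∃ b : ℝ, 0 ≤ b ∧ deriv g ρ = b
  eqn : ∀ z ∈ Metric.ball (0 : ℂ) ρ, cSeries h z = g z + z * cSeries w (cSeries h z)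
  char : HasSum (fun n => ρ * (derivCoeff w n * s₀ ^ n)) 1
  w_zero : 0 < w 0
  two_le : ∃ k, 2 ≤ k ∧ 0 < w k
  period : ∀ ζ : ℂ, (∀ k, w k ≠ 0 → ζ ^ k = 1) → ζ ^ d = 1

namespace TreeEquation

variable {w h : ℕ → ℝ} {g : ℂ → ℂ} {ρ s₀ r R : ℝ} {d : ℕ} (E : TreeEquation w h g ρ s₀ r R d)

include E

theorem norm_term_le {z : ℂ} (hz : ‖z‖ ≤ ρ) (n : ℕ) : ‖(h n : ℂ) * z ^ n‖ ≤ h n * ρ ^ n := by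
  rw [norm_mul, norm_pow, Complex.norm_real, Real.norm_of_nonneg (E.h_nonneg n)]
  exact mul_le_mul_of_nonneg_left (pow_le_pow_left₀ (norm_nonneg z) hz n) (E.h_nonneg n)

theorem summable_h {z : ℂ} (hz : ‖z‖ ≤ ρ) : Summable fun n => (h n : ℂ) * z ^ n :=
  Summable.of_norm_bounded E.hasSum_h.summable (E.norm_term_le hz)

theorem norm_H_le {z : ℂ} (hz : ‖z‖ ≤ ρ) : ‖cSeries h z‖ ≤ s₀ :=
  tsum_of_norm_bounded E.hasSum_h (E.norm_term_le hz)

theorem H_rho : cSeries h ρ = s₀ := by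
  have := (Complex.hasSum_ofReal.2 E.hasSum_h).tsum_eq
  rw [← this, cSeries]
  push_cast
  rfl

theorem continuousOn_H : ContinuousOn (cSeries h) (Metric.closedBall 0 ρ) :=
  continuousOn_tsum (fun n => by fun_prop) E.hasSum_h.summable
    fun n z hz => E.norm_term_le (by simpa using hz) n

theorem hasDerivAt_phi {v : ℂ} (hv : ‖v‖ < r) :
    HasDerivAt (cSeries w) (cSeries (derivCoeff w) v) v :=
  hasDerivAt_cSeries (enorm_lt_ofReal hv) E.conv

theorem analyticAt_phi {v : ℂ} (hv : ‖v‖ < r) : AnalyticAt ℂ (cSeries w) v := by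
  have : DifferentiableOn ℂ (cSeries w) (Metric.ball 0 r) := fun v hv =>
    (E.hasDerivAt_phi (by simpa using hv)).differentiableAt.differentiableWithinAt
  exact this.analyticAt (Metric.isOpen_ball.mem_nhds (by simpa using hv))

theorem norm_H_lt {z : ℂ} (hz : ‖z‖ ≤ ρ) : ‖cSeries h z‖ < r := (E.norm_H_le hz).trans_lt E.s_lt

theorem analyticAt_g {z : ℂ} (hz : ‖z‖ ≤ ρ) : AnalyticAt ℂ g z :=
  E.g_diff.analyticAt (Metric.isOpen_ball.mem_nhds (by simpa using hz.trans_lt E.rho_lt))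

theorem eqn_closed {z : ℂ} (hz : ‖z‖ ≤ ρ) : cSeries h z = g z + z * cSeries w (cSeries h z) := by
  have hcl : closure (Metric.ball (0 : ℂ) ρ) = Metric.closedBall 0 ρ := closure_ball _ E.rho_pos.ne'
  have h1 : ContinuousOn (fun z => g z + z * cSeries w (cSeries h z)) (Metric.closedBall 0 ρ) := by
    intro v hv
    have hv' : ‖v‖ ≤ ρ := by simpa using hv
    refine ContinuousWithinAt.add (E.analyticAt_g hv').continuousAt.continuousWithinAt ?_
    refine continuousWithinAt_id.mul ?_
    exact (E.analyticAt_phi (E.norm_H_lt hv')).continuousAt.comp_continuousWithinAt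
      (E.continuousOn_H v hv)
  have h2 : Set.EqOn (cSeries h) (fun z => g z + z * cSeries w (cSeries h z))
      (Metric.closedBall 0 ρ) := by
    refine Set.EqOn.of_subset_closure (s := Metric.ball 0 ρ) (fun v hv => E.eqn v hv)
      E.continuousOn_H h1 Metric.ball_subset_closedBall hcl.ge
  exact h2 (by simpa using hz)

/-- On the circle of convergence, the characteristic equation holds only at rotations of `ρ`. -/
theorem pow_eq_of_char {ζ : ℂ} (hζ : ‖ζ‖ = ρ)
    (hc : ζ * cSeries (derivCoeff w) (cSeries h ζ) = 1) : ζ ^ d = (ρ : ℂ) ^ d := by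
  have hρ0 : (ρ : ℂ) ≠ 0 := by exact_mod_cast E.rho_pos.ne'
  have hs0 : (s₀ : ℂ) ≠ 0 := by exact_mod_cast E.s_pos.ne'
  have hζ0 : ζ ≠ 0 := norm_ne_zero_iff.1 (by rw [hζ]; exact E.rho_pos.ne')
  set η := cSeries h ζ with hη
  have hηle : ‖η‖ ≤ s₀ := E.norm_H_le hζ.le
  have hdn := derivCoeff_nonneg E.w_nonneg
  have hbound : ∀ n, ‖ζ * ((derivCoeff w n : ℝ) * η ^ n)‖ ≤ ρ * (derivCoeff w n * s₀ ^ n) := by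
    intro n
    rw [norm_mul, norm_mul, norm_pow, hζ, Complex.norm_real, Real.norm_of_nonneg (hdn n)]
    exact mul_le_mul_of_nonneg_left (mul_le_mul_of_nonneg_left
      (pow_le_pow_left₀ (norm_nonneg _) hηle n) (hdn n)) E.rho_pos.le
  have hsum : HasSum (fun n => ζ * ((derivCoeff w n : ℝ) * η ^ n)) ((1 : ℝ) : ℂ) := by
    have h1 := (Summable.of_norm_bounded E.char.summable hbound).hasSum
    rw [tsum_mul_left] at h1
    have h2 : ζ * ∑' n, ((derivCoeff w n : ℝ) : ℂ) * η ^ n = ((1 : ℝ) : ℂ) := by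
      rw [Complex.ofReal_one, ← hc, cSeries]
    rwa [h2] at h1
  -- The series for ζ Φ'(H(ζ)) is dominated termwise by one with the same sum 1, so all terms agree.
  have hterm := eq_of_hasSum_of_norm_le hbound E.char hsum
  have hk : ∀ k, w (k + 1) ≠ 0 → ζ * η ^ k = ρ * s₀ ^ k := by
    intro k hk
    have h1 := hterm k
    have h2 : ((derivCoeff w k : ℝ) : ℂ) ≠ 0 := by
      have : derivCoeff w k ≠ 0 := mul_ne_zero (by positivity) hk
      exact_mod_cast this
    push_cast at h1
    refine mul_left_cancel₀ h2 ?_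
    linear_combination h1
  have hηnorm : ‖η‖ = s₀ := by
    obtain ⟨k, hk2, hkpos⟩ := E.two_le
    obtain ⟨j, rfl⟩ := Nat.exists_eq_add_of_le' hk2
    have h1 := congrArg norm (hk (j + 1) hkpos.ne')
    rw [norm_mul, norm_mul, norm_pow, norm_pow, hζ, Complex.norm_real, Complex.norm_real,
      Real.norm_of_nonneg E.rho_pos.le, Real.norm_of_nonneg E.s_pos.le] at h1
    have h2 := mul_left_cancel₀ E.rho_pos.ne' h1
    exact (pow_left_inj₀ (norm_nonneg _) E.s_pos.le (Nat.succ_ne_zero j)).1 h2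
  have hη0 : η ≠ 0 := norm_ne_zero_iff.1 (by rw [hηnorm]; exact E.s_pos.ne')
  -- Since |H(ζ)| = s₀, the triangle inequality is also an equality for H itself; its nonzero linear
  -- coefficient ties the argument of η to that of ζ.
  have h1 : ζ * s₀ = ρ * η := by
    have hb2 : ∀ n, ‖(s₀ / η) * ((h n : ℂ) * ζ ^ n)‖ ≤ h n * ρ ^ n := by
      intro n
      rw [norm_mul, norm_div, Complex.norm_real, Real.norm_of_nonneg E.s_pos.le, hηnorm,
        div_self E.s_pos.ne', one_mul]
      exact E.norm_term_le hζ.le n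
    have hs2 : HasSum (fun n => (s₀ / η) * ((h n : ℂ) * ζ ^ n)) (s₀ : ℂ) := by
      have := (E.summable_h hζ.le).hasSum.mul_left ((s₀ : ℂ) / η)
      have h3 : (s₀ : ℂ) / η * ∑' n, (h n : ℂ) * ζ ^ n = s₀ := by
        rw [show ∑' n, (h n : ℂ) * ζ ^ n = η from rfl]
        field_simp
      rwa [h3] at this
    have h4 := eq_of_hasSum_of_norm_le hb2 E.hasSum_h hs2 1
    have h5 : (h 1 : ℂ) ≠ 0 := by exact_mod_cast E.h_one_pos.ne'
    push_cast at h4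
    field_simp at h4
    linear_combination h4
  -- Substituting η = (ζ/ρ) s₀ in ζ η^k = ρ s₀^k gives (ζ/ρ)^{k+1} = 1 whenever w_{k+1} ≠ 0.
  have h2 : ∀ k, w k ≠ 0 → (ζ / ρ) ^ k = 1 := by
    intro k hwk
    rcases k with _ | k
    · simp
    · have h3 := hk k hwk
      have h4 : η = ζ / ρ * s₀ := by
        field_simp
        linear_combination -h1
      rw [h4, mul_pow] at h3
      have h5 : (s₀ : ℂ) ^ k ≠ 0 := pow_ne_zero _ hs0
      rw [pow_succ]
      field_simp at h3 ⊢
      refine mul_right_cancel₀ hρ0 ?_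
      rw [div_pow] at *
      field_simp at h3 ⊢
      linear_combination h3
  have h3 := E.period _ h2
  rw [div_pow, div_eq_one_iff_eq (pow_ne_zero _ hρ0)] at h3
  exact h3

theorem analyticAt_equation {z v : ℂ} (hz : ‖z‖ ≤ ρ) (hv : ‖v‖ < r) :
    AnalyticAt ℂ (fun p : ℂ × ℂ => p.2 - g p.1 - p.1 * cSeries w p.2) (z, v) := by
  have h1 : AnalyticAt ℂ (fun p : ℂ × ℂ => g p.1) (z, v) :=
    (E.analyticAt_g hz).comp_of_eq analyticAt_fst rfl
  have h2 : AnalyticAt ℂ (fun p : ℂ × ℂ => cSeries w p.2) (z, v) :=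
    (E.analyticAt_phi hv).comp_of_eq analyticAt_snd rfl
  exact (analyticAt_snd.fun_sub h1).fun_sub (analyticAt_fst.fun_mul h2)

theorem tendsto_H {ζ : ℂ} (hζ : ‖ζ‖ = ρ) :
    Tendsto (cSeries h) (𝓝[Metric.ball 0 ρ] ζ) (𝓝 (cSeries h ζ)) :=
  (E.continuousOn_H ζ (by simp [hζ])).mono_left (nhdsWithin_mono _ Metric.ball_subset_closedBall)

/-- The derivative of H - g - zΦ(H) with respect to H is 1 - zΦ'(H), which vanishes on the circle
only if ζ^d = ρ^d; elsewhere the implicit function theorem continues H. -/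
theorem exists_analytic_extension {ζ : ℂ} (hζ : ‖ζ‖ = ρ) (hd : ζ ^ d ≠ (ρ : ℂ) ^ d) :
    ∃ θ, AnalyticAt ℂ θ ζ ∧ cSeries h =ᶠ[𝓝[Metric.ball 0 ρ] ζ] θ := by
  have hne : 1 - ζ * cSeries (derivCoeff w) (cSeries h ζ) ≠ 0 := fun h0 =>
    hd (E.pow_eq_of_char hζ (sub_eq_zero.1 h0).symm)
  obtain ⟨θ, hθ, -, hev, -⟩ := exists_analyticAt_implicit
    (E.analyticAt_equation hζ.le (E.norm_H_lt hζ.le))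
    (by linear_combination E.eqn_closed hζ.le)
    (((hasDerivAt_id _).sub_const (g ζ)).sub
      ((E.hasDerivAt_phi (E.norm_H_lt hζ.le)).const_mul ζ)) hne
  refine ⟨θ, hθ, ?_⟩
  have ht : Tendsto (fun z => (z, cSeries h z)) (𝓝[Metric.ball 0 ρ] ζ) (𝓝 (ζ, cSeries h ζ)) := by
    rw [nhds_prod_eq]
    exact (tendsto_id.mono_left nhdsWithin_le_nhds).prodMk (E.tendsto_H hζ)
  filter_upwards [ht.eventually hev, self_mem_nhdsWithin] with z hz hzb
  refine hz ?_
  have hzb' : ‖z‖ ≤ ρ := (mem_ball_zero_iff.1 hzb).le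
  linear_combination E.eqn_closed hzb'

/-- The second order Taylor quotient of `Φ` at `s₀` is positive. -/
theorem exists_second_quotient :
    ∃ (Φ₂ : ℂ → ℂ) (b : ℝ), AnalyticAt ℂ Φ₂ s₀ ∧ 0 < b ∧ Φ₂ s₀ = b ∧
      ∀ v, cSeries w v = cSeries w s₀ + cSeries (derivCoeff w) s₀ * (v - s₀) +
        (v - s₀) ^ 2 * Φ₂ v := by
  have hs : ‖(s₀ : ℂ)‖ < r := by
    rw [Complex.norm_real, Real.norm_of_nonneg E.s_pos.le]
    exact E.s_lt
  have han := E.analyticAt_phi hs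
  have hds : ∀ {f : ℂ → ℂ} {x : ℂ}, AnalyticAt ℂ f x → AnalyticAt ℂ (dslope f x) x := by
    rintro f x ⟨p, hp⟩
    exact ⟨_, hp.has_fpower_series_dslope_fslope⟩
  have hq : ∀ (f : ℂ → ℂ) (x v : ℂ), f v = f x + (v - x) * dslope f x v := by
    intro f x v
    have := sub_smul_dslope f x v
    simp only [smul_eq_mul] at this
    rw [this]
    ring
  set Φ₂ := dslope (dslope (cSeries w) s₀) s₀ with hΦ₂
  have hΦ₂an : AnalyticAt ℂ Φ₂ s₀ := hds (hds han)
  have hexp : ∀ v, cSeries w v = cSeries w s₀ + cSeries (derivCoeff w) s₀ * (v - s₀) +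
        (v - s₀) ^ 2 * Φ₂ v := by
    intro v
    have h1 := hq (cSeries w) s₀ v
    have h2 := hq (dslope (cSeries w) s₀) s₀ v
    rw [dslope_same, (E.hasDerivAt_phi hs).deriv] at h2
    rw [h1, h2]
    ring
  obtain ⟨t, hst, htr⟩ := exists_between E.s_lt
  have hlt : ENNReal.ofReal t < ENNReal.ofReal r :=
    (ENNReal.ofReal_lt_ofReal_iff (E.s_pos.trans E.s_lt)).2 htr
  have hs' : ‖(s₀ : ℂ)‖ < t := by
    rw [Complex.norm_real, Real.norm_of_nonneg E.s_pos.le]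
    exact hst
  have hconv1 := eSeries_derivCoeff_enorm_ne_top hlt E.conv
  have hd2 := hasDerivAt_cSeries (enorm_lt_ofReal hs') hconv1
  -- compare the derivatives of `Φ'` at `s₀`
  have hev : cSeries (derivCoeff w) =ᶠ[𝓝 (s₀ : ℂ)] fun v => cSeries (derivCoeff w) s₀ +
      (2 * (v - s₀) * Φ₂ v + (v - s₀) ^ 2 * deriv Φ₂ v) := by
    filter_upwards [hΦ₂an.eventually_analyticAt, Metric.isOpen_ball.mem_nhds
      (show (s₀ : ℂ) ∈ Metric.ball 0 r by simpa using hs)] with v hv hvr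
    have h1 := E.hasDerivAt_phi (v := v) (by simpa using hvr)
    have h2 : HasDerivAt (fun v => cSeries w s₀ + cSeries (derivCoeff w) s₀ * (v - s₀) +
        (v - s₀) ^ 2 * Φ₂ v) (cSeries (derivCoeff w) s₀ * 1 +
          (((2 : ℕ) : ℂ) * (v - s₀) ^ (2 - 1) * 1 * Φ₂ v + (v - s₀) ^ 2 * deriv Φ₂ v)) v :=
      ((((hasDerivAt_id v).sub_const _).const_mul _).const_add _).add
        ((((hasDerivAt_id v).sub_const (s₀ : ℂ)).fun_pow 2).mul hv.differentiableAt.hasDerivAt)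
    rw [funext hexp] at h1
    rw [h1.unique h2]
    push_cast
    ring
  have hval : cSeries (derivCoeff (derivCoeff w)) s₀ = 2 * Φ₂ s₀ := by
    have h1 := (hd2.congr_of_eventuallyEq hev.symm)
    have h2 : HasDerivAt (fun v => cSeries (derivCoeff w) s₀ +
      (2 * (v - s₀) * Φ₂ v + (v - s₀) ^ 2 * deriv Φ₂ v))
        ((2 * 1 * Φ₂ s₀ + 2 * ((s₀ : ℂ) - s₀) * deriv Φ₂ s₀) +
          (((2 : ℕ) : ℂ) * ((s₀ : ℂ) - s₀) ^ (2 - 1) * 1 * deriv Φ₂ s₀ +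
            ((s₀ : ℂ) - s₀) ^ 2 * deriv (deriv Φ₂) s₀)) s₀ :=
      (((((hasDerivAt_id _).sub_const _).const_mul _).mul hΦ₂an.differentiableAt.hasDerivAt).add
        ((((hasDerivAt_id _).sub_const (s₀ : ℂ)).fun_pow 2).mul
          hΦ₂an.deriv.differentiableAt.hasDerivAt)).const_add _
    rw [h1.unique h2]
    simp
  obtain ⟨k, hk2, hkpos⟩ := E.two_le
  obtain ⟨j, rfl⟩ := Nat.exists_eq_add_of_le' hk2
  have hnn := derivCoeff_nonneg (derivCoeff_nonneg E.w_nonneg)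
  have hconv2 : Summable fun n => derivCoeff (derivCoeff w) n * s₀ ^ n := by
    obtain ⟨t', hst', htt'⟩ := exists_between hst
    have hlt' : ENNReal.ofReal t' < ENNReal.ofReal t :=
      (ENNReal.ofReal_lt_ofReal_iff (E.s_pos.trans hst)).2 htt'
    have h1 := summable_cSeries (a := derivCoeff (derivCoeff w)) (z := (s₀ : ℂ))
      (y := ENNReal.ofReal t') ?_ (eSeries_derivCoeff_enorm_ne_top hlt' hconv1)
    · rw [← Complex.summable_ofReal]
      push_cast
      exact h1
    · refine (enorm_lt_ofReal ?_).le
      rw [Complex.norm_real, Real.norm_of_nonneg E.s_pos.le]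
      exact hst'
  have hpos : 0 < ∑' n, derivCoeff (derivCoeff w) n * s₀ ^ n := by
    refine hconv2.tsum_pos (fun n => mul_nonneg (hnn n) (pow_nonneg E.s_pos.le n)) j ?_
    refine mul_pos (mul_pos (by positivity) (mul_pos (by positivity) hkpos)) (pow_pos E.s_pos j)
  refine ⟨Φ₂, (∑' n, derivCoeff (derivCoeff w) n * s₀ ^ n) / 2, hΦ₂an, by positivity, ?_, hexp⟩
  have h3 : cSeries (derivCoeff (derivCoeff w)) s₀ =
      ((∑' n, derivCoeff (derivCoeff w) n * s₀ ^ n : ℝ) : ℂ) := by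
    rw [cSeries, Complex.ofReal_tsum]
    push_cast
    rfl
  rw [h3] at hval
  push_cast at hval ⊢
  linear_combination (-1 / 2 : ℂ) * hval

/-- Expanding the equation at (ρ, s₀), the terms linear in H - s₀ cancel because ρ Φ'(s₀) = 1. What
remains is ρ - z = (H - s₀)² κ with κ > 0 at the base point. Taking roots gives (ρ - z)^{1/2} = (s₀
- H) √κ, which can be solved analytically for H. -/
theorem exists_singular_expansion :
    ∃ (θ : ℂ → ℂ) (c : ℝ), AnalyticAt ℂ θ 0 ∧ c < 0 ∧ deriv θ 0 = c ∧
      cSeries h =ᶠ[𝓝[Metric.ball 0 ρ] (ρ : ℂ)] fun z => θ (csqrt (ρ - z)) := by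
  obtain ⟨Φ₂, b, hΦ₂, hb, hΦ₂b, hexp⟩ := E.exists_second_quotient
  obtain ⟨b', hb', hgb'⟩ := E.g_deriv
  have hρn : ‖(ρ : ℂ)‖ = ρ := by rw [Complex.norm_real, Real.norm_of_nonneg E.rho_pos.le]
  have hsn : ‖(s₀ : ℂ)‖ < r := by
    rw [Complex.norm_real, Real.norm_of_nonneg E.s_pos.le]
    exact E.s_lt
  set g₁ := dslope g ρ with hg₁
  have hg₁an : AnalyticAt ℂ g₁ ρ := by
    obtain ⟨p, hp⟩ := E.analyticAt_g hρn.le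
    exact ⟨_, hp.has_fpower_series_dslope_fslope⟩
  have hgexp : ∀ z, g z = g ρ + (z - ρ) * g₁ z := by
    intro z
    have := sub_smul_dslope g ρ z
    simp only [smul_eq_mul] at this
    rw [hg₁, this]
    ring
  have hg₁ρ : g₁ ρ = b' := by rw [hg₁, dslope_same, hgb']
  -- the value `Φ(s₀)`
  have hΦs : ∃ a : ℝ, 0 < a ∧ cSeries w s₀ = a := by
    have hsm : Summable fun n => w n * s₀ ^ n := by
      have h1 := summable_cSeries (a := w) (z := (s₀ : ℂ)) (enorm_lt_ofReal hsn).le E.conv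
      rw [← Complex.summable_ofReal]
      push_cast
      exact h1
    refine ⟨∑' n, w n * s₀ ^ n, ?_, ?_⟩
    · refine hsm.tsum_pos (fun n => mul_nonneg (E.w_nonneg n) (pow_nonneg E.s_pos.le n)) 0 ?_
      simpa using E.w_zero
    · rw [cSeries, Complex.ofReal_tsum]
      push_cast
      rfl
  obtain ⟨a, ha, hΦa⟩ := hΦs
  have hchar : ρ * cSeries (derivCoeff w) s₀ = 1 := by
    have h1 := (Complex.hasSum_ofReal.2 E.char).tsum_eq
    rw [Complex.ofReal_one] at h1
    rw [← h1, cSeries, ← tsum_mul_left]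
    push_cast
    rfl
  have heq0 : (s₀ : ℂ) = g ρ + ρ * cSeries w s₀ := by
    have := E.eqn_closed hρn.le
    rwa [E.H_rho] at this
  -- The variables are s = (ρ - z)^{1/2} and the value of H; hence z appears as ρ - s².
  set κ : ℂ × ℂ → ℂ := fun p => ρ * Φ₂ p.2 / (g₁ (ρ - p.1 ^ 2) + cSeries w p.2) with hκ
  set κ₀ : ℝ := ρ * b / (b' + a) with hκ₀
  have hκ₀pos : 0 < κ₀ := div_pos (mul_pos E.rho_pos hb) (by linarith)
  have hκval : κ (0, (s₀ : ℂ)) = κ₀ := by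
    simp only [hκ, hκ₀]
    rw [hΦ₂b, hΦa]
    simp [hg₁ρ]
  have hden : AnalyticAt ℂ (fun p : ℂ × ℂ => g₁ (ρ - p.1 ^ 2) + cSeries w p.2) (0, (s₀ : ℂ)) := by
    refine AnalyticAt.fun_add ?_ ?_
    · exact hg₁an.comp_of_eq (f := fun p : ℂ × ℂ => (ρ : ℂ) - p.1 ^ 2)
        (analyticAt_const.fun_sub (analyticAt_fst.fun_pow 2)) (by simp)
    · exact (E.analyticAt_phi hsn).comp_of_eq analyticAt_snd rfl
  have hden0 : (fun p : ℂ × ℂ => g₁ (ρ - p.1 ^ 2) + cSeries w p.2) (0, (s₀ : ℂ)) ≠ 0 := by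
    have h1 : (b' + a : ℂ) ≠ 0 := by
      have : b' + a ≠ 0 := by linarith
      exact_mod_cast this
    simpa [hg₁ρ, hΦa] using h1
  have hκan : AnalyticAt ℂ κ (0, (s₀ : ℂ)) := by
    refine AnalyticAt.fun_div (analyticAt_const.fun_mul ?_) hden hden0
    exact hΦ₂.comp_of_eq analyticAt_snd rfl
  have hκsp : κ (0, (s₀ : ℂ)) ∈ Complex.slitPlane := by
    rw [hκval]
    exact Or.inl (by simpa using hκ₀pos)
  have hsqan : AnalyticAt ℂ (fun p => csqrt (κ p)) (0, (s₀ : ℂ)) :=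
    (analyticAt_csqrt hκsp).comp_of_eq hκan rfl
  have hsqval : csqrt (κ (0, (s₀ : ℂ))) = (√κ₀ : ℝ) := by
    symm
    refine eq_csqrt_of_sq_eq hκsp ?_ (by simp)
    rw [hκval, ← Complex.ofReal_pow, Real.sq_sqrt hκ₀pos.le]
  have hsq0 : ((√κ₀ : ℝ) : ℂ) ≠ 0 := by exact_mod_cast (Real.sqrt_pos.2 hκ₀pos).ne'
  set P : ℂ × ℂ → ℂ := fun p => p.1 - (s₀ - p.2) * csqrt (κ p) with hP
  have hPan : AnalyticAt ℂ P (0, (s₀ : ℂ)) :=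
    analyticAt_fst.fun_sub ((analyticAt_const.fun_sub analyticAt_snd).fun_mul hsqan)
  have hP2 : HasDerivAt (fun v => P (0, v)) ((√κ₀ : ℝ) : ℂ) s₀ := by
    have h1 : DifferentiableAt ℂ (fun v => csqrt (κ (0, v))) (s₀ : ℂ) := by
      have : AnalyticAt ℂ (fun v : ℂ => csqrt (κ (0, v))) (s₀ : ℂ) :=
        hsqan.comp_of_eq (f := fun v : ℂ => ((0 : ℂ), v)) (by fun_prop) rfl
      exact this.differentiableAt
    have h2 := (((hasDerivAt_id (s₀ : ℂ)).const_sub (s₀ : ℂ)).mul h1.hasDerivAt).const_sub 0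
    refine h2.congr_deriv ?_
    rw [hsqval]
    simp
  have hP1 : HasDerivAt (fun s => P (s, (s₀ : ℂ))) 1 0 := by
    have : (fun s => P (s, (s₀ : ℂ))) = fun s => s := by
      funext s
      simp [hP]
    rw [this]
    exact hasDerivAt_id 0
  obtain ⟨θ, hθ, -, hev, hder⟩ := exists_analyticAt_implicit hPan (by simp [hP]) hP2 hsq0
  refine ⟨θ, -1 / √κ₀, hθ, ?_, ?_, ?_⟩
  · exact div_neg_of_neg_of_pos (by norm_num) (Real.sqrt_pos.2 hκ₀pos)
  · rw [hder 1 hP1]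
    push_cast
    rfl
  · have ht : Tendsto (fun z => (csqrt (ρ - z), cSeries h z)) (𝓝[Metric.ball 0 ρ] (ρ : ℂ))
        (𝓝 (0, (s₀ : ℂ))) := by
      rw [nhds_prod_eq]
      refine ((SqrtSing.tendsto_csqrt_sub ρ).mono_left nhdsWithin_le_nhds).prodMk ?_
      have := E.tendsto_H hρn
      rwa [E.H_rho] at this
    have hden' : ∀ᶠ p in 𝓝 ((0 : ℂ), (s₀ : ℂ)), g₁ (ρ - p.1 ^ 2) + cSeries w p.2 ≠ 0 :=
      hden.continuousAt.eventually_ne hden0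
    -- Near a positive value √κ is almost real. Together with Re (s₀ - H) ≥ 0, from |H| ≤ s₀, this
    -- selects the principal branch.
    have hq : ∀ᶠ p in 𝓝 ((0 : ℂ), (s₀ : ℂ)), |(csqrt (κ p)).im| < (csqrt (κ p)).re := by
      have h1 : ContinuousAt (fun p => |(csqrt (κ p)).im|) ((0 : ℂ), (s₀ : ℂ)) :=
        (Complex.continuous_im.continuousAt.comp hsqan.continuousAt).abs
      have h2 : ContinuousAt (fun p => (csqrt (κ p)).re) ((0 : ℂ), (s₀ : ℂ)) :=
        Complex.continuous_re.continuousAt.comp hsqan.continuousAt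
      refine h1.eventually_lt h2 ?_
      rw [hsqval]
      simpa using hκ₀pos
    filter_upwards [ht.eventually hev, ht.eventually hden', ht.eventually hq,
      self_mem_nhdsWithin] with z hz1 hz2 hz3 hzb
    refine hz1 ?_
    have hzn : ‖z‖ < ρ := by simpa using hzb
    have hzre : 0 < ((ρ : ℂ) - z).re := by
      have := Complex.re_le_norm z
      simp only [Complex.sub_re, Complex.ofReal_re]
      linarith
    have hHre : 0 ≤ ((s₀ : ℂ) - cSeries h z).re := by
      have h1 := Complex.re_le_norm (cSeries h z)
      have h2 := E.norm_H_le hzn.le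
      simp only [Complex.sub_re, Complex.ofReal_re]
      linarith
    have hmain : ((ρ : ℂ) - z) = (cSeries h z - s₀) ^ 2 * κ (csqrt (ρ - z), cSeries h z) := by
      simp only [hκ]
      rw [csqrt_sq] at hz2 ⊢
      rw [sub_sub_cancel] at hz2 ⊢
      have h1 := E.eqn_closed hzn.le
      have h2 := hexp (cSeries h z)
      have h3 := hgexp z
      rw [← mul_div_assoc, eq_div_iff hz2]
      linear_combination h1 - heq0 + h3 + (ρ : ℂ) * h2 + (cSeries h z - s₀) * hchar
    have h4 := eq_csqrt_of_re_nonneg hzre hHre hz3 (by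
      rw [mul_pow, csqrt_sq]
      linear_combination -hmain)
    simp only [hP]
    linear_combination -h4

theorem sqrtSing : ∃ c : ℝ, c < 0 ∧ SqrtSing (cSeries h) ρ d c := by
  obtain ⟨θ, c, hθ, hc, hder, hev⟩ := E.exists_singular_expansion
  refine ⟨c, hc, ?_, fun ζ hζ hd => E.exists_analytic_extension hζ hd, θ, hθ, hder, hev⟩
  refine differentiableOn_cSeries fun y hy => ?_
  have h1 : eSeries (fun n => ‖h n‖ₑ) (ENNReal.ofReal ρ) ≠ ∞ := by
    have := E.hasSum_h.summable.tsum_ofReal_ne_top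
    rw [eSeries]
    convert this using 3 with n
    rw [ENNReal.ofReal_mul (E.h_nonneg n), enorm_eq_ofReal_of_nonneg E.h_nonneg,
      ENNReal.ofReal_pow E.rho_pos.le]
  exact ne_top_of_le_ne_top h1 (eSeries_mono _ hy.le)

end TreeEquation

/-! ### Holomorphic functions majorized by extended nonnegative functions -/

/-- `f` is holomorphic on the disc of radius `R`, is given by `B` on the nonnegative reals and is
majorized by `B`. -/
structure IsRep (B : ℝ≥0∞ → ℝ≥0∞) (f : ℂ → ℂ) (R : ℝ) : Prop where
  differentiableOn : DifferentiableOn ℂ f (Metric.ball 0 R)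
  ne_top : ∀ x : ℝ, 0 ≤ x → x < R → B (ENNReal.ofReal x) ≠ ∞
  apply_ofReal : ∀ x : ℝ, 0 ≤ x → x < R → f x = ((B (ENNReal.ofReal x)).toReal : ℂ)
  norm_le : ∀ z ∈ Metric.ball (0 : ℂ) R, ‖f z‖ₑ ≤ B ‖z‖ₑ

namespace IsRep

variable {B B' : ℝ≥0∞ → ℝ≥0∞} {f f' : ℂ → ℂ} {R R' : ℝ}

theorem mono (h : IsRep B f R) (hR : R' ≤ R) : IsRep B f R' :=
  ⟨h.differentiableOn.mono (Metric.ball_subset_ball hR),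
    fun x hx hxR => h.ne_top x hx (by linarith),
    fun x hx hxR => h.apply_ofReal x hx (by linarith),
    fun z hz => h.norm_le z (Metric.ball_subset_ball hR hz)⟩

theorem congr (h : IsRep B f R) (he : ∀ x, B' x = B x) : IsRep B' f R := by
  rwa [show B' = B from funext he]

/-- Two holomorphic functions representing the same `B` agree on a real interval, hence on the disc.
Identities proved in [0, ∞] thus transfer to complex arguments. -/
theorem eqOn (h : IsRep B f R) (h' : IsRep B f' R) : Set.EqOn f f' (Metric.ball 0 R) := by
  rcases le_or_gt R 0 with hR | hR
  · simp [Metric.ball_eq_empty.2 hR]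
  refine AnalyticOnNhd.eqOn_of_preconnected_of_frequently_eq (z₀ := 0)
    (h.differentiableOn.analyticOnNhd Metric.isOpen_ball)
    (h'.differentiableOn.analyticOnNhd Metric.isOpen_ball)
    (convex_ball _ _).isPreconnected (by simpa using hR) ?_
  have h1 : ∀ᶠ x : ℝ in 𝓝[>] 0, f x = f' x := by
    filter_upwards [Ioo_mem_nhdsGT hR] with x hx
    rw [h.apply_ofReal x hx.1.le hx.2, h'.apply_ofReal x hx.1.le hx.2]
  have h2 : Tendsto (fun x : ℝ => (x : ℂ)) (𝓝[>] 0) (𝓝[≠] 0) := by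
    refine tendsto_nhdsWithin_iff.2 ⟨?_, ?_⟩
    · have := Complex.continuous_ofReal.tendsto 0
      rw [Complex.ofReal_zero] at this
      exact this.mono_left nhdsWithin_le_nhds
    · filter_upwards [self_mem_nhdsWithin] with x hx
      simpa using (ne_of_gt hx)
  exact h2.frequently h1.frequently

theorem const {b : ℝ≥0∞} (hb : b ≠ ∞) (R : ℝ) : IsRep (fun _ => b) (fun _ => (b.toReal : ℂ)) R :=
  ⟨differentiableOn_const _, fun _ _ _ => hb, fun _ _ _ => rfl, fun _ _ => by
    rw [← ofReal_norm, Complex.norm_real, Real.norm_of_nonneg ENNReal.toReal_nonneg,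
      ENNReal.ofReal_toReal hb]⟩

theorem natCast (n : ℕ) (R : ℝ) : IsRep (fun _ => (n : ℝ≥0∞)) (fun _ => (n : ℂ)) R := by
  simpa using const (ENNReal.natCast_ne_top n) R

theorem id (R : ℝ) : IsRep (fun x => x) (fun z => z) R :=
  ⟨differentiableOn_id, fun _ _ _ => ENNReal.ofReal_ne_top, fun x hx _ => by
    rw [ENNReal.toReal_ofReal hx], fun _ _ => le_rfl⟩

theorem add (h : IsRep B f R) (h' : IsRep B' f' R) :
    IsRep (fun x => B x + B' x) (fun z => f z + f' z) R := by
  refine ⟨h.differentiableOn.fun_add h'.differentiableOn, fun x h1 h2 => ?_, fun x h1 h2 => ?_,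
    fun z hz => ?_⟩
  · exact ENNReal.add_ne_top.2 ⟨h.ne_top x h1 h2, h'.ne_top x h1 h2⟩
  · rw [ENNReal.toReal_add (h.ne_top x h1 h2) (h'.ne_top x h1 h2), h.apply_ofReal x h1 h2,
      h'.apply_ofReal x h1 h2]
    push_cast
    rfl
  · exact (enorm_add_le _ _).trans (add_le_add (h.norm_le z hz) (h'.norm_le z hz))

theorem mul (h : IsRep B f R) (h' : IsRep B' f' R) :
    IsRep (fun x => B x * B' x) (fun z => f z * f' z) R := by
  refine ⟨h.differentiableOn.fun_mul h'.differentiableOn, fun x h1 h2 => ?_, fun x h1 h2 => ?_,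
    fun z hz => ?_⟩
  · exact ENNReal.mul_ne_top (h.ne_top x h1 h2) (h'.ne_top x h1 h2)
  · rw [ENNReal.toReal_mul, h.apply_ofReal x h1 h2, h'.apply_ofReal x h1 h2]
    push_cast
    rfl
  · rw [enorm_mul]
    exact mul_le_mul' (h.norm_le z hz) (h'.norm_le z hz)

theorem sum {ι : Type*} {s : Finset ι} {B : ι → ℝ≥0∞ → ℝ≥0∞} {f : ι → ℂ → ℂ}
    (h : ∀ i ∈ s, IsRep (B i) (f i) R) :
    IsRep (fun x => ∑ i ∈ s, B i x) (fun z => ∑ i ∈ s, f i z) R := by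
  classical
  induction s using Finset.induction_on with
  | empty => simpa using natCast 0 R
  | insert i s hi ih =>
    simp_rw [Finset.sum_insert hi]
    exact (h i (Finset.mem_insert_self i s)).add
      (ih fun j hj => h j (Finset.mem_insert_of_mem hj))

theorem enorm_ne_top (h : IsRep B f R) {z : ℂ} (hz : z ∈ Metric.ball (0 : ℂ) R) : B ‖z‖ₑ ≠ ∞ := by
  rw [← ofReal_norm]
  exact h.ne_top _ (norm_nonneg z) (by simpa using hz)

end IsRep

theorem cSeries_ofReal_eq {a : ℕ → ℝ} (ha : ∀ n, 0 ≤ a n) {x : ℝ} (hx : 0 ≤ x) :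
    cSeries a x = ((eSeries (fun n => ENNReal.ofReal (a n)) (ENNReal.ofReal x)).toReal : ℂ) := by
  rw [← seriesSum_eq_toReal ha hx, seriesSum, cSeries, Complex.ofReal_tsum]
  push_cast
  rfl

theorem enorm_cSeries_le {a : ℕ → ℝ} (ha : ∀ n, 0 ≤ a n) (z : ℂ) :
    ‖cSeries a z‖ₑ ≤ eSeries (fun n => ENNReal.ofReal (a n)) ‖z‖ₑ := by
  refine (enorm_tsum_le_tsum_enorm).trans (ENNReal.tsum_le_tsum fun n => ?_)
  rw [enorm_mul, enorm_pow, congrFun (enorm_ofReal_coeff a) n, enorm_eq_ofReal_of_nonneg ha]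

/-- A power series with nonnegative coefficients, composed with a represented function. -/
theorem IsRep.eSeries_comp {B : ℝ≥0∞ → ℝ≥0∞} {f : ℂ → ℂ} {R : ℝ} (h : IsRep B f R) {a : ℕ → ℝ}
    (ha : ∀ n, 0 ≤ a n) {r : ℝ≥0∞} (hr : ∀ y < r, eSeries (fun n => ENNReal.ofReal (a n)) y ≠ ∞)
    (hB : ∀ x : ℝ, 0 ≤ x → x < R → B (ENNReal.ofReal x) < r) :
    IsRep (fun x => eSeries (fun n => ENNReal.ofReal (a n)) (B x))
      (fun z => cSeries a (f z)) R := by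
  refine ⟨fun z hz => ?_, fun x h1 h2 => hr _ (hB x h1 h2), fun x h1 h2 => ?_, fun z hz => ?_⟩
  · have h1 : ‖f z‖ₑ < r := by
      refine (h.norm_le z hz).trans_lt ?_
      rw [← ofReal_norm]
      exact hB _ (norm_nonneg z) (by simpa using hz)
    obtain ⟨y, hy1, hy2⟩ := exists_between h1
    have h2 := hr y hy2
    rw [← funext (enorm_eq_ofReal_of_nonneg ha)] at h2
    exact (hasDerivAt_cSeries hy1 h2).differentiableAt.comp_differentiableWithinAt z
      (h.differentiableOn z hz)
  · rw [h.apply_ofReal x h1 h2, cSeries_ofReal_eq ha ENNReal.toReal_nonneg,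
      ENNReal.ofReal_toReal (h.ne_top x h1 h2)]
  · exact (enorm_cSeries_le ha _).trans (eSeries_mono _ (h.norm_le z hz))

theorem isRep_cSeries {a : ℕ → ℝ} (ha : ∀ n, 0 ≤ a n) {R : ℝ}
    (h : ∀ y < ENNReal.ofReal R, eSeries (fun n => ENNReal.ofReal (a n)) y ≠ ∞) :
    IsRep (eSeries fun n => ENNReal.ofReal (a n)) (cSeries a) R :=
  (IsRep.id R).eSeries_comp ha h fun _ h1 h2 =>
    (ENNReal.ofReal_lt_ofReal_iff (h1.trans_lt h2)).2 h2

/-- Each factor `n` is one application of x d/dx, which keeps convergence on the open disc. -/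
theorem eSeries_pow_mul_ne_top {a : ℕ → ℝ≥0∞} {r : ℝ≥0∞} (h : ∀ y < r, eSeries a y ≠ ∞) (m : ℕ) :
    ∀ y < r, eSeries (fun n => (n : ℝ≥0∞) ^ m * a n) y ≠ ∞ := by
  induction m with
  | zero => simpa using h
  | succ m ih =>
    intro y hy
    obtain ⟨x, hyx, hx⟩ := exists_between hy
    have h1 := eSeries_derivCoeff_ne_top hyx (ih x hx)
    have h2 : eSeries (fun n => (n : ℝ≥0∞) ^ (m + 1) * a n) y =
        y * eSeries (derivCoeff fun n => (n : ℝ≥0∞) ^ m * a n) y := by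
      rw [eSeries_eq_zero_add, eSeries, ← ENNReal.tsum_mul_left]
      simp only [derivCoeff]
      rw [Nat.cast_zero, zero_pow (Nat.succ_ne_zero m), zero_mul, zero_add]
      refine tsum_congr fun n => ?_
      push_cast
      ring
    rw [h2]
    exact ENNReal.mul_ne_top hy.ne_top h1

/-- The period of a set of exponents. -/
theorem exists_period {w : ℕ → ℝ} (hw : ∃ k, 2 ≤ k ∧ 0 < w k) :
    ∃ d, 0 < d ∧ (∀ k, w k ≠ 0 → d ∣ k) ∧
      ∀ ζ : ℂ, (∀ k, w k ≠ 0 → ζ ^ k = 1) → ζ ^ d = 1 := by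
  classical
  obtain ⟨k₀, hk2, hk⟩ := hw
  -- The period is the least common multiple of all common divisors of the support. The order of ζ
  -- is itself such a common divisor, so it divides the period.
  set s := k₀.divisors.filter fun g => ∀ k, w k ≠ 0 → g ∣ k with hs
  refine ⟨s.lcm _root_.id, ?_, fun k hk => ?_, fun ζ hζ => ?_⟩
  · rw [Nat.pos_iff_ne_zero, Ne, Finset.lcm_eq_zero_iff]
    rintro ⟨x, hx, hx0⟩
    simp only [hs, Finset.mem_filter, Nat.mem_divisors] at hx
    obtain ⟨⟨h1, h2⟩, -⟩ := hx
    simp only [_root_.id] at hx0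
    subst hx0
    exact h2 (zero_dvd_iff.1 h1)
  · exact Finset.lcm_dvd fun g hg => (Finset.mem_filter.1 hg).2 k hk
  · rw [← orderOf_dvd_iff_pow_eq_one]
    have h1 : orderOf ζ ∈ s := by
      rw [hs, Finset.mem_filter, Nat.mem_divisors]
      exact ⟨⟨orderOf_dvd_of_pow_eq_one (hζ k₀ hk.ne'), by omega⟩,
        fun k hk => orderOf_dvd_of_pow_eq_one (hζ k hk)⟩
    exact Finset.dvd_lcm h1

/-! ### Holomorphic moment functions and their linear equations -/

namespace OrderedTree

theorem derivCoeff_iterate_nonneg {a : ℕ → ℝ} (ha : ∀ n, 0 ≤ a n) (k n : ℕ) :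
    0 ≤ (derivCoeff^[k] a) n := by
  induction k generalizing n with
  | zero => exact ha n
  | succ k ih =>
    rw [Function.iterate_succ_apply']
    exact derivCoeff_nonneg ih n

theorem eWeight_derivCoeff_iterate {w : ℕ → ℝ} (hw : ∀ n, 0 ≤ w n) (k : ℕ) :
    eWeight (derivCoeff^[k] w) = derivCoeff^[k] (eWeight w) := by
  induction k with
  | zero => rfl
  | succ k ih =>
    rw [Function.iterate_succ_apply', Function.iterate_succ_apply', ← ih]
    exact ofReal_derivCoeff (derivCoeff_iterate_nonneg hw k)

/-- The complex generating function of a mixed moment. -/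
noncomputable def momentFun (w : ℕ → ℝ) (l m : ℕ) (z : ℂ) : ℂ := cSeries (momentCoeff w l m) z

/-- The complex version of `\widehat F_p`. -/
noncomputable def hatFun (w : ℕ → ℝ) (p : ℕ) (z : ℂ) : ℂ :=
  ∑ k ∈ Finset.range (p + 1), (p.choose k : ℂ) * momentFun w k 0 z

/-- The complex version of `Φ'(\widehat F_p(z))`. -/
noncomputable def phiFun (w : ℕ → ℝ) (p : ℕ) (z : ℂ) : ℂ := cSeries (derivCoeff w) (hatFun w p z)

namespace Admissible

variable {w : ℕ → ℝ} (hw : Admissible w)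

include hw

theorem ofReal_rho (m : ℕ) : ENNReal.ofReal (rho w m) = rootRadius w m :=
  ENNReal.ofReal_toReal (hw.rootRadius_lt_top m).ne

theorem rho_pos (m : ℕ) : 0 < rho w m :=
  ENNReal.toReal_pos (hw.rootRadius_pos m).ne' (hw.rootRadius_lt_top m).ne

theorem rho_strictAnti : StrictAnti (rho w) := fun _ n h =>
  (ENNReal.toReal_lt_toReal (hw.rootRadius_lt_top n).ne (hw.rootRadius_lt_top _).ne).2
    (hw.rootRadius_strictAnti h)

theorem rho_antitone : Antitone (rho w) := hw.rho_strictAnti.antitone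

theorem ofReal_lt_rootRadius {m : ℕ} {x : ℝ} (h : x < rho w m) :
    ENNReal.ofReal x < rootRadius w m := by
  rw [← hw.ofReal_rho]
  exact (ENNReal.ofReal_lt_ofReal_iff (hw.rho_pos m)).2 h

/-- By S ≤ nR, the mixed moment is dominated by n^m times the pure moment of order `l + m`. -/
theorem momentGF_mixed_ne_top (l m : ℕ) : ∀ y < rootRadius w (l + m), momentGF w l m y ≠ ∞ := by
  intro y hy
  have h := eSeries_pow_mul_ne_top (a := fun n => ENNReal.ofReal (momentCoeff w (l + m) 0 n))
    (r := rootRadius w (l + m)) (fun y hy => by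
      rw [← momentGF_eq_eSeries hw.nonneg]
      exact hw.momentGF_ne_top hy) m y hy
  refine ne_top_of_le_ne_top h ?_
  rw [momentGF_eq_eSeries hw.nonneg]
  refine ENNReal.tsum_le_tsum fun n => mul_le_mul_left ?_ _
  have h1 : (n : ℝ≥0∞) ^ m = ENNReal.ofReal ((n : ℝ) ^ m) := by
    rw [ENNReal.ofReal_pow (by positivity), ENNReal.ofReal_natCast]
  beta_reduce
  rw [h1, ← ENNReal.ofReal_mul (by positivity)]
  refine ENNReal.ofReal_le_ofReal ?_
  rw [momentCoeff, momentCoeff, Finset.mul_sum]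
  refine Finset.sum_le_sum fun T hT => ?_
  rw [mem_ofSize] at hT
  have h2 : (T.numSubtrees : ℝ) ≤ n * T.numRootSubtrees := by
    rw [← hT]
    exact_mod_cast T.numSubtrees_le_size_mul
  have h3 : (T.numSubtrees : ℝ) ^ m ≤ (n : ℝ) ^ m * (T.numRootSubtrees : ℝ) ^ m := by
    rw [← mul_pow]
    exact pow_le_pow_left₀ (by positivity) h2 m
  calc T.weight w * ((T.numRootSubtrees : ℝ) ^ l * (T.numSubtrees : ℝ) ^ m)
      ≤ T.weight w * ((T.numRootSubtrees : ℝ) ^ l *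
          ((n : ℝ) ^ m * (T.numRootSubtrees : ℝ) ^ m)) :=
        mul_le_mul_of_nonneg_left (mul_le_mul_of_nonneg_left h3 (by positivity))
          (weight_nonneg hw.nonneg T)
    _ = _ := by ring

theorem isRep_moment (l m : ℕ) : IsRep (momentGF w l m) (momentFun w l m) (rho w (l + m)) := by
  refine (isRep_cSeries (momentCoeff_nonneg hw.nonneg l m) ?_).congr
    (momentGF_eq_eSeries hw.nonneg l m)
  intro y hy
  rw [← momentGF_eq_eSeries hw.nonneg]
  rw [hw.ofReal_rho] at hy
  exact hw.momentGF_mixed_ne_top l m y hy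

theorem isRep_hatGF (p q : ℕ) : ∃ f, IsRep (hatGF w p q) f (rho w (p + q)) := by
  refine ⟨_, (IsRep.sum (f := fun k z => (p.choose k : ℂ) * momentFun w k q z) fun k hk =>
    (IsRep.natCast (p.choose k) _).mul ((hw.isRep_moment k q).mono (hw.rho_antitone ?_))).congr
      (hatGF_eq_sum w p q)⟩
  have := Finset.mem_range.1 hk
  omega

theorem isRep_hatFun (p : ℕ) : IsRep (hatGF w p 0) (hatFun w p) (rho w p) := by
  refine (IsRep.sum (f := fun k z => (p.choose k : ℂ) * momentFun w k 0 z) fun k hk =>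
    (IsRep.natCast (p.choose k) _).mul ((hw.isRep_moment k 0).mono (hw.rho_antitone ?_))).congr
      (hatGF_eq_sum w p 0)
  have := Finset.mem_range.1 hk
  omega

theorem hatGF_lt_radius_of_lt (p : ℕ) {x : ℝ} (hx : x < rho w p) :
    hatGF w p 0 (ENNReal.ofReal x) < seriesRadius w :=
  (hatGF_mono w p 0 (hw.ofReal_lt_rootRadius hx).le).trans_lt (hw.hatGF_lt_radius p)

theorem eSeries_derivCoeff_iterate_ne_top (k : ℕ) :
    ∀ y < seriesRadius w, eSeries (eWeight (derivCoeff^[k] w)) y ≠ ∞ := by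
  rw [eWeight_derivCoeff_iterate hw.nonneg]
  induction k with
  | zero => exact fun y hy => hw.eSeries_ne_top hy
  | succ k ih =>
    intro y hy
    rw [Function.iterate_succ_apply']
    obtain ⟨z, hyz, hz⟩ := exists_between hy
    exact eSeries_derivCoeff_ne_top hyz (ih z hz)

theorem isRep_eSeries_hat (k p : ℕ) :
    IsRep (fun x => eSeries (derivCoeff^[k] (eWeight w)) (hatGF w p 0 x))
      (fun z => cSeries (derivCoeff^[k] w) (hatFun w p z)) (rho w p) := by
  rw [← eWeight_derivCoeff_iterate hw.nonneg]
  exact (hw.isRep_hatFun p).eSeries_comp (derivCoeff_iterate_nonneg hw.nonneg k)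
    (hw.eSeries_derivCoeff_iterate_ne_top k) fun x _ hx => hw.hatGF_lt_radius_of_lt p hx

theorem isRep_phiFun (p : ℕ) :
    IsRep (fun x => ePhiDeriv w (hatGF w p 0 x)) (phiFun w p) (rho w p) :=
  hw.isRep_eSeries_hat 1 p

/-- Each use of the recursion differentiates Φ once more, so the claim is needed for all derivatives
at once. In every summand both factors have total order at most `p + j`. -/
theorem isRep_tupleSum (p j k : ℕ) :
    ∃ f, IsRep (fun x => tupleSum (derivCoeff^[k] (eWeight w)) (hatTerm w p x)
      (fun T => (T.numSubtrees : ℝ≥0∞)) j) f (rho w (p + j)) := by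
  induction j using Nat.strong_induction_on generalizing k with
  | _ j ih =>
    rcases j with _ | j
    · exact ⟨_, (hw.isRep_eSeries_hat k p).congr fun x => by rw [tupleSum_zero, hatGF_zero]⟩
    · have hf : ∀ q ∈ Finset.range (j + 1), ∃ f, IsRep (fun x => (j.choose q : ℝ≥0∞) *
          hatGF w p (q + 1) x * tupleSum (derivCoeff^[k + 1] (eWeight w)) (hatTerm w p x)
            (fun T => (T.numSubtrees : ℝ≥0∞)) (j - q)) f (rho w (p + (j + 1))) := by
        intro q hq
        have hq' := Finset.mem_range.1 hq
        obtain ⟨f₁, h1⟩ := hw.isRep_hatGF p (q + 1)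
        obtain ⟨f₂, h2⟩ := ih (j - q) (by omega) (k + 1)
        exact ⟨_, ((IsRep.natCast _ _).mul (h1.mono (hw.rho_antitone (by omega)))).mul
          (h2.mono (hw.rho_antitone (by omega)))⟩
      choose! f hf using hf
      refine ⟨_, (IsRep.sum hf).congr fun x => ?_⟩
      rw [tupleSum_succ, ← Function.iterate_succ_apply' derivCoeff]
      rfl

/-- The part of a summand of the recursion that is not regular at `ρ_N`. -/
theorem exists_remainder {N j : ℕ} (hj : 1 ≤ j) (hjN : j ≤ N) :
    ∃ (K : ℝ≥0∞ → ℝ≥0∞) (κ : ℂ → ℂ), IsRep K κ (rho w (N - 1)) ∧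
      ∀ x, x * tupleSum (eWeight w) (hatTerm w (N - j) x) (fun T => (T.numSubtrees : ℝ≥0∞)) j =
        x * ePhiDeriv w (hatGF w (N - j) 0 x) * momentGF w (N - j) j x + K x := by
  obtain ⟨i, rfl⟩ := Nat.exists_eq_add_of_le' hj
  set p := N - (i + 1) with hp
  -- For q < i both factors have total order at most N - 1, so they are regular at ρ_N. Only q = i
  -- reaches order N, and within it only the top binomial term of the (1 + R)^p expansion.
  have hf : ∀ q ∈ Finset.range i, ∃ f, IsRep (fun x => (i.choose q : ℝ≥0∞) *
      hatGF w p (q + 1) x * tupleSum (derivCoeff^[1] (eWeight w)) (hatTerm w p x)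
        (fun T => (T.numSubtrees : ℝ≥0∞)) (i - q)) f (rho w (N - 1)) := by
    intro q hq
    have hq' := Finset.mem_range.1 hq
    obtain ⟨f₁, h1⟩ := hw.isRep_hatGF p (q + 1)
    obtain ⟨f₂, h2⟩ := hw.isRep_tupleSum p (i - q) 1
    exact ⟨_, ((IsRep.natCast _ _).mul (h1.mono (hw.rho_antitone (by omega)))).mul
      (h2.mono (hw.rho_antitone (by omega)))⟩
  choose! f hf using hf
  have hlow : IsRep (fun x => ∑ k ∈ Finset.range p, (p.choose k : ℝ≥0∞) * momentGF w k (i + 1) x)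
      (fun z => ∑ k ∈ Finset.range p, (p.choose k : ℂ) * momentFun w k (i + 1) z)
      (rho w (N - 1)) := by
    refine IsRep.sum fun k hk => (IsRep.natCast _ _).mul
      ((hw.isRep_moment k (i + 1)).mono (hw.rho_antitone ?_))
    have := Finset.mem_range.1 hk
    omega
  refine ⟨_, _, (((IsRep.id _).mul ((hw.isRep_phiFun p).mono (hw.rho_antitone (by omega)))).mul
    hlow).add ((IsRep.id _).mul (IsRep.sum hf)), fun x => ?_⟩
  rw [tupleSum_succ, Finset.sum_range_succ, Nat.choose_self, Nat.sub_self, tupleSum_zero,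
    ← hatGF_zero]
  have h1 : (∑' t, hatTerm w p x t * (t.numSubtrees : ℝ≥0∞) ^ (i + 1)) =
      ∑ k ∈ Finset.range p, (p.choose k : ℝ≥0∞) * momentGF w k (i + 1) x +
        momentGF w p (i + 1) x := by
    have := hatGF_eq_sum w p (i + 1) x
    rw [Finset.sum_range_succ, Nat.choose_self, Nat.cast_one, one_mul] at this
    exact this
  rw [h1]
  simp only [hatGF, Function.iterate_one, ePhiDeriv]
  push_cast
  ring

/-- The functional equation of the mixed moments, up to a function that is regular at `ρ_N`. -/
theorem exists_moment_eq {l m : ℕ} (hm : 1 ≤ m) :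
    ∃ κ : ℂ → ℂ, DifferentiableOn ℂ κ (Metric.ball 0 (rho w (m + l - 1))) ∧
      ∀ z ∈ Metric.ball (0 : ℂ) (rho w (m + l)),
        momentFun w l m z = momentFun w (m + l) 0 z +
          ∑ j ∈ Finset.Ico 1 m, (m.choose j : ℂ) *
            (z * phiFun w (m + l - j) z) * momentFun w (m + l - j) j z +
          z * phiFun w l z * momentFun w l m z + κ z := by
  have hK : ∀ j ∈ Finset.Icc 1 m, ∃ (K : ℝ≥0∞ → ℝ≥0∞) (κ : ℂ → ℂ),
      IsRep K κ (rho w (m + l - 1)) ∧ ∀ x,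
        x * tupleSum (eWeight w) (hatTerm w (m + l - j) x) (fun T => (T.numSubtrees : ℝ≥0∞)) j =
        x * ePhiDeriv w (hatGF w (m + l - j) 0 x) * momentGF w (m + l - j) j x + K x := by
    intro j hj
    have := Finset.mem_Icc.1 hj
    exact hw.exists_remainder this.1 (by omega)
  choose! K κ hKrep hKeq using hK
  have hrest : IsRep (fun x => ∑ j ∈ Finset.Icc 1 m, (m.choose j : ℝ≥0∞) * K j x)
      (fun z => ∑ j ∈ Finset.Icc 1 m, (m.choose j : ℂ) * κ j z) (rho w (m + l - 1)) :=
    IsRep.sum fun j hj => (IsRep.natCast _ _).mul (hKrep j hj)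
  have hterm : ∀ j, 1 ≤ j → j ≤ m → IsRep
      (fun x => x * ePhiDeriv w (hatGF w (m + l - j) 0 x) * momentGF w (m + l - j) j x)
      (fun z => z * phiFun w (m + l - j) z * momentFun w (m + l - j) j z) (rho w (m + l)) := by
    intro j h1 h2
    refine ((IsRep.id _).mul ((hw.isRep_phiFun _).mono (hw.rho_antitone (by omega)))).mul
      ((hw.isRep_moment _ _).mono (hw.rho_antitone (by omega)))
  have hsum := IsRep.sum (s := Finset.Ico 1 m) (R := rho w (m + l))
    (B := fun j x => (m.choose j : ℝ≥0∞) *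
      (x * ePhiDeriv w (hatGF w (m + l - j) 0 x) * momentGF w (m + l - j) j x))
    (f := fun j z => (m.choose j : ℂ) *
      (z * phiFun w (m + l - j) z * momentFun w (m + l - j) j z))
    fun j hj => (IsRep.natCast _ _).mul
      (hterm j (Finset.mem_Ico.1 hj).1 (Finset.mem_Ico.1 hj).2.le)
  have hall := (((hw.isRep_moment (m + l) 0).add hsum).add (hterm m hm le_rfl)).add
    (hrest.mono (hw.rho_antitone (by omega)))
  have hmom := (hw.isRep_moment l m)
  rw [add_comm l m] at hmom
  refine ⟨_, hrest.differentiableOn, fun z hz => ?_⟩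
  have hcongr := hall.congr (B' := momentGF w l m) fun x => by
    rw [momentGF_eq_sum hw.nonneg, Finset.sum_range_eq_add_Ico _ (Nat.succ_pos m)]
    -- The term with no factor on the branches is F_{m+l}, by the functional equation for pure
    -- moments.
    have e0 : ((m.choose 0 : ℕ) : ℝ≥0∞) * (x * tupleSum (eWeight w) (hatTerm w (l + m - 0) x)
        (fun T => (T.numSubtrees : ℝ≥0∞)) 0) = momentGF w (m + l) 0 x := by
      rw [tupleSum_zero, ← hatGF_zero, momentGF_zero_right hw.nonneg, Nat.sub_zero, add_comm l m]
      simp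
    rw [e0]
    have e1 : ∑ j ∈ Finset.Ico 1 (m + 1), (m.choose j : ℝ≥0∞) * (x * tupleSum (eWeight w)
        (hatTerm w (l + m - j) x) (fun T => (T.numSubtrees : ℝ≥0∞)) j) =
        ∑ j ∈ Finset.Ico 1 (m + 1), (m.choose j : ℝ≥0∞) *
          (x * ePhiDeriv w (hatGF w (m + l - j) 0 x) * momentGF w (m + l - j) j x) +
        ∑ j ∈ Finset.Icc 1 m, (m.choose j : ℝ≥0∞) * K j x := by
      rw [show Finset.Icc 1 m = Finset.Ico 1 (m + 1) from rfl, ← Finset.sum_add_distrib]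
      refine Finset.sum_congr rfl fun j hj => ?_
      have hj' := Finset.mem_Ico.1 hj
      rw [add_comm l m, hKeq j (Finset.mem_Icc.2 ⟨hj'.1, by omega⟩) x, mul_add]
    rw [e1, Finset.sum_Ico_succ_top hm, Nat.choose_self, Nat.cast_one, one_mul]
    ring
  have := hmom.eqOn hcongr hz
  have h2 : m + l - m = l := by omega
  rw [h2] at this
  simp only [mul_assoc] at this ⊢
  exact this

end Admissible

end OrderedTree

/-! ### Square root singularities of the moment functions -/

namespace OrderedTree

/-- The coefficients of a binomial combination of the moment generating functions. -/
noncomputable def hatCoeff (w : ℕ → ℝ) (p s n : ℕ) : ℝ :=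
  ∑ k ∈ Finset.range s, (p.choose k : ℝ) * momentCoeff w k 0 n

theorem hatCoeff_nonneg {w : ℕ → ℝ} (hw : ∀ i, 0 ≤ w i) (p s n : ℕ) : 0 ≤ hatCoeff w p s n :=
  Finset.sum_nonneg fun _ _ => mul_nonneg (by positivity) (momentCoeff_nonneg hw _ _ _)

theorem eSeries_hatCoeff {w : ℕ → ℝ} (hw : ∀ i, 0 ≤ w i) (p s : ℕ) (x : ℝ≥0∞) :
    eSeries (fun n => ENNReal.ofReal (hatCoeff w p s n)) x =
      ∑ k ∈ Finset.range s, (p.choose k : ℝ≥0∞) * momentGF w k 0 x := by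
  simp_rw [momentGF_eq_eSeries hw, eSeries, ← ENNReal.tsum_mul_left]
  rw [← Summable.tsum_finsetSum fun _ _ => ENNReal.summable]
  refine tsum_congr fun n => ?_
  rw [hatCoeff, ENNReal.ofReal_sum_of_nonneg
    fun _ _ => mul_nonneg (by positivity) (momentCoeff_nonneg hw _ _ _), Finset.sum_mul]
  refine Finset.sum_congr rfl fun k _ => ?_
  rw [ENNReal.ofReal_mul (by positivity), ENNReal.ofReal_natCast, mul_assoc]

theorem hasSum_of_eSeries_ne_top {a : ℕ → ℝ} (ha : ∀ n, 0 ≤ a n) {x : ℝ} (hx : 0 ≤ x)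
    (h : eSeries (fun n => ENNReal.ofReal (a n)) (ENNReal.ofReal x) ≠ ∞) :
    HasSum (fun n => a n * x ^ n)
      (eSeries (fun n => ENNReal.ofReal (a n)) (ENNReal.ofReal x)).toReal := by
  rw [← seriesSum_eq_toReal ha hx]
  have h1 : (fun n => ‖a n‖ₑ) = fun n => ENNReal.ofReal (a n) :=
    funext (enorm_eq_ofReal_of_nonneg ha)
  rw [← h1] at h
  refine (summable_of_eSeries_ne_top (z := x) ?_ h).of_norm.hasSum
  rw [Real.enorm_of_nonneg hx]

theorem momentCoeff_modEq {w : ℕ → ℝ} {d : ℕ} (hd : ∀ k, w k ≠ 0 → d ∣ k) {l m n : ℕ}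
    (h : momentCoeff w l m n ≠ 0) : n ≡ 1 [MOD d] := by
  obtain ⟨T, hT, hne⟩ := Finset.exists_ne_zero_of_sum_ne_zero h
  rw [← mem_ofSize.1 hT]
  exact size_modEq_one hd T (left_ne_zero_of_mul hne)

namespace Admissible

variable {w : ℕ → ℝ} (hw : Admissible w)

include hw

theorem momentCoeff_zero_one_pos : 0 < momentCoeff w 0 0 1 := by
  set T := graft 0 Fin.elim0 with hT
  have hmem : T ∈ ofSize 1 := by
    rw [mem_ofSize, hT, size_graft]
    simp
  have hwt : T.weight w = w 0 := by
    rw [hT, weight_graft]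
    simp
  refine lt_of_lt_of_le ?_ (Finset.single_le_sum (f := fun T : OrderedTree => T.weight w *
    ((T.numRootSubtrees : ℝ) ^ 0 * (T.numSubtrees : ℝ) ^ 0))
    (fun T _ => mul_nonneg (weight_nonneg hw.nonneg T) (by positivity)) hmem)
  simp only [pow_zero, mul_one]
  rw [hwt]
  exact hw.zero_pos

theorem isRep_hatCoeff (m : ℕ) :
    IsRep (hatGF w m 0) (cSeries (hatCoeff w m (m + 1))) (rho w m) := by
  refine (isRep_cSeries (hatCoeff_nonneg hw.nonneg m (m + 1)) fun y hy => ?_).congr fun x => ?_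
  · rw [eSeries_hatCoeff hw.nonneg, ← hatGF_eq_sum]
    rw [hw.ofReal_rho] at hy
    exact ((hatGF_mono w m 0 hy.le).trans_lt ((hw.hatGF_lt_radius m).trans_le le_top)).ne
  · rw [eSeries_hatCoeff hw.nonneg, ← hatGF_eq_sum]

/-- The lower part is regular beyond ρ_m: for m > 0 up to ρ_{m-1}, and for m = 0 everywhere because
the sum is empty, so any larger radius serves. -/
theorem exists_lower_rep (m : ℕ) :
    ∃ R, rho w m < R ∧ IsRep (lowerGF w m) (cSeries (hatCoeff w m m)) R := by
  obtain ⟨R, hR, hfin⟩ : ∃ R, rho w m < R ∧ ∀ y < ENNReal.ofReal R, lowerGF w m y ≠ ∞ := by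
    rcases m with _ | m
    · exact ⟨rho w 0 + 1, by linarith, fun y _ => by simp [lowerGF]⟩
    · refine ⟨rho w m, hw.rho_strictAnti (Nat.lt_succ_self m), fun y hy => ?_⟩
      rw [hw.ofReal_rho] at hy
      exact lowerGF_succ_ne_top (hw.momentGF_ne_top hy)
  refine ⟨R, hR, (isRep_cSeries (hatCoeff_nonneg hw.nonneg m m) fun y hy => ?_).congr fun x => ?_⟩
  · rw [eSeries_hatCoeff hw.nonneg]
    exact hfin y hy
  · rw [eSeries_hatCoeff hw.nonneg, lowerGF]

theorem treeEquation {d : ℕ} (hd : ∀ ζ : ℂ, (∀ k, w k ≠ 0 → ζ ^ k = 1) → ζ ^ d = 1) (m : ℕ)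
    {R : ℝ} (hR : rho w m < R) (hg : IsRep (lowerGF w m) (cSeries (hatCoeff w m m)) R) :
    ∃ r, TreeEquation w (hatCoeff w m (m + 1)) (cSeries (hatCoeff w m m)) (rho w m)
      (hatGF w m 0 (rootRadius w m)).toReal r R d := by
  have hρ := hw.rho_pos m
  have htop := hw.hatGF_ne_top m
  have hs0 : 0 < (hatGF w m 0 (rootRadius w m)).toReal := by
    refine ENNReal.toReal_pos (ne_of_gt ?_) htop
    refine lt_of_lt_of_le ?_ (hw.mul_zero_le_hatGF m _)
    exact ENNReal.mul_pos (hw.rootRadius_pos m).ne' hw.eWeight_zero_pos.ne'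
  -- A point strictly below the radius of Φ is finite even if that radius is infinite, and Φ
  -- converges there.
  obtain ⟨r', hr1, hr2⟩ := exists_between (hw.hatGF_lt_radius m)
  have hr'top := hr2.ne_top
  refine ⟨r'.toReal, ⟨hw.nonneg, hatCoeff_nonneg hw.nonneg _ _, hρ, hs0,
    (ENNReal.toReal_lt_toReal htop hr'top).2 hr1, ?_, ?_, ?_, hR, hg.differentiableOn, ?_, ?_, ?_,
    hw.zero_pos, hw.exists_two_le, hd⟩⟩
  · rw [hw.enorm_eq, ENNReal.ofReal_toReal hr'top]
    exact hw.eSeries_ne_top hr2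
  · have h1 : eSeries (fun n => ENNReal.ofReal (hatCoeff w m (m + 1) n))
        (ENNReal.ofReal (rho w m)) = hatGF w m 0 (rootRadius w m) := by
      rw [eSeries_hatCoeff hw.nonneg, ← hatGF_eq_sum, hw.ofReal_rho]
    rw [← h1]
    exact hasSum_of_eSeries_ne_top (hatCoeff_nonneg hw.nonneg _ _) hρ.le (by rwa [h1])
  · refine lt_of_lt_of_le ?_ (Finset.single_le_sum
      (f := fun k => (m.choose k : ℝ) * momentCoeff w k 0 1)
      (fun _ _ => mul_nonneg (by positivity) (momentCoeff_nonneg hw.nonneg _ _ _))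
      (Finset.mem_range.2 (Nat.succ_pos m)))
    simpa using hw.momentCoeff_zero_one_pos
  · have hnn := derivCoeff_nonneg (hatCoeff_nonneg hw.nonneg m m)
    refine ⟨(eSeries (fun n => ENNReal.ofReal (derivCoeff (hatCoeff w m m) n))
      (ENNReal.ofReal (rho w m))).toReal, ENNReal.toReal_nonneg, ?_⟩
    rw [← cSeries_ofReal_eq hnn hρ.le]
    obtain ⟨t, ht1, ht2⟩ := exists_between hR
    refine (hasDerivAt_cSeries (y := ENNReal.ofReal t) (enorm_lt_ofReal ?_) ?_).deriv
    · rwa [Complex.norm_real, Real.norm_of_nonneg hρ.le]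
    · rw [funext (enorm_eq_ofReal_of_nonneg (hatCoeff_nonneg hw.nonneg m m)),
        eSeries_hatCoeff hw.nonneg]
      exact hg.ne_top t (hρ.le.trans ht1.le) ht2
  · have hH := hw.isRep_hatCoeff m
    have hcomp : IsRep (fun x => eSeries (eWeight w) (hatGF w m 0 x))
        (fun z => cSeries w (cSeries (hatCoeff w m (m + 1)) z)) (rho w m) :=
      hH.eSeries_comp hw.nonneg (r := seriesRadius w) (fun y hy => hw.eSeries_ne_top hy)
        fun x _ hx => hw.hatGF_lt_radius_of_lt m hx
    exact hH.eqOn (((hg.mono hR.le).add ((IsRep.id _).mul hcomp)).congr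
      (hatGF_eq_lower_add_mul hw.nonneg m))
  · have h1 := hasSum_of_eSeries_ne_top (derivCoeff_nonneg hw.nonneg) hs0.le (by
      rw [ENNReal.ofReal_toReal htop, ofReal_derivCoeff hw.nonneg]
      exact hw.ePhiDeriv_ne_top_at m)
    rw [ENNReal.ofReal_toReal htop, ofReal_derivCoeff hw.nonneg] at h1
    have h2 := congrArg ENNReal.toReal (hw.mul_ePhiDeriv_eq_one m)
    rw [ENNReal.toReal_mul, ENNReal.toReal_one] at h2
    have h3 := h1.mul_left (rho w m)
    have h4 : rho w m * (eSeries (derivCoeff fun n => ENNReal.ofReal (w n))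
      (hatGF w m 0 (rootRadius w m))).toReal = 1 := h2
    rwa [h4] at h3

/-- The singularity of `F_m`. -/
theorem sqrtSing_momentFun_zero {d : ℕ}
    (hd : ∀ ζ : ℂ, (∀ k, w k ≠ 0 → ζ ^ k = 1) → ζ ^ d = 1) (m : ℕ) :
    ∃ c : ℝ, c < 0 ∧ SqrtSing (momentFun w m 0) (rho w m) d c := by
  obtain ⟨R, hR, hg⟩ := hw.exists_lower_rep m
  obtain ⟨r, E⟩ := hw.treeEquation hd m hR hg
  obtain ⟨c, hc, hs⟩ := E.sqrtSing
  refine ⟨c, hc, ?_⟩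
  -- F_m is F̂_m minus the lower part, which is regular at ρ_m and leaves the linear coefficient
  -- unchanged.
  have h1 := hs.add (SqrtSing.of_differentiableOn (d := d) E.rho_pos hR hg.differentiableOn.neg)
  rw [add_zero] at h1
  refine h1.congr fun z hz => ?_
  have h2 := ((hg.mono hR.le).add (hw.isRep_moment m 0)).congr (hatGF_eq_lower_add w m)
  have h3 := (hw.isRep_hatCoeff m).eqOn h2 hz
  simp only [Pi.neg_apply]
  rw [h3]
  ring

theorem hatF_eq {l : ℕ} {x : ℝ} (h0 : 0 ≤ x) (hx : x < rho w l) :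
    hatF w l x = (hatGF w l 0 (ENNReal.ofReal x)).toReal := by
  have h1 := hw.ofReal_lt_rootRadius hx
  rw [hatGF_eq_sum, hatF, ENNReal.toReal_sum]
  · refine Finset.sum_congr rfl fun k _ => ?_
    have : rootCoeff w k = momentCoeff w k 0 := by
      funext n
      simp [rootCoeff, momentCoeff]
    rw [ENNReal.toReal_mul, ENNReal.toReal_natCast, this,
      seriesSum_eq_toReal (momentCoeff_nonneg hw.nonneg k 0) h0, momentGF_eq_eSeries hw.nonneg]
  · intro k hk
    refine ENNReal.mul_ne_top (by finiteness) (hw.momentGF_ne_top (h1.trans_le ?_))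
    exact hw.rootRadius_antitone (by have := Finset.mem_range.1 hk; omega)

theorem ofReal_hatF_lt {l : ℕ} {x : ℝ} (h0 : 0 ≤ x) (hx : x < rho w l) :
    ENNReal.ofReal (hatF w l x) < seriesRadius w := by
  have h1 := hw.hatGF_lt_radius_of_lt l hx
  rwa [hw.hatF_eq h0 hx, ENNReal.ofReal_toReal h1.ne_top]

theorem deriv_hatF_eq {l : ℕ} {x : ℝ} (h0 : 0 ≤ x) (hx : x < rho w l) :
    deriv (seriesSum w) (hatF w l x) =
      (ePhiDeriv w (hatGF w l 0 (ENNReal.ofReal x))).toReal := by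
  have h1 := hw.hatGF_lt_radius_of_lt l hx
  have h2 := hw.ofReal_hatF_lt h0 hx
  rw [hw.hatF_eq h0 hx] at h2 ⊢
  rw [hw.deriv_eq ENNReal.toReal_nonneg h2, ENNReal.ofReal_toReal h1.ne_top]

theorem mul_deriv_hatF_lt_one {l : ℕ} {x : ℝ} (h0 : 0 ≤ x) (hx : x < rho w l) :
    x * deriv (seriesSum w) (hatF w l x) < 1 := by
  have h1 := hw.mul_ePhiDeriv_lt_one_of_lt (hw.ofReal_lt_rootRadius hx)
  have h2 := (ENNReal.toReal_lt_toReal h1.ne_top ENNReal.one_ne_top).2 h1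
  rwa [ENNReal.toReal_mul, ENNReal.toReal_ofReal h0, ENNReal.toReal_one, ← hw.deriv_hatF_eq h0 hx]
    at h2

theorem deriv_hatF_nonneg {l : ℕ} {x : ℝ} (h0 : 0 ≤ x) (hx : x < rho w l) :
    0 ≤ deriv (seriesSum w) (hatF w l x) := by
  rw [hw.deriv_hatF_eq h0 hx]
  exact ENNReal.toReal_nonneg

theorem phiFun_ofReal {l : ℕ} {x : ℝ} (h0 : 0 ≤ x) (hx : x < rho w l) :
    phiFun w l x = (deriv (seriesSum w) (hatF w l x) : ℝ) := by
  rw [hw.deriv_hatF_eq h0 hx]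
  exact (hw.isRep_phiFun l).apply_ofReal x h0 hx

/-- By majorization the modulus of zΦ'(F̂_l(z)) is at most the value at |z|, which is below 1. -/
theorem one_sub_mul_phiFun_ne_zero {l : ℕ} {z : ℂ} (hz : z ∈ Metric.ball (0 : ℂ) (rho w l)) :
    1 - z * phiFun w l z ≠ 0 := by
  intro h
  have h1 := ((IsRep.id _).mul (hw.isRep_phiFun l)).norm_le z hz
  have h2 : z * phiFun w l z = 1 := by linear_combination -h
  rw [h2, ← ofReal_norm, ← ofReal_norm, norm_one, ENNReal.ofReal_one] at h1
  exact h1.not_gt (hw.mul_ePhiDeriv_lt_one_of_lt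
    (hw.ofReal_lt_rootRadius (by simpa using hz)))

end Admissible

theorem alpha_zero (w : ℕ → ℝ) (l : ℕ) : alpha w 0 l = 1 := by
  rw [alpha, if_pos rfl]

theorem alpha_of_pos (w : ℕ → ℝ) {m : ℕ} (hm : 1 ≤ m) (l : ℕ) :
    alpha w m l = (1 + rho w (m + l) * ∑ k ∈ Finset.Ico 1 m,
      (m.choose k : ℝ) * alpha w k (m + l - k) *
        deriv (seriesSum w) (hatF w (m + l - k) (rho w (m + l)))) /
      (1 - rho w (m + l) * deriv (seriesSum w) (hatF w l (rho w (m + l)))) := by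
  rw [alpha, if_neg (by omega), Finset.sum_attach (Finset.Ico 1 m) fun k =>
    (m.choose k : ℝ) * alpha w k (m + l - k) *
        deriv (seriesSum w) (hatF w (m + l - k) (rho w (m + l)))]

namespace Admissible

variable {w : ℕ → ℝ} (hw : Admissible w)

include hw

theorem alpha_pos (m l : ℕ) : 0 < alpha w m l := by
  induction m using Nat.strong_induction_on generalizing l with
  | _ m ih =>
    rcases Nat.eq_zero_or_pos m with rfl | hm
    · rw [alpha_zero]
      exact one_pos
    · rw [alpha_of_pos w hm]
      have hρ := hw.rho_pos (m + l)
      refine div_pos (add_pos_of_pos_of_nonneg one_pos (mul_nonneg hρ.le ?_)) ?_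
      · refine Finset.sum_nonneg fun k hk => ?_
        obtain ⟨h1, h2⟩ := Finset.mem_Ico.1 hk
        exact mul_nonneg (mul_nonneg (by positivity) (ih k h2 _).le)
          (hw.deriv_hatF_nonneg hρ.le (hw.rho_strictAnti (by omega)))
      · exact sub_pos.2 (hw.mul_deriv_hatF_lt_one hρ.le (hw.rho_strictAnti (by omega)))

/-- The singularities of the mixed moments. -/
theorem sqrtSing_momentFun {d : ℕ} {c : ℕ → ℝ}
    (hc : ∀ m, SqrtSing (momentFun w m 0) (rho w m) d (c m)) (m l : ℕ) :
    SqrtSing (momentFun w l m) (rho w (m + l)) d ((alpha w m l * c (m + l) : ℝ) : ℂ) := by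
  induction m using Nat.strong_induction_on generalizing l with
  | _ m ih =>
    rcases Nat.eq_zero_or_pos m with rfl | hm
    · rw [alpha_zero, one_mul, zero_add]
      exact hc l
    · obtain ⟨κ, hκ, heq⟩ := hw.exists_moment_eq (l := l) hm
      set N := m + l with hN
      have hρ := hw.rho_pos N
      -- The mixed functions in the sum all have order N, hence by induction the same ρ_N and the
      -- common factor c_N. Their multipliers involve only F̂_{N-j} with j ≥ 1 and are regular at
      -- ρ_N.
      have hsum : SqrtSing (fun z => ∑ j ∈ Finset.Ico 1 m, ((m.choose j : ℂ) *
          (z * phiFun w (N - j) z)) * momentFun w (N - j) j z) (rho w N) d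
          (∑ j ∈ Finset.Ico 1 m, ((m.choose j : ℂ) * (rho w N * phiFun w (N - j) (rho w N))) *
            ((alpha w j (N - j) * c N : ℝ) : ℂ)) := by
        refine SqrtSing.sum hρ fun j hj => ?_
        obtain ⟨h1, h2⟩ := Finset.mem_Ico.1 hj
        have h3 := ih j h2 (N - j)
        rw [show j + (N - j) = N by omega] at h3
        refine h3.mul_left (u := fun z => (m.choose j : ℂ) * (z * phiFun w (N - j) z)) hρ
          (hw.rho_strictAnti (show N - j < N by omega)) ?_
        exact (differentiableOn_const _).fun_mul
          (differentiableOn_id.fun_mul (hw.isRep_phiFun (N - j)).differentiableOn)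
      have hrest : SqrtSing κ (rho w N) d 0 :=
        SqrtSing.of_differentiableOn hρ (hw.rho_strictAnti (show N - 1 < N by omega)) hκ
      have hinv : DifferentiableOn ℂ (fun z => (1 - z * phiFun w l z)⁻¹)
          (Metric.ball 0 (rho w l)) :=
        ((differentiableOn_const _).fun_sub
          (differentiableOn_id.fun_mul (hw.isRep_phiFun l).differentiableOn)).fun_inv
          fun z hz => hw.one_sub_mul_phiFun_ne_zero hz
      have hlN : rho w N < rho w l := hw.rho_strictAnti (by omega)
      -- Dividing by 1 - zΦ'(F̂_l), regular and nonzero at ρ_N since ρ_N < ρ_l, produces the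
      -- denominator of α.
      have hall := (((hc N).add hsum).add hrest).mul_left hρ hlN hinv
      have hmom : SqrtSing (momentFun w l m) (rho w N) d _ := hall.congr fun z hz => by
        have hne := hw.one_sub_mul_phiFun_ne_zero (Metric.ball_subset_ball hlN.le hz)
        rw [eq_inv_mul_iff_mul_eq₀ hne]
        simp only [← mul_assoc] at heq ⊢
        linear_combination heq z hz
      convert hmom using 1
      · rw [alpha_of_pos w hm, ← hN, hw.phiFun_ofReal hρ.le hlN]
        have h1 : ∑ j ∈ Finset.Ico 1 m, ((m.choose j : ℂ) *
            (rho w N * phiFun w (N - j) (rho w N))) * ((alpha w j (N - j) * c N : ℝ) : ℂ) =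
            ((rho w N * (∑ k ∈ Finset.Ico 1 m, (m.choose k : ℝ) * alpha w k (N - k) *
              deriv (seriesSum w) (hatF w (N - k) (rho w N))) * c N : ℝ) : ℂ) := by
          rw [Finset.mul_sum, Finset.sum_mul, Complex.ofReal_sum]
          refine Finset.sum_congr rfl fun j hj => ?_
          obtain ⟨h1, h2⟩ := Finset.mem_Ico.1 hj
          rw [hw.phiFun_ofReal hρ.le (hw.rho_strictAnti (by omega))]
          push_cast
          ring
        rw [h1]
        push_cast
        ring

end Admissible

end OrderedTree

/-! ### Asymptotics of the moments -/

/-- A relative error bound of order `1 / n` for large `n` extends to all `n ≥ 1`. -/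
theorem exists_bound_of_large {P : ℕ → Prop} {q : ℕ → ℝ} {C : ℝ} {n₀ : ℕ}
    (h : ∀ n ≥ n₀, P n → |q n| ≤ C / n) : ∃ C', ∀ n, 1 ≤ n → P n → |q n| ≤ C' / n := by
  -- The finitely many small indices are absorbed by adding their k |q k| to the constant.
  refine ⟨|C| + ∑ k ∈ Finset.range n₀, (k : ℝ) * |q k|, fun n hn hP => ?_⟩
  have hn0 : (0 : ℝ) < n := by exact_mod_cast hn
  have hnn : ∀ k ∈ Finset.range n₀, 0 ≤ (k : ℝ) * |q k| := fun k _ => by positivity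
  rw [le_div_iff₀ hn0]
  rcases le_or_gt n₀ n with hle | hlt
  · have h1 := h n hle hP
    rw [le_div_iff₀ hn0] at h1
    linarith [le_abs_self C, Finset.sum_nonneg hnn]
  · have h1 := Finset.single_le_sum hnn (Finset.mem_range.2 hlt)
    linarith [abs_nonneg C]

/-- The quotient of two quantities that are `1 + O(1 / n)`. -/
theorem abs_div_sub_one_le {A B C C₀ n : ℝ} (hn : 0 < n) (hC₀ : 2 * C₀ ≤ n)
    (hA : |A - 1| ≤ C / n) (hB : |B - 1| ≤ C₀ / n) : |A / B - 1| ≤ 2 * (C + C₀) / n := by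
  have h1 : C₀ / n ≤ 1 / 2 := by
    rw [div_le_iff₀ hn]
    linarith
  have hB2 : 1 / 2 ≤ B := by linarith [(abs_le.1 hB).1]
  have hB0 : 0 < B := by linarith
  have h2 : A / B - 1 = ((A - 1) - (B - 1)) / B := by
    field_simp
    ring
  rw [h2, abs_div, abs_of_pos hB0, div_le_iff₀ hB0]
  have h3 : |(A - 1) - (B - 1)| ≤ C / n + C₀ / n := (abs_sub _ _).trans (add_le_add hA hB)
  have h4 : 0 ≤ C / n + C₀ / n := (abs_nonneg _).trans h3
  have h5 : 2 * (C + C₀) / n = 2 * (C / n + C₀ / n) := by ring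
  rw [h5]
  nlinarith

namespace OrderedTree

theorem totalWeight_eq (w : ℕ → ℝ) (n : ℕ) : totalWeight w n = momentCoeff w 0 0 n := by
  simp [totalWeight, momentCoeff]

theorem treeExp_eq (w : ℕ → ℝ) (l m n : ℕ) :
    treeExp w n (fun T => (T.numRootSubtrees : ℝ) ^ l * (T.numSubtrees : ℝ) ^ m) =
      momentCoeff w l m n / momentCoeff w 0 0 n := by
  rw [treeExp, ← totalWeight_eq, momentCoeff, Finset.sum_div]
  refine Finset.sum_congr rfl fun T _ => ?_
  rw [treeProb]
  ring

namespace Admissible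

variable {w : ℕ → ℝ} (hw : Admissible w)

include hw

theorem exists_coeff_bound {d : ℕ} (hd0 : 0 < d) (hd : ∀ k, w k ≠ 0 → d ∣ k) {l m : ℕ} {c : ℝ}
    (hc : c ≠ 0) (h : SqrtSing (momentFun w l m) (rho w (m + l)) d c) :
    ∃ C, ∀ n ≥ 3, n ≡ 1 [MOD d] →
      |momentCoeff w l m n * rho w (m + l) ^ n /
        (d * (√(rho w (m + l)) * c) * sqrtCoeff n) - 1| ≤ C / n := by
  have hρ := hw.rho_pos (m + l)
  have hsum : ∀ z ∈ Metric.ball (0 : ℂ) (rho w (m + l)),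
      HasSum (fun n => (momentCoeff w l m n : ℂ) * z ^ n) (momentFun w l m z) := by
    intro z hz
    have h1 := (hw.isRep_moment l m).enorm_ne_top (z := z) (by rwa [add_comm l m])
    rw [momentGF_eq_eSeries hw.nonneg,
      ← funext (enorm_eq_ofReal_of_nonneg (momentCoeff_nonneg hw.nonneg l m))] at h1
    exact (summable_cSeries le_rfl h1).hasSum
  obtain ⟨C, hC⟩ := h.coeff_asymptotics hρ hd0 hsum fun n hn =>
    momentCoeff_modEq hd (l := l) (m := m) (by exact_mod_cast hn)
  set K : ℝ := d * (√(rho w (m + l)) * c) with hK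
  have hK0 : K ≠ 0 := mul_ne_zero (by exact_mod_cast hd0.ne')
    (mul_ne_zero (Real.sqrt_pos.2 hρ).ne' hc)
  refine ⟨C / |K|, fun n hn hnd => ?_⟩
  have hs : sqrtCoeff n ≠ 0 := by
    obtain ⟨k, rfl⟩ := Nat.exists_eq_add_of_le' (show 1 ≤ n by omega)
    exact (sqrtCoeff_succ_neg k).ne
  have h1 := hC n hn hnd
  have h2 : ‖(momentCoeff w l m n : ℂ) * (rho w (m + l) : ℂ) ^ n -
      d * ((√(rho w (m + l)) : ℝ) * (c : ℂ)) * (sqrtCoeff n : ℂ)‖ =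
      |momentCoeff w l m n * rho w (m + l) ^ n - K * sqrtCoeff n| := by
    rw [← Real.norm_eq_abs, ← Complex.norm_real, hK]
    push_cast
    rfl
  rw [h2] at h1
  have h3 : momentCoeff w l m n * rho w (m + l) ^ n / (K * sqrtCoeff n) - 1 =
      (momentCoeff w l m n * rho w (m + l) ^ n - K * sqrtCoeff n) / (K * sqrtCoeff n) := by
    field_simp
  rw [h3, abs_div, abs_mul, div_le_iff₀ (by positivity)]
  refine h1.trans (le_of_eq ?_)
  have : |K| ≠ 0 := abs_ne_zero.2 hK0
  field_simp

/-- The expectation is a quotient of two coefficients. The factors d and `sqrtCoeff n` are common to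
both asymptotics and cancel, leaving a pure exponential. -/
theorem hasExpAsymptotics {d : ℕ} (hd0 : 0 < d) (hd : ∀ k, w k ≠ 0 → d ∣ k) {c : ℕ → ℝ}
    (hcneg : ∀ m, c m < 0) (hc : ∀ m, SqrtSing (momentFun w m 0) (rho w m) d (c m)) (l m : ℕ) :
    HasExpAsymptotics w (fun T => (T.numRootSubtrees : ℝ) ^ l * (T.numSubtrees : ℝ) ^ m)
      (alpha w m l * (√(rho w (m + l)) * c (m + l) / (√(rho w 0) * c 0)))
      (rho w 0 / rho w (m + l)) := by
  obtain ⟨C, hC⟩ := hw.exists_coeff_bound hd0 hd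
    (mul_ne_zero (hw.alpha_pos m l).ne' (hcneg (m + l)).ne) (hw.sqrtSing_momentFun hc m l)
  obtain ⟨C₀, hC₀⟩ := hw.exists_coeff_bound hd0 hd (l := 0) (m := 0) (hcneg 0).ne (hc 0)
  -- The coefficient bounds start at 3, and n ≥ 2 C₀ keeps the normalized denominator at least 1/2.
  refine exists_bound_of_large (n₀ := max 3 ⌈2 * C₀⌉₊) (C := 2 * (C + C₀)) fun n hn hT => ?_
  rw [totalWeight_eq] at hT
  -- Existence of the random tree forces n ≡ 1 mod d, the residue class covered by the coefficient
  -- asymptotics.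
  have hnd := momentCoeff_modEq hd hT
  have hn3 : 3 ≤ n := (le_max_left _ _).trans hn
  have hnC : 2 * C₀ ≤ n := (Nat.le_ceil _).trans (by exact_mod_cast (le_max_right _ _).trans hn)
  have hn0 : (0 : ℝ) < n := by exact_mod_cast (show 0 < n by omega)
  have hmain := abs_div_sub_one_le hn0 hnC (hC n hn3 hnd) (hC₀ n hn3 hnd)
  have hs : sqrtCoeff n ≠ 0 := by
    obtain ⟨k, rfl⟩ := Nat.exists_eq_add_of_le' (show 1 ≤ n by omega)
    exact (sqrtCoeff_succ_neg k).ne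
  have e1 := (hw.alpha_pos m l).ne'
  have e2 := (hcneg (m + l)).ne
  have e3 := (hcneg 0).ne
  have e4 := (Real.sqrt_pos.2 (hw.rho_pos (m + l))).ne'
  have e5 := (Real.sqrt_pos.2 (hw.rho_pos 0)).ne'
  have e6 := (hw.rho_pos (m + l)).ne'
  have e7 := (hw.rho_pos 0).ne'
  have e8 : (d : ℝ) ≠ 0 := by exact_mod_cast hd0.ne'
  rw [add_zero] at hmain
  convert hmain using 3
  rw [treeExp_eq, div_pow]
  field_simp

end Admissible

end OrderedTree

/-! ### The two sets of assumptions -/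

theorem SimplyGeneratedAssumptions.admissible {w : ℕ → ℝ} (h : SimplyGeneratedAssumptions w) :
    OrderedTree.Admissible w :=
  ⟨h.nonneg, h.zero_pos, h.radius_pos, h.deriv_limit⟩

/-- If ξ ≥ 1 almost surely, mean one forces ξ = 1 almost surely, against the positive variance. -/
theorem GaltonWatsonAssumptions.zero_ne_zero {p : PMF ℕ} (h : GaltonWatsonAssumptions p) :
    p 0 ≠ 0 := by
  intro h0
  have hint : Integrable (fun i : ℕ => (i : ℝ)) p.toMeasure :=
      h.variance_finite.integrable one_le_two
  have hpos : ∀ᵐ i ∂p.toMeasure, 1 ≤ i := by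
    rw [ae_iff]
    have : {i : ℕ | ¬1 ≤ i} = {0} := by
      ext i
      simp
    rw [this, PMF.toMeasure_apply_singleton _ _ (measurableSet_singleton 0), h0]
  have hnn : 0 ≤ᵐ[p.toMeasure] fun i : ℕ => (i : ℝ) - 1 := by
    filter_upwards [hpos] with i hi
    have : (1 : ℝ) ≤ i := by exact_mod_cast hi
    simpa using this
  have hzero : ∫ i : ℕ, ((i : ℝ) - 1) ∂p.toMeasure = 0 := by
    rw [integral_sub hint (integrable_const 1), h.mean_one]
    simp
  have hae := (integral_eq_zero_iff_of_nonneg_ae hnn (hint.sub (integrable_const 1))).1 hzero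
  have hconst : (fun i : ℕ => (i : ℝ)) =ᵐ[p.toMeasure] fun _ => 1 := by
    filter_upwards [hae] with i hi
    simp only [Pi.zero_apply] at hi
    linarith
  have hvar := h.variance_pos
  rw [variance_congr hconst, variance_eq_integral aemeasurable_const] at hvar
  simp at hvar

/-- The probabilities sum to 1, so Φ converges at 1 and its radius is at least 1. -/
theorem GaltonWatsonAssumptions.admissible {p : PMF ℕ} (h : GaltonWatsonAssumptions p) :
    OrderedTree.Admissible fun i => (p i).toReal := by
  refine ⟨fun i => ENNReal.toReal_nonneg,
    ENNReal.toReal_pos h.zero_ne_zero (p.apply_ne_top 0), ?_, h.deriv_limit⟩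
  refine lt_of_lt_of_le one_pos (le_seriesRadius_of_eSeries_ne_top ENNReal.one_ne_top ?_)
  have h1 : eSeries (fun n => ‖(p n).toReal‖ₑ) 1 = 1 := by
    refine Eq.trans ?_ p.tsum_coe
    refine tsum_congr fun n => ?_
    beta_reduce
    rw [one_pow, mul_one, Real.enorm_of_nonneg ENNReal.toReal_nonneg,
      ENNReal.ofReal_toReal (p.apply_ne_top n)]
  rw [h1]
  exact ENNReal.one_ne_top

theorem theorem3p4 (w : ℕ → ℝ)
    (hw : SimplyGeneratedAssumptions w ∨
      ∃ p : PMF ℕ, GaltonWatsonAssumptions p ∧ w = fun i => (p i).toReal) :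
    -- the radii of convergence `ρ_m` are positive, finite and strictly decreasing, and the
    -- quantities in the recursion for `α_{m,ℓ}` are well defined
    (∀ m, 0 < rootRadius w m ∧ rootRadius w m < ⊤) ∧
    StrictAnti (rootRadius w) ∧
    (∀ m l : ℕ, 1 ≤ m →
      ENNReal.ofReal (hatF w l (rho w (m + l))) < seriesRadius w ∧
      rho w (m + l) * deriv (seriesSum w) (hatF w l (rho w (m + l))) < 1) ∧
    -- the moments
    ∃ (γ τ : ℕ → ℝ) (γ' : ℕ → ℕ → ℝ),
      (∀ m, 0 < γ m) ∧ τ 0 = 1 ∧ StrictMono τ ∧ (∀ m, τ m = rho w 0 / rho w m) ∧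
      (∀ m, HasExpAsymptotics w (fun T => (T.numRootSubtrees : ℝ) ^ m) (γ m) (τ m)) ∧
      (∀ l m, 0 < γ' l m) ∧ (∀ l m, γ' l m = alpha w m l * γ (l + m)) ∧
      (∀ m, 1 ≤ m →
        HasExpAsymptotics w (fun T => (T.numSubtrees : ℝ) ^ m) (γ' 0 m) (τ m)) ∧
      (∀ l m, HasExpAsymptotics w
        (fun T => (T.numRootSubtrees : ℝ) ^ l * (T.numSubtrees : ℝ) ^ m) (γ' l m) (τ (l + m))) := by
  have ha : OrderedTree.Admissible w := by
    rcases hw with h | ⟨p, h, rfl⟩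
    · exact h.admissible
    · exact h.admissible
  obtain ⟨d, hd0, hd, hdζ⟩ := exists_period ha.exists_two_le
  choose c hcneg hc using ha.sqrtSing_momentFun_zero hdζ
  have hasym := ha.hasExpAsymptotics hd0 hd hcneg hc
  -- γ_m compares the linear coefficients of F_m and F_0 after rescaling to the unit disc, which
  -- contributes the factors √ρ; both are negative.
  have hγ : ∀ m, 0 < √(rho w m) * c m / (√(rho w 0) * c 0) := fun m =>
    div_pos_of_neg_of_neg (mul_neg_of_pos_of_neg (Real.sqrt_pos.2 (ha.rho_pos m)) (hcneg m))
      (mul_neg_of_pos_of_neg (Real.sqrt_pos.2 (ha.rho_pos 0)) (hcneg 0))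
  refine ⟨fun m => ⟨ha.rootRadius_pos m, ha.rootRadius_lt_top m⟩, ha.rootRadius_strictAnti,
    fun m l hm => ?_, fun m => √(rho w m) * c m / (√(rho w 0) * c 0),
    fun m => rho w 0 / rho w m,
    fun l m => alpha w m l * (√(rho w (l + m)) * c (l + m) / (√(rho w 0) * c 0)),
    hγ, div_self (ha.rho_pos 0).ne', fun k m h => ?_, fun _ => rfl, fun m => ?_,
    fun l m => mul_pos (ha.alpha_pos m l) (hγ _), fun _ _ => rfl, fun m _ => ?_, fun l m => ?_⟩
  · have h0 := (ha.rho_pos (m + l)).le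
    have h1 : rho w (m + l) < rho w l := ha.rho_strictAnti (by omega)
    exact ⟨ha.ofReal_hatF_lt h0 h1, ha.mul_deriv_hatF_lt_one h0 h1⟩
  · exact div_lt_div_of_pos_left (ha.rho_pos 0) (ha.rho_pos m) (ha.rho_strictAnti h)
  · simpa [OrderedTree.alpha_zero] using hasym m 0
  · simpa using hasym 0 m
  · have := hasym l m
    rwa [add_comm m l] at this
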